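/- Let $k$ be an algebraically closed field of characteristic $0$, let $s \ge t \ge 2$ be integers, and let $f = y^t - x^s \in R = k[[x,y]]$. Let $\delta_1,\dots,\delta_d \in R$ be representatives of a $k$-basis of the space of first-order deformations $\mathrm{Def}^1(f) = R/(f, \partial f/\partial x, \partial f/\partial y)$. An $r$-parameter deformation $X/B$ of $f$ (for $r = 1, 2$) is given by scalars $a_{ji} \in k$: the base has coordinate ring $\mathcal O_B = k[[t_1,\dots,t_r]]$, and $\mathcal O_X = \mathcal O_B[[x,y]]/(F)$, where $F = f + \sum_{j} t_j \sum_i a_{ji}\delta_i$. The singular locus $\mathrm{Sing}(X/B)$ is cut out in $X$ by $\partial F/\partial x, \partial F/\partial y$, and $X/B$ is called admissible if $\mathrm{Sing}(X/B)$ has codimension at least $2$ in $X$. The $m$-th order module of relative principal parts is the $\mathcal O_X$-module $$\mathcal P^m_{X/B} = (\mathcal O_X \widehat\otimes_{\mathcal O_B} \mathcal O_X)/I_\Delta^m = \mathcal O_B[[x,y,u,v]]/\big(F(x,y),\, F(u,v),\, (u-x,v-y)^m\big),$$ with module structure through the left factor. For a list $\overline\tau = (\tau_1,\dots,\tau_{m-1})$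 of elements of $\mathcal P^m_{X/B}$, let $I_{\overline\tau} \subset \mathcal O_X$ be the ideal of the degeneracy locus of the induced map $\mathcal O_X^{m-1} \to (\mathcal P^m_{X/B})^{\vee\vee}$, i.e. the ideal generated by all determinants $\det(\phi_i(\tau_j))$ with $\phi_1,\dots,\phi_{m-1} \in (\mathcal P^m_{X/B})^\vee$ (when $(\mathcal P^m_{X/B})^\vee$ is free, this is the ideal of maximal minors of $(e_i(\tau_j))$ for any basis $(e_i)$ of it). The $m$-th order weight-$2$ type-(a) automatic degeneracy of $f$ is $$\mathrm{AD}^m_{(2)}(f) = \min_{X/B}\ \min_{\overline\tau}\ \dim_k \mathcal O_X/I_{\overline\tau},$$ the minimum being over all admissible $1$-parameter deformations $X/B$ of $f$ and all lists $\overline\tau$ of $m-1$ elements of $\mathcal P^m_{X/B}$. The number of $m$-th order weight-$2$ type-(a) inflection points limiting to the singularity in a general $2$-parameter deformation is defined as follows: for a general $2$-parameter deformation $X/B$ (that is, for general scalars $a_{ji}$) and a general list $\overline\tau$ of $m-1$ elements of $\mathcal P^m_{X/B}$, let $\overline H$ be the scheme-theoretic closure in $X$ of the degeneracy locus of $\overline\tau$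 on $X \setminus \mathrm{Sing}(X/B)$; the number is the intersection multiplicity at the origin of $\overline H$ with the total space $\{t_1 = 0\} \subset X$ of a $1$-parameter subdeformation, i.e. $\dim_k \mathcal O_X/(I_{\overline H} + (t_1))$. Then $$\mathrm{AD}^3_{(2)}(y^t - x^s) = (2t-3)(s-1),$$ and the number of third-order weight-$2$ type-(a) inflection points limiting to the singularity $y^t - x^s = 0$ in a general $2$-parameter deformation is $(t-2)(s-1)$. -/

import Mathlib

namespace AutDeg

open MvPowerSeries

noncomputable section

/-- A property `Q` holds for a general element of the (possibly infinite-dimensional) `k`-vector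
space `V`: it holds on a nonempty subset of `V` defined by the non-vanishing of a polynomial in
finitely many linear coordinates. -/
def HoldsForGeneral (k : Type*) [Field k] {V : Type*} [AddCommGroup V] [Module k V]
    (Q : V → Prop) : Prop :=
  ∃ (n : ℕ) (L : V →ₗ[k] (Fin n → k)) (p : MvPolynomial (Fin n) k),
    (∃ v, MvPolynomial.eval (L v) p ≠ 0) ∧ ∀ v, MvPolynomial.eval (L v) p ≠ 0 → Q v

/-- The dimension of a vector space, as an element of `ℕ ∪ {∞}`. -/
def edim (k : Type*) [Field k] (V : Type*) [AddCommGroup V] [Module k V] : ℕ∞ :=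
  Cardinal.toENat (Module.rank k V)

/-! ### Families of plane curve germs -/

section Family

/-- The coordinate ring `𝒪_X = T[[x, y]] / (F)` of the total space of the family of plane curve
germs `F = 0` over the base with coordinate ring `T`. -/
abbrev TotalRing {T : Type*} [CommRing T] (F : MvPowerSeries (Fin 2) T) : Type _ :=
  MvPowerSeries (Fin 2) T ⧸ Ideal.span {F}

/-- The ideal of `T[[x, y, u, v]]` generated by `F(x, y)`, `F(u, v)` and `(u - x, v - y) ^ m`.
The variables `x, y` are `X (inl 0), X (inl 1)`; the variables `u, v` are
`X (inr 0), X (inr 1)`. -/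
def principalPartsIdeal {T : Type*} [CommRing T] (F : MvPowerSeries (Fin 2) T) (m : ℕ) :
    Ideal (MvPowerSeries (Fin 2 ⊕ Fin 2) T) :=
  Ideal.span {rename Sum.inl F, rename Sum.inr F} ⊔
    Ideal.span (Set.range fun i : Fin 2 =>
      (X (Sum.inr i) - X (Sum.inl i) : MvPowerSeries (Fin 2 ⊕ Fin 2) T)) ^ m

/-- The (complete) module of relative principal parts
`𝒫^m_{X/B} = (𝒪_X ⊗_T 𝒪_X) / I_Δ ^ m` of order `m`, where the tensor product is the completed one:
`T[[x, y, u, v]] / (F(x, y), F(u, v), (u - x, v - y) ^ m)`. -/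
abbrev PrincipalParts {T : Type*} [CommRing T] (F : MvPowerSeries (Fin 2) T) (m : ℕ) : Type _ :=
  MvPowerSeries (Fin 2 ⊕ Fin 2) T ⧸ principalPartsIdeal F m

/-- The structure map `𝒪_X → 𝒫^m_{X/B}` of the left factor. -/
def leftMap {T : Type*} [CommRing T] (F : MvPowerSeries (Fin 2) T) (m : ℕ) :
    TotalRing F →+* PrincipalParts F m :=
  Ideal.quotientMap (principalPartsIdeal F m)
    (rename (R := T) (Sum.inl : Fin 2 → Fin 2 ⊕ Fin 2)).toRingHom
    (by
      rw [Ideal.span_singleton_le_iff_mem, Ideal.mem_comap]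
      exact (le_sup_left : _ ≤ principalPartsIdeal F m) (Ideal.subset_span (Or.inl rfl)))

/-- `𝒫^m_{X/B}` is an `𝒪_X`-module through the left factor. -/
instance instAlgebraPrincipalParts {T : Type*} [CommRing T] (F : MvPowerSeries (Fin 2) T) (m : ℕ) :
    Algebra (TotalRing F) (PrincipalParts F m) :=
  (leftMap F m).toAlgebra

/-- The ideal of `𝒪_X` cutting out the locus `Sing(X/B)` where `X → B` is not smooth; it is
generated by the partial derivatives of `F` along the fibres. -/
def singIdeal {T : Type*} [CommRing T] (F : MvPowerSeries (Fin 2) T) : Ideal (TotalRing F) :=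
  Ideal.span (Set.range fun i : Fin 2 => Ideal.Quotient.mk (Ideal.span {F}) (pderiv T i F))

/-- The family `X/B` is admissible: `Sing(X/B)` has codimension (at least) two in `X`. For the
deformations of a reduced plane curve germ below, the other requirements on an admissible family
(flatness, fibres that are reduced local complete intersections of pure dimension one, and
normality of the total space) are automatic or follow from this one. -/
def Admissible {T : Type*} [CommRing T] (F : MvPowerSeries (Fin 2) T) : Prop :=
  2 ≤ (singIdeal F).height

/-- The ideal of the degeneracy locus of the map `A ^ n → P → Pᵛᵛ` given by a list
`τ = (τ_1, …, τ_n)` of elements of an `A`-module `P`, where `n` is at most the rank of `Pᵛᵛ`: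
the ideal generated by all determinants `det (φ_i (τ_j))` with `φ_1, …, φ_n ∈ Pᵛ`. If `Pᵛ` is free,
this is the ideal of maximal minors of the matrix `(e_i (τ_j))` for any basis `(e_i)` of `Pᵛ`,
see `degeneracyIdeal_eq_span_minors`. -/
def degeneracyIdeal (A : Type*) [CommRing A] {P : Type*} [AddCommGroup P] [Module A P] {n : ℕ}
    (τ : Fin n → P) : Ideal A :=
  Ideal.span (Set.range fun φ : Fin n → Module.Dual A P =>
    (Matrix.of fun i j => φ i (τ j)).det)

theorem degeneracyIdeal_eq_span_minors (A : Type*) [CommRing A] {P : Type*} [AddCommGroup P]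
    [Module A P] {m n : ℕ} (e : Module.Basis (Fin m) A (Module.Dual A P)) (τ : Fin n → P) :
    degeneracyIdeal A τ = Ideal.span (Set.range fun r : Fin n → Fin m =>
      ((Matrix.of fun (i : Fin m) (j : Fin n) => e i (τ j)).submatrix r id).det) := by
  classical
  apply le_antisymm
  · refine Ideal.span_le.2 ?_
    rintro _ ⟨φ, rfl⟩
    let E : Module.Dual A P →ₗ[A] (Fin n → A) := LinearMap.pi fun j => LinearMap.applyₗ (τ j)
    have h : (Matrix.of fun i j => φ i (τ j)).det =
        Matrix.detRowAlternating (R := A) (fun i => ∑ b, e.repr (φ i) b • E (e b)) := by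
      congr 1
      ext i j
      have h1 : φ i (τ j) = (∑ b, e.repr (φ i) b • e b) (τ j) := by rw [e.sum_repr]
      rw [Matrix.of_apply, h1, LinearMap.sum_apply]
      simp [E]
    simp only [h]
    have h2 := (Matrix.detRowAlternating (n := Fin n) (R := A)).toMultilinearMap.map_sum
      (fun i b => e.repr (φ i) b • E (e b))
    simp only [AlternatingMap.coe_multilinearMap] at h2
    rw [h2]
    refine Ideal.sum_mem _ fun r _ => ?_
    have h3 := (Matrix.detRowAlternating (n := Fin n) (R := A)).toMultilinearMap.map_smul_univ
      (fun i => e.repr (φ i) (r i)) (fun i => E (e (r i)))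
    simp only [AlternatingMap.coe_multilinearMap] at h3
    rw [h3]
    exact Ideal.mul_mem_left _ _ (Ideal.subset_span ⟨r, rfl⟩)
  · refine Ideal.span_le.2 ?_
    rintro _ ⟨r, rfl⟩
    exact Ideal.subset_span ⟨fun i => e (r i), rfl⟩

end Family

/-! ### Linear deformations of a plane curve germ -/

section Deformation

variable {k : Type*} [Field k]

/-- `(δ_i)` represents a `k`-basis of the space of first-order deformations
`Def¹(f) = k[[x, y]] / (f, ∂f/∂x, ∂f/∂y)` of the plane curve germ `f = 0`. -/
def IsDefBasis (f : MvPowerSeries (Fin 2) k) {d : ℕ} (δ : Fin d → MvPowerSeries (Fin 2) k) :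
    Prop :=
  LinearIndependent k
      (fun i => Ideal.Quotient.mk (Ideal.span {f, pderiv k 0 f, pderiv k 1 f}) (δ i)) ∧
    Submodule.span k (Set.range
      fun i => Ideal.Quotient.mk (Ideal.span {f, pderiv k 0 f, pderiv k 1 f}) (δ i)) = ⊤

/-- The equation `F = f + ∑_j t_j (∑_i a_{j i} δ_i)` over `k[[t_1, …, t_r]]` of the `r`-parameter
deformation of `f` obtained from the versal deformation `f + ∑_i α_i δ_i` by the substitution
`α_i ↦ ∑_j a_{j i} t_j`. -/
def deformation (f : MvPowerSeries (Fin 2) k) {d : ℕ} (δ : Fin d → MvPowerSeries (Fin 2) k)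
    {r : ℕ} (a : Fin r → Fin d → k) : MvPowerSeries (Fin 2) (MvPowerSeries (Fin r) k) :=
  map C f + ∑ j, C (X j) * map C (∑ i, a j i • δ i)

/-- The `m`-th order weight-2 type-(a) automatic degeneracy of `f`: the minimum of
`dim_k 𝒪_X / I_τ` over all (admissible) one-parameter deformations `X/B` of `f` and all lists
`τ` of `m - 1` elements of `𝒫^m_{X/B}`. -/
def autDegTypeA (f : MvPowerSeries (Fin 2) k) {d : ℕ} (δ : Fin d → MvPowerSeries (Fin 2) k)
    (m : ℕ) : ℕ∞ :=
  ⨅ (a : Fin 1 → Fin d → k) (_ : Admissible (deformation f δ a))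
    (τ : Fin (m - 1) → PrincipalParts (deformation f δ a) m),
    edim k (TotalRing (deformation f δ a) ⧸ degeneracyIdeal (TotalRing (deformation f δ a)) τ)

/-- The ideal of the scheme-theoretic closure of `V(I) \ V(J)`. -/
def closureIdeal {A : Type*} [CommRing A] (I J : Ideal A) : Ideal A :=
  ⨆ n : ℕ, Submodule.colon I ((J ^ n : Ideal A) : Set A)

/-- For the two-parameter deformation `X → B` of `f` with coefficients `a`, with parameters
`t_0, t_1`, and a list `τ` of elements of `𝒫^m_{X/B}`, let `H` be the degeneracy locus of `τ` on the
smooth locus of `X → B`. This is the intersection multiplicity at the origin of the closure of `H`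
and the total space `t_0 = 0` of a one-parameter subdeformation. -/
def limitingMultiplicity (f : MvPowerSeries (Fin 2) k) {d : ℕ}
    (δ : Fin d → MvPowerSeries (Fin 2) k) (a : Fin 2 → Fin d → k) (m : ℕ) {n : ℕ}
    (τ : Fin n → PrincipalParts (deformation f δ a) m) : ℕ∞ :=
  edim k (TotalRing (deformation f δ a) ⧸
    (closureIdeal (degeneracyIdeal (TotalRing (deformation f δ a)) τ)
        (singIdeal (deformation f δ a)) ⊔
      Ideal.span {Ideal.Quotient.mk (Ideal.span {deformation f δ a}) (C (X 0))}))

/-- The number of `m`-th order weight-2 type-(a) inflection points limiting to the singularity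
`f = 0` in a general two-parameter deformation is `N`: for a general two-parameter deformation
`X/B` and a general list of `m - 1` elements of `𝒫^m_{X/B}`, the closure of the degeneracy locus on
the smooth locus of `X/B` meets the total space of the one-parameter subdeformation
with multiplicity `N`. -/
def NumLimitingTypeA (f : MvPowerSeries (Fin 2) k) {d : ℕ}
    (δ : Fin d → MvPowerSeries (Fin 2) k) (m : ℕ) (N : ℕ∞) : Prop :=
  HoldsForGeneral k fun a : Fin 2 → Fin d → k =>
    HoldsForGeneral k fun τ : Fin (m - 1) → PrincipalParts (deformation f δ a) m =>
      limitingMultiplicity f δ a m τ = N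

end Deformation

end

end AutDeg

/-! Write D = (s-1)(t-1) and give the parameters t_j weight D, x weight t-1 and y weight s-1. In
these weights F_x and F_y have order at least D, with leading forms -s x^(s-1) and t y^(t-1) plus
linear forms in the parameters. F has order at least D, with leading form ∑ η_j(0) t_j, because x^s
and y^t are heavier than D. Both numbers are weighted Bezout numbers.

The ideals involved are made explicit as follows. If F, F_x, F_y is a regular sequence, the dual of
the third-order principal parts is generated by the iterates 1, H, H² on the diagonal of the
Hamiltonian derivation H = F_y ∂_u - F_x ∂_v, which kills F(u,v) (`exists_dual_eq`; this is Koszul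
exactness used in orders two and one). So the degeneracy ideal of a pair g_0, g_1 is generated by
the three 2×2 minors of the matrix of H^i g_j on the diagonal. If g_0 is a unit there, the minors
M_01 and M_02 suffice. When moreover a first-order Wronskian is a unit, the ideal becomes (F, G, F_x
K) with G = F_y - ρ F_x and K = F_yy - ρ F_yx - ρ F_xy + ρ² F_xx + σ F_x (`exists_span_minors_eq`).
G has order at least D and K has order at least (t-2)(s-1).

Lower bounds come from counting monomials. If as many elements as there are variables have weights
at least m_i w_i, where w_i are the weights of the variables, then the colength of the ideal they
generate is at least ∏ m_i (`prod_le_of_forall_span`). For F, M_01, M_02 the factors are 1, s-1,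
2t-3. When g_0 is not a unit on the diagonal, a small constant is added to it; ranks do not drop
under a general perturbation, so the colength does not grow (`exists_perturbed_span`). Admissibility
enters only to make F, F_x, F_y regular: the singular locus is then supported at the origin.

Upper bounds come from rewriting: the leading forms turn every monomial into standard ones up to
heavier terms, and Nakayama's lemma removes the heavier terms (`top_le_span_sup_of_forall_mon`). For
the automatic degeneracy one splits (F, G, F_x K) into (F, G, F_x) = (F, F_x, F_y) and (F, G, K),
which contribute (s-1)(t-1) and (s-1)(t-2); the sum is (2t-3)(s-1).

In a general two-parameter family F_x is regular modulo (F, G, K)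
(`isWeaklyRegular_slope_cofactor`). Since F_y = G + ρ F_x, saturating (F, G, F_x K) by the singular
ideal gives exactly (F, G, K) (`closureIdeal_degeneracyIdeal`). Cutting with one parameter leaves a
complete intersection whose colength is (t-2)(s-1) by the same two bounds (`edim_eq_of_comap_eq`).

When s = t both terms of the leading form of K have the same weight. The rewriting then needs two
binary forms without common zero, which is the source of the inequalities between powers below. -/

namespace AutDeg

open MvPowerSeries RingTheory.Sequence

noncomputable section


/-! ### Filtrations by weighted monomials -/

section Weights

variable {ι : Type*} [Fintype ι]

/-- The weight of an exponent vector. -/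
def wt (w β : ι → ℕ) : ℕ := ∑ i, w i * β i

theorem wt_add (w β γ : ι → ℕ) : wt w (β + γ) = wt w β + wt w γ := by
  simp [wt, mul_add, Finset.sum_add_distrib]

@[simp] theorem wt_zero (w : ι → ℕ) : wt w 0 = 0 := by simp [wt]

@[simp] theorem wt_single [DecidableEq ι] (w : ι → ℕ) (i : ι) (n : ℕ) :
    wt w (Pi.single i n) = w i * n := by
  simp only [wt]
  rw [Finset.sum_eq_single i]
  · simp
  · intro j _ hj; simp [Pi.single_eq_of_ne hj]
  · simp

theorem le_wt {w : ι → ℕ} (hw : ∀ i, 0 < w i) (β : ι → ℕ) (i : ι) : β i ≤ wt w β :=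
  (Nat.le_mul_of_pos_left _ (hw i)).trans
    (Finset.single_le_sum (f := fun i => w i * β i) (fun _ _ => Nat.zero_le _) (Finset.mem_univ i))

/-- The exponent vectors of weight less than `N`. -/
def lowExp (w : ι → ℕ) (N : ℕ) : Set (ι → ℕ) := {β | wt w β < N}

theorem lowExp_finite {w : ι → ℕ} (hw : ∀ i, 0 < w i) (N : ℕ) : (lowExp w N).Finite := by
  refine (Set.Finite.pi' (t := fun _ : ι => Set.Iio N) fun _ => Set.finite_Iio N).subset ?_
  intro β hβ i
  exact lt_of_le_of_lt (le_wt hw β i) hβ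

/-- A crude bound: only polynomial growth in `N` is needed, to be played off against geometric
growth. -/
theorem ncard_lowExp_le {w : ι → ℕ} (hw : ∀ i, 0 < w i) (N : ℕ) :
    (lowExp w N).ncard ≤ N ^ Fintype.card ι := by
  classical
  have h : lowExp w N ⊆ (Fintype.piFinset fun _ : ι => Finset.range N : Finset (ι → ℕ)) := by
    intro β hβ
    simp only [Finset.mem_coe, Fintype.mem_piFinset, Finset.mem_range]
    exact fun i => lt_of_le_of_lt (le_wt hw β i) hβ
  refine (Set.ncard_le_ncard h (Finset.finite_toSet _)).trans ?_
  rw [Set.ncard_coe_finset, Fintype.card_piFinset]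
  simp

/-- Coordinatewise division with remainder by `m`: the map sending (ρ, γ) with ρ < m to mγ + ρ is
injective, and the remainder costs at most `wt w m` in weight. -/
theorem prod_mul_ncard_lowExp_le {w m : ι → ℕ} (hw : ∀ i, 0 < w i) (hm : ∀ i, 0 < m i) (N : ℕ) :
    (∏ i, m i) * (lowExp (m * w) N).ncard ≤ (lowExp w (N + wt w m)).ncard := by
  classical
  have hfin := lowExp_finite (w := m * w) (fun i => Nat.mul_pos (hm i) (hw i)) N
  have hcard : (∏ i, m i) * (lowExp (m * w) N).ncard =
      ((Fintype.piFinset fun i => Finset.range (m i)) ×ˢ hfin.toFinset).card := by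
    rw [Finset.card_product, Fintype.card_piFinset, Set.ncard_eq_toFinset_card _ hfin]
    simp
  rw [hcard, ← Set.ncard_coe_finset]
  refine Set.ncard_le_ncard_of_injOn (fun p => m * p.2 + p.1) ?_ ?_ (lowExp_finite hw _)
  · rintro ⟨ρ, γ⟩ h
    simp only [Finset.coe_product, Set.mem_prod, Finset.mem_coe, Fintype.mem_piFinset,
      Finset.mem_range, Set.Finite.mem_toFinset] at h
    obtain ⟨hρ, hγ⟩ := h
    have h1 : wt w (m * γ) = wt (m * w) γ := by
      simp only [wt, Pi.mul_apply]
      exact Finset.sum_congr rfl fun i _ => by ring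
    have h2 : wt w ρ ≤ wt w m :=
      Finset.sum_le_sum fun i _ => Nat.mul_le_mul_left _ (hρ i).le
    have h3 : wt (m * w) γ < N := hγ
    change wt w (m * γ + ρ) < _
    rw [wt_add, h1]
    omega
  · rintro ⟨ρ, γ⟩ h ⟨ρ', γ'⟩ h' heq
    simp only [Finset.coe_product, Set.mem_prod, Finset.mem_coe, Fintype.mem_piFinset,
      Finset.mem_range, Set.Finite.mem_toFinset] at h h'
    have key : ∀ i, ρ i = ρ' i ∧ γ i = γ' i := by
      intro i
      have e : m i * γ i + ρ i = m i * γ' i + ρ' i := congrFun heq i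
      have e1 := congrArg (· % m i) e
      have e2 := congrArg (· / m i) e
      simp only [Nat.mul_add_mod, Nat.mod_eq_of_lt (h.1 i), Nat.mod_eq_of_lt (h'.1 i)] at e1
      simp only [Nat.mul_add_div (hm i), Nat.div_eq_of_lt (h.1 i), Nat.div_eq_of_lt (h'.1 i)] at e2
      exact ⟨e1, by simpa using e2⟩
    rw [Prod.mk.injEq]
    exact ⟨funext fun i => (key i).1, funext fun i => (key i).2⟩

/-- Comparison of the growth of the number of exponent vectors of bounded weight for two
proportional weight vectors. -/
theorem prod_le_of_ncard_lowExp_le {w m : ι → ℕ} (hw : ∀ i, 0 < w i) {l : ℕ}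
    (h : ∀ N, (lowExp w N).ncard ≤ l * (lowExp (m * w) N).ncard) : ∏ i, m i ≤ l := by
  by_cases hm0 : ∃ i, m i = 0
  · obtain ⟨i, hi⟩ := hm0
    rw [Finset.prod_eq_zero (Finset.mem_univ i) hi]
    exact Nat.zero_le _
  have hm : ∀ i, 0 < m i := fun i => Nat.pos_of_ne_zero fun hi => hm0 ⟨i, hi⟩
  have hmw : ∀ i, 0 < (m * w) i := fun i => Nat.mul_pos (hm i) (hw i)
  by_contra hlt
  push Not at hlt
  set A : ℕ → ℕ := fun N => (lowExp (m * w) N).ncard with hA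
  set M := ∏ i, m i with hM
  set c := wt w m with hc
  have hA1 : 1 ≤ A 1 := by
    rw [hA, Nat.one_le_iff_ne_zero]
    simp only [ne_eq, Set.ncard_eq_zero (lowExp_finite hmw 1)]
    intro h0
    have : (0 : ι → ℕ) ∈ lowExp (m * w) 1 := by simp [lowExp]
    simp [h0] at this
  have hstep : ∀ N, M * A N ≤ l * A (N + c) := fun N =>
    (prod_mul_ncard_lowExp_le hw hm N).trans (h _)
  have hl : 0 < l := by
    rcases Nat.eq_zero_or_pos l with h0 | h0
    · have := hstep 1
      have hMpos : 0 < M := Finset.prod_pos fun i _ => hm i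
      have h2 : 0 < M * A 1 := Nat.mul_pos hMpos hA1
      rw [h0, zero_mul] at this
      omega
    · exact h0
  -- Each shift of the bound by `c` multiplies the count by at least `M / l`. If `M > l` this is
  -- geometric growth, which the polynomial bound `hpoly` forbids.
  have hgrow : ∀ j : ℕ, ((M : ℝ) / l) ^ j ≤ A (1 + j * c) := by
    intro j
    induction j with
    | zero => simpa using hA1
    | succ j ih =>
      have h1 : (M : ℝ) * A (1 + j * c) ≤ l * A (1 + (j + 1) * c) := by
        have := hstep (1 + j * c)
        rw [show 1 + j * c + c = 1 + (j + 1) * c by ring] at this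
        exact_mod_cast this
      have hl' : (0 : ℝ) < l := by exact_mod_cast hl
      calc ((M : ℝ) / l) ^ (j + 1) = (M / l) * (M / l) ^ j := by ring
        _ ≤ (M / l) * A (1 + j * c) := by gcongr
        _ ≤ A (1 + (j + 1) * c) := by
          rw [div_mul_eq_mul_div, div_le_iff₀ hl']
          linarith
  have hr : 1 < (M : ℝ) / l := by
    rw [one_lt_div (by exact_mod_cast hl)]
    exact_mod_cast hlt
  have hpoly : ∀ j : ℕ, 1 ≤ j → ((M : ℝ) / l) ^ j ≤
      ((1 + c) ^ Fintype.card ι : ℝ) * (j : ℝ) ^ Fintype.card ι := by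
    intro j hj
    refine (hgrow j).trans ?_
    have h1 : A (1 + j * c) ≤ ((1 + c) * j) ^ Fintype.card ι := by
      refine (ncard_lowExp_le hmw _).trans (Nat.pow_le_pow_left ?_ _)
      nlinarith
    rw [← mul_pow]
    exact_mod_cast h1
  have hlim := (tendsto_pow_const_div_const_pow_of_one_lt (Fintype.card ι) hr).const_mul
    ((1 + c) ^ Fintype.card ι : ℝ)
  rw [mul_zero] at hlim
  have hev := hlim.eventually (gt_mem_nhds (zero_lt_one' ℝ))
  obtain ⟨j, hj, hj1⟩ := (hev.and (Filter.eventually_ge_atTop 1)).exists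
  have hpos : 0 < ((M : ℝ) / l) ^ j := by positivity
  rw [mul_div_assoc', div_lt_one hpos] at hj
  exact absurd (hpoly j hj1) (not_le.2 hj)

end Weights

/-! ### The weight filtration of a ring and counting of monomials. -/

section Filtration

variable {k R ι : Type*} [Field k] [CommRing R] [Algebra k R] [Fintype ι]

/-- The monomial in the elements `X i` with given exponents. -/
def mon (X : ι → R) (β : ι → ℕ) : R := ∏ i, X i ^ β i

theorem mon_add (X : ι → R) (β γ : ι → ℕ) : mon X (β + γ) = mon X β * mon X γ := by
  simp [mon, pow_add, Finset.prod_mul_distrib]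

@[simp] theorem mon_zero (X : ι → R) : mon X 0 = 1 := by simp [mon]

@[simp] theorem mon_single [DecidableEq ι] (X : ι → R) (i : ι) (n : ℕ) :
    mon X (Pi.single i n) = X i ^ n := by
  simp only [mon]
  rw [Finset.prod_eq_single i]
  · simp
  · intro j _ hj; simp [Pi.single_eq_of_ne hj]
  · simp

/-- The ideal generated by the monomials of weight at least `N`. -/
def wIdeal (X : ι → R) (w : ι → ℕ) (N : ℕ) : Ideal R :=
  Ideal.span (mon X '' {β | N ≤ wt w β})

variable {X : ι → R} {w : ι → ℕ}

theorem mon_mem_wIdeal {β : ι → ℕ} {N : ℕ} (h : N ≤ wt w β) : mon X β ∈ wIdeal X w N :=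
  Ideal.subset_span ⟨β, h, rfl⟩

theorem wIdeal_anti {M N : ℕ} (h : M ≤ N) : wIdeal X w N ≤ wIdeal X w M :=
  Ideal.span_mono (Set.image_mono fun _ hβ => h.trans hβ)

theorem wIdeal_zero : wIdeal X w 0 = ⊤ :=
  (Ideal.eq_top_iff_one _).2 (by simpa using mon_mem_wIdeal (X := X) (w := w) (β := 0) (Nat.zero_le _))

theorem wIdeal_mul_le (M N : ℕ) : wIdeal X w M * wIdeal X w N ≤ wIdeal X w (M + N) := by
  rw [wIdeal, wIdeal, Ideal.span_mul_span', Ideal.span_le]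
  rintro _ ⟨_, ⟨β, hβ, rfl⟩, _, ⟨γ, hγ, rfl⟩, rfl⟩
  simp only [← mon_add]
  refine mon_mem_wIdeal ?_
  rw [wt_add]
  exact add_le_add hβ hγ

theorem mul_mem_wIdeal {M N : ℕ} {a b : R} (ha : a ∈ wIdeal X w M) (hb : b ∈ wIdeal X w N) :
    a * b ∈ wIdeal X w (M + N) := wIdeal_mul_le M N (Ideal.mul_mem_mul ha hb)

theorem pow_mem_wIdeal {M : ℕ} {a : R} (ha : a ∈ wIdeal X w M) (n : ℕ) :
    a ^ n ∈ wIdeal X w (n * M) := by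
  induction n with
  | zero => simp [wIdeal_zero]
  | succ n ih =>
    rw [pow_succ, Nat.succ_mul]
    exact mul_mem_wIdeal ih ha

theorem X_mem_wIdeal (i : ι) : X i ∈ wIdeal X w (w i) := by
  classical
  have := mon_mem_wIdeal (X := X) (w := w) (β := Pi.single i 1) (N := w i) (by simp)
  simpa using this

theorem mon_mem_wIdeal_of_mem {F : ι → R} {m : ι → ℕ} (hF : ∀ i, F i ∈ wIdeal X w (m i * w i))
    (α : ι → ℕ) : mon F α ∈ wIdeal X w (wt (m * w) α) := by
  classical
  have h : ∀ s : Finset ι, ∏ i ∈ s, F i ^ α i ∈ wIdeal X w (∑ i ∈ s, (m * w) i * α i) := by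
    intro s
    induction s using Finset.induction_on with
    | empty => simp [wIdeal_zero]
    | insert a s ha ih =>
      rw [Finset.prod_insert ha, Finset.sum_insert ha]
      refine mul_mem_wIdeal ?_ ih
      rw [mul_comm]
      exact pow_mem_wIdeal (hF a) (α a)
  exact h Finset.univ

/-- Modulo the next step of the filtration, the ideal `wIdeal X w n` is spanned by monomials. -/
theorem wIdeal_le_span_sup (hw : ∀ i, 0 < w i)
    (hgen : ∀ g : R, ∃ c : k, g - algebraMap k R c ∈ Ideal.span (Set.range X)) (n : ℕ) :
    (wIdeal X w n).restrictScalars k ≤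
      Submodule.span k (mon X '' {β | wt w β = n}) ⊔ (wIdeal X w (n + 1)).restrictScalars k := by
  intro g hg
  rw [Submodule.restrictScalars_mem] at hg
  refine Submodule.span_induction ?_ ?_ ?_ ?_ hg
  · rintro _ ⟨β, hβ, rfl⟩
    rcases eq_or_lt_of_le (show n ≤ wt w β from hβ) with h | h
    · exact Submodule.mem_sup_left (Submodule.subset_span ⟨β, h.symm, rfl⟩)
    · exact Submodule.mem_sup_right (mon_mem_wIdeal h)
  · exact zero_mem _
  · intro a b _ _ ha hb
    exact add_mem ha hb
  · intro r a ha' ha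
    -- A coefficient differs from a scalar by an element of positive weight, so ideal combinations
    -- are `k`-combinations modulo the next step of the filtration.
    obtain ⟨c, hc⟩ := hgen r
    have ha'' : a ∈ wIdeal X w n := ha'
    have h1 : Ideal.span (Set.range X) ≤ wIdeal X w 1 := by
      rw [Ideal.span_le]
      rintro _ ⟨i, rfl⟩
      exact wIdeal_anti (hw i) (X_mem_wIdeal i)
    have h2 : (r - algebraMap k R c) * a ∈ wIdeal X w (n + 1) := by
      rw [add_comm]
      exact mul_mem_wIdeal (h1 hc) ha''
    have h3 : r • a = c • a + (r - algebraMap k R c) * a := by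
      rw [smul_eq_mul, Algebra.smul_def]; ring
    rw [h3]
    exact add_mem (Submodule.smul_mem _ _ ha) (Submodule.mem_sup_right h2)

/-- If the monomials of each weight can be rewritten in terms of a submodule `B` modulo terms of
higher weight, then `B` generates everything modulo terms of arbitrarily high weight. -/
theorem top_le_sup_wIdeal (hw : ∀ i, 0 < w i)
    (hgen : ∀ g : R, ∃ c : k, g - algebraMap k R c ∈ Ideal.span (Set.range X))
    {B : Submodule k R}
    (N : ℕ) (hB : ∀ β, wt w β < N → mon X β ∈ B ⊔ (wIdeal X w (wt w β + 1)).restrictScalars k) :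
    ⊤ ≤ B ⊔ (wIdeal X w N).restrictScalars k := by
  suffices h : ∀ n ≤ N, ⊤ ≤ B ⊔ (wIdeal X w n).restrictScalars k from h N le_rfl
  intro n
  induction n with
  | zero =>
    intro _
    rw [wIdeal_zero]
    exact le_trans (by simp) le_sup_right
  | succ n ih =>
    intro hn
    refine (ih (by omega)).trans (sup_le le_sup_left ?_)
    refine (wIdeal_le_span_sup hw hgen n).trans (sup_le ?_ le_sup_right)
    rw [Submodule.span_le]
    rintro _ ⟨β, hβ, rfl⟩
    have := hB β (by rw [show wt w β = n from hβ]; omega)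
    rwa [show wt w β = n from hβ] at this

theorem top_le_span_lowExp_sup (hw : ∀ i, 0 < w i)
    (hgen : ∀ g : R, ∃ c : k, g - algebraMap k R c ∈ Ideal.span (Set.range X)) (N : ℕ) :
    ⊤ ≤ Submodule.span k (mon X '' lowExp w N) ⊔ (wIdeal X w N).restrictScalars k :=
  top_le_sup_wIdeal hw hgen N fun β hβ =>
    Submodule.mem_sup_left (Submodule.subset_span ⟨β, hβ, rfl⟩)

theorem finite_quotient_wIdeal (hw : ∀ i, 0 < w i)
    (hgen : ∀ g : R, ∃ c : k, g - algebraMap k R c ∈ Ideal.span (Set.range X)) (N : ℕ) :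
    Module.Finite k (R ⧸ wIdeal X w N) := by
  refine ⟨Submodule.fg_def.2 ⟨(Ideal.Quotient.mkₐ k (wIdeal X w N)) '' (mon X '' lowExp w N),
    ((lowExp_finite hw N).image _).image _, ?_⟩⟩
  rw [eq_top_iff]
  rintro y -
  obtain ⟨g, rfl⟩ := Ideal.Quotient.mk_surjective y
  obtain ⟨a, ha, b, hb, hab⟩ := Submodule.mem_sup.1
    (top_le_span_lowExp_sup hw hgen N (Submodule.mem_top (x := g)))
  have h1 : Ideal.Quotient.mk (wIdeal X w N) g = Ideal.Quotient.mkₐ k (wIdeal X w N) a := by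
    rw [← hab, map_add, Ideal.Quotient.eq_zero_iff_mem.2 (show b ∈ wIdeal X w N from hb), add_zero]
    rfl
  rw [h1]
  have := Submodule.mem_map_of_mem (f := (Ideal.Quotient.mkₐ k (wIdeal X w N)).toLinearMap) ha
  rw [Submodule.map_span] at this
  exact this

/-- If `R` is spanned by `l` elements modulo the ideal generated by elements `F i` of weight at
least `m i * w i` and modulo terms of high weight, then the number of monomials of low weight is
bounded in terms of `l`. -/
theorem ncard_lowExp_le_of_span (hw : ∀ i, 0 < w i)
    {m : ι → ℕ} (hm : ∀ i, 0 < m i) {F : ι → R} (hF : ∀ i, F i ∈ wIdeal X w (m i * w i)) (N : ℕ)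
    (hind : LinearIndependent k
      (fun β : lowExp w N => Ideal.Quotient.mk (wIdeal X w N) (mon X β)))
    {l : ℕ} (e : Fin l → R)
    (he : ⊤ ≤ Submodule.span k (Set.range e) ⊔
      (Ideal.span (Set.range F) ⊔ wIdeal X w N).restrictScalars k) :
    (lowExp w N).ncard ≤ l * (lowExp (m * w) N).ncard := by
  classical
  have hmw : ∀ i, 0 < (m * w) i := fun i => Nat.mul_pos (hm i) (hw i)
  set S : Set R := (fun p : Fin l × (ι → ℕ) => mon F p.2 * e p.1) ''
    (Set.univ ×ˢ lowExp (m * w) N) with hS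
  set V : Submodule k R := Submodule.span k S ⊔ (wIdeal X w N).restrictScalars k with hV
  have hWV : ∀ a ∈ wIdeal X w N, a ∈ V := fun a ha => Submodule.mem_sup_right ha
  -- Expand the cofactor `g` by `he`: the combination of the `e j` lands in the span of `S`, the
  -- part in the ideal of the `F i` raises `α` and hence its weight, and the rest is of weight at
  -- least `N`. The number `n` bounds the weight still missing.
  have key : ∀ n, ∀ α : ι → ℕ, N ≤ wt (m * w) α + n → ∀ g : R, mon F α * g ∈ V := by
    intro n
    induction n with
    | zero =>
      intro α hα g
      exact hWV _ (Ideal.mul_mem_right _ _ (wIdeal_anti hα (mon_mem_wIdeal_of_mem hF α)))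
    | succ n ih =>
      intro α hα g
      obtain ⟨a, ha, b, hb, hab⟩ := Submodule.mem_sup.1 (he (Submodule.mem_top (x := g)))
      obtain ⟨c, hc, d, hd, hcd⟩ := Submodule.mem_sup.1
        (show b ∈ Ideal.span (Set.range F) ⊔ wIdeal X w N from hb)
      rw [← hab, ← hcd, mul_add, mul_add]
      refine add_mem ?_ (add_mem ?_ ?_)
      · refine Submodule.span_induction (p := fun a _ => mon F α * a ∈ V) ?_ ?_ ?_ ?_ ha
        · rintro _ ⟨j, rfl⟩
          by_cases h : wt (m * w) α < N
          · exact Submodule.mem_sup_left (Submodule.subset_span ⟨(j, α), ⟨trivial, h⟩, rfl⟩)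
          · exact hWV _ (Ideal.mul_mem_right _ _
              (wIdeal_anti (not_lt.1 h) (mon_mem_wIdeal_of_mem hF α)))
        · simp
        · intro x y _ _ hx hy
          rw [mul_add]; exact add_mem hx hy
        · intro r x _ hx
          rw [mul_smul_comm]; exact Submodule.smul_mem _ _ hx
      · obtain ⟨f, rfl⟩ := (Ideal.mem_span_range_iff_exists_fun).1 hc
        rw [Finset.mul_sum]
        refine Submodule.sum_mem _ fun i _ => ?_
        have h1 : mon F α * (f i * F i) = mon F (α + Pi.single i 1) * f i := by
          rw [mon_add, mon_single, pow_one]; ring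
        rw [h1]
        refine ih _ ?_ _
        rw [wt_add, wt_single, mul_one]
        have := hmw i
        omega
      · exact hWV _ (Ideal.mul_mem_left _ _ hd)
  have hVtop : V = ⊤ := by
    rw [eq_top_iff]
    rintro g -
    simpa using key N 0 (by simp) g
  have hSfin : S.Finite := (Set.finite_univ.prod (lowExp_finite hmw N)).image _
  have hScard : S.ncard ≤ l * (lowExp (m * w) N).ncard := by
    refine (Set.ncard_image_le (Set.finite_univ.prod (lowExp_finite hmw N))).trans ?_
    rw [Set.ncard_prod]
    simp
  refine le_trans ?_ hScard
  let q := (Ideal.Quotient.mkₐ k (wIdeal X w N)).toLinearMap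
  -- So `S` spans the quotient in which the monomials of weight below `N` are independent; comparing
  -- cardinalities gives the bound.
  have hspan : Submodule.span k (q '' S) = ⊤ := by
    rw [eq_top_iff]
    rintro y -
    obtain ⟨g, rfl⟩ := Ideal.Quotient.mk_surjective y
    obtain ⟨a, ha, b, hb, hab⟩ := Submodule.mem_sup.1 (hVtop ▸ Submodule.mem_top (x := g) : g ∈ V)
    have h1 : Ideal.Quotient.mk (wIdeal X w N) g = q a := by
      rw [← hab, map_add,
        Ideal.Quotient.eq_zero_iff_mem.2 (show b ∈ wIdeal X w N from hb), add_zero]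
      rfl
    rw [h1]
    have := Submodule.mem_map_of_mem (f := q) ha
    rwa [Submodule.map_span] at this
  have hqfin : (q '' S).Finite := hSfin.image _
  have := hqfin.fintype
  have := (lowExp_finite hw N).fintype
  have hfin : Module.Finite k (R ⧸ wIdeal X w N) :=
    ⟨Submodule.fg_def.2 ⟨q '' S, hqfin, hspan⟩⟩
  have h1 := hind.fintype_card_le_finrank
  have h2 : Module.finrank k (R ⧸ wIdeal X w N) ≤ (q '' S).toFinset.card := by
    have := finrank_span_le_card (R := k) (q '' S)
    rwa [hspan, finrank_top] at this
  rw [← Set.ncard_eq_toFinset_card'] at h2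
  rw [← Nat.card_eq_fintype_card] at h1
  exact h1.trans (h2.trans (Set.ncard_image_le hSfin))

end Filtration

/-! ### Semicontinuity of the rank -/

section Semicontinuity

variable {k U V : Type*} [Field k] [AddCommGroup U] [Module k U] [AddCommGroup V] [Module k V]
  [Module.Finite k V]

/-- The rank of a linear map does not drop under a general perturbation. -/
theorem finite_setOf_finrank_range_add_smul_lt (φ ψ : U →ₗ[k] V) :
    {ε : k | Module.finrank k (LinearMap.range (φ + ε • ψ)) <
      Module.finrank k (LinearMap.range φ)}.Finite := by
  classical
  let b := Module.finBasis k (LinearMap.range φ)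
  choose u hu using fun i => (b i).2
  obtain ⟨P, hP⟩ := (LinearMap.range φ).exists_isCompl
  let π : V →ₗ[k] LinearMap.range φ := Submodule.projectionOnto _ _ hP
  let B : Matrix _ _ k := Matrix.of fun i j => b.repr (π (ψ (u j))) i
  have hφ : ∀ j, π (φ (u j)) = b j := fun j => by
    rw [hu]; exact Submodule.projectionOnto_apply_left hP (b j)
  -- `p` evaluated at ε is the determinant of `φ + ε • ψ` compressed to the `u j` and projected to
  -- the range of `φ`. It equals 1 at ε = 0, so it has finitely many roots, and away from them the
  -- images of the `u j` stay independent.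
  let p : Polynomial k := (1 + (Polynomial.X : Polynomial k) • B.map Polynomial.C).det
  have hp0 : p ≠ 0 := by
    intro h
    have h1 : p.eval 0 = 1 := by
      simp only [p]
      rw [← Polynomial.coe_evalRingHom, RingHom.map_det]
      rw [show (Polynomial.evalRingHom (0 : k)).mapMatrix
        (1 + (Polynomial.X : Polynomial k) • B.map Polynomial.C) = 1 by
          ext i j; simp [Matrix.one_apply, apply_ite]]
      exact Matrix.det_one
    simp [h] at h1
  refine (Polynomial.finite_setOfPred_isRoot hp0).subset ?_
  intro ε hε
  by_contra hroot
  have hdet : (1 + ε • B).det ≠ 0 := by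
    intro h
    apply hroot
    simp only [Set.mem_ofPred_eq, Polynomial.IsRoot, p]
    rw [← Polynomial.coe_evalRingHom, RingHom.map_det]
    rw [← h]
    congr 1
    ext i j
    simp [Matrix.one_apply, apply_ite, mul_comm (B i j)]
  have hli : LinearIndependent k (fun j => π ((φ + ε • ψ) (u j))) := by
    have h1 := Matrix.linearIndependent_cols_of_det_ne_zero hdet
    rw [← LinearMap.linearIndependent_iff b.equivFun.toLinearMap b.equivFun.ker]
    have h2 : (b.equivFun.toLinearMap ∘ fun j => π ((φ + ε • ψ) (u j))) = (1 + ε • B).col := by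
      ext j i
      simp only [Function.comp, LinearMap.add_apply, LinearMap.smul_apply, map_add, map_smul, hφ]
      simp [B, Matrix.col, Matrix.one_apply, Finsupp.single_apply, eq_comm]
    rw [h2]
    exact h1
  have hli2 : LinearIndependent k (fun j => (φ + ε • ψ) (u j)) :=
    LinearIndependent.of_comp π hli
  have hli3 : LinearIndependent k
      (fun j => (⟨(φ + ε • ψ) (u j), LinearMap.mem_range_self _ _⟩ :
        LinearMap.range (φ + ε • ψ))) :=
    LinearIndependent.of_comp (Submodule.subtype _) hli2
  have := hli3.fintype_card_le_finrank
  rw [Fintype.card_fin] at this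
  exact absurd hε (not_lt.2 this)

end Semicontinuity


/-! ### Dimension of a quotient through spanning families. -/

section Dimension

variable {k R V : Type*} [Field k] [AddCommGroup R] [Module k R] [AddCommGroup V] [Module k V]

theorem exists_fin_span_eq_top_of_finrank_le [Module.Finite k V] {l : ℕ}
    (h : Module.finrank k V ≤ l) : ∃ e : Fin l → V, Submodule.span k (Set.range e) = ⊤ := by
  let b := Module.finBasis k V
  refine ⟨fun i => if hi : (i : ℕ) < Module.finrank k V then b ⟨i, hi⟩ else 0, ?_⟩
  rw [eq_top_iff, ← b.span_eq, Submodule.span_le]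
  rintro _ ⟨j, rfl⟩
  refine Submodule.subset_span ⟨⟨j, j.2.trans_le h⟩, ?_⟩
  simp

theorem exists_fin_top_le_span_sup_ker {q : R →ₗ[k] V} (hq : Function.Surjective q) {l : ℕ}
    {e : Fin l → V} (he : Submodule.span k (Set.range e) = ⊤) :
    ∃ e' : Fin l → R, ⊤ ≤ Submodule.span k (Set.range e') ⊔ LinearMap.ker q := by
  choose e' he' using fun i => hq (e i)
  refine ⟨e', ?_⟩
  rw [← Submodule.comap_map_eq, Submodule.map_span, ← Set.range_comp,
    show q ∘ e' = e from funext he', he, Submodule.comap_top]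

theorem span_range_comp_eq_top {q : R →ₗ[k] V} (hq : Function.Surjective q) {B : Set R}
    (hB : ⊤ ≤ Submodule.span k B ⊔ LinearMap.ker q) : Submodule.span k (q '' B) = ⊤ := by
  rw [← Submodule.map_span, eq_top_iff, ← LinearMap.range_eq_top.2 hq, LinearMap.range_eq_map]
  refine (Submodule.map_mono hB).trans ?_
  rw [Submodule.map_sup]
  refine sup_le le_rfl ?_
  rintro _ ⟨x, hx, rfl⟩
  rw [LinearMap.mem_ker.1 hx]
  exact zero_mem _

theorem edim_le_of_top_le_span_sup_ker {q : R →ₗ[k] V} (hq : Function.Surjective q) {B : Set R}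
    (hBf : B.Finite) (hB : ⊤ ≤ Submodule.span k B ⊔ LinearMap.ker q) :
    edim k V ≤ (B.ncard : ℕ∞) := by
  have h := span_range_comp_eq_top hq hB
  have hf : (q '' B).Finite := hBf.image _
  have h1 : Module.rank k V ≤ (B.ncard : Cardinal) := by
    have h2 := rank_span_le (R := k) (q '' B)
    rw [h, rank_top] at h2
    refine h2.trans ?_
    rw [← Set.cast_ncard hf, Nat.cast_le]
    exact Set.ncard_image_le hBf
  have h3 := OrderHomClass.mono Cardinal.toENat h1
  simpa [edim] using h3

/-- Reduces a lower bound for a possibly infinite dimension to a statement about finite spanning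
families upstairs; in infinite dimension there is nothing to prove. -/
theorem le_edim_of_forall_span {q : R →ₗ[k] V} (hq : Function.Surjective q) {n : ℕ}
    (h : ∀ (l : ℕ) (e : Fin l → R), ⊤ ≤ Submodule.span k (Set.range e) ⊔ LinearMap.ker q → n ≤ l) :
    (n : ℕ∞) ≤ edim k V := by
  by_cases hfin : Module.Finite k V
  · have h1 : edim k V = (Module.finrank k V : ℕ∞) := by
      rw [edim, ← Module.finrank_eq_rank, map_natCast]
    rw [h1, Nat.cast_le]
    obtain ⟨e, he⟩ := exists_fin_span_eq_top_of_finrank_le (k := k) (V := V) le_rfl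
    obtain ⟨e', he'⟩ := exists_fin_top_le_span_sup_ker hq he
    exact h _ e' he'
  · have h1 : edim k V = ⊤ := by
      rw [edim, Cardinal.toENat_eq_top]
      by_contra hlt
      exact hfin (Module.rank_lt_aleph0_iff.1 (not_le.1 hlt))
    rw [h1]
    exact le_top

end Dimension

/-! ### Lower bounds for colengths: weighted Bezout inequality and perturbation. -/

section LowerBound

variable {k R ι : Type*} [Field k] [CommRing R] [Algebra k R] [Fintype ι]
  {X : ι → R} {w : ι → ℕ}

/-- The local Bezout inequality for weighted orders. The elements `F i` may depend on `N`, so a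
perturbation can be chosen afresh at each truncation of the filtration. -/
theorem prod_le_of_forall_span (hw : ∀ i, 0 < w i)
    (hind : ∀ N, LinearIndependent k
      (fun β : lowExp w N => Ideal.Quotient.mk (wIdeal X w N) (mon X β)))
    {m : ι → ℕ} {l : ℕ}
    (h : ∀ N, ∃ F : ι → R, (∀ i, F i ∈ wIdeal X w (m i * w i)) ∧ ∃ e : Fin l → R,
      ⊤ ≤ Submodule.span k (Set.range e) ⊔
        (Ideal.span (Set.range F) ⊔ wIdeal X w N).restrictScalars k) :
    ∏ i, m i ≤ l := by
  by_cases hm0 : ∃ i, m i = 0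
  · obtain ⟨i, hi⟩ := hm0
    rw [Finset.prod_eq_zero (Finset.mem_univ i) hi]
    exact Nat.zero_le _
  refine prod_le_of_ncard_lowExp_le hw fun N => ?_
  obtain ⟨F, hF, e, he⟩ := h N
  exact ncard_lowExp_le_of_span hw (fun i => Nat.pos_of_ne_zero fun hi => hm0 ⟨i, hi⟩) hF N
    (hind N) e he

/-- The number of elements needed to generate the quotient by an ideal does not increase under a
general linear perturbation of the generators of the ideal. -/
theorem exists_perturbed_span [Infinite k] (W : Ideal R) [Module.Finite k (R ⧸ W)] {m : ℕ}
    (a b : Fin m → R) {l : ℕ} (e : Fin l → R)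
    (he : ⊤ ≤ Submodule.span k (Set.range e) ⊔
      (Ideal.span (Set.range a) ⊔ W).restrictScalars k) {S : Set k} (hS : S.Finite) :
    ∃ ε ∉ S, ∃ e' : Fin l → R, ⊤ ≤ Submodule.span k (Set.range e') ⊔
      (Ideal.span (Set.range fun i => a i + ε • b i) ⊔ W).restrictScalars k := by
  classical
  let Q := R ⧸ W
  -- The range of `μ c` is the image in `Q` of the ideal generated by the `c i`. As `μ` is linear in
  -- `c`, the semicontinuity of ranks becomes semicontinuity of colengths.
  let μ : (Fin m → R) → (Fin m → Q) →ₗ[k] Q := fun c =>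
    ∑ i, (LinearMap.mulLeft k (Ideal.Quotient.mk W (c i))) ∘ₗ LinearMap.proj i
  have hμ : ∀ c g, μ c g = ∑ i, Ideal.Quotient.mk W (c i) * g i := by
    intro c g; simp [μ]
  have hμadd : ∀ ε : k, μ a + ε • μ b = μ (fun i => a i + ε • b i) := by
    intro ε
    refine LinearMap.ext fun g => ?_
    rw [LinearMap.add_apply, LinearMap.smul_apply, hμ, hμ, hμ, Finset.smul_sum,
      ← Finset.sum_add_distrib]
    refine Finset.sum_congr rfl fun i _ => ?_
    rw [map_add, add_mul, ← smul_mul_assoc]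
    rfl
  let q : ∀ c : Fin m → R, R →ₗ[k] Q ⧸ LinearMap.range (μ c) := fun c =>
    (LinearMap.range (μ c)).mkQ ∘ₗ (Ideal.Quotient.mkₐ k W).toLinearMap
  have hq : ∀ c, Function.Surjective (q c) := fun c =>
    (Submodule.mkQ_surjective _).comp Ideal.Quotient.mk_surjective
  have hker : ∀ c, LinearMap.ker (q c) =
      (Ideal.span (Set.range c) ⊔ W).restrictScalars k := by
    intro c
    ext x
    rw [LinearMap.mem_ker, Submodule.restrictScalars_mem]
    change (LinearMap.range (μ c)).mkQ (Ideal.Quotient.mk W x) = 0 ↔ _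
    rw [Submodule.mkQ_apply, Submodule.Quotient.mk_eq_zero]
    constructor
    · rintro ⟨g, hg⟩
      choose g' hg' using fun i => Ideal.Quotient.mk_surjective (g i)
      rw [hμ] at hg
      have h1 : x - ∑ i, c i * g' i ∈ W := by
        rw [← Ideal.Quotient.eq, ← hg, map_sum]
        exact Finset.sum_congr rfl fun i _ => by rw [map_mul, hg']
      rw [show x = ∑ i, c i * g' i + (x - ∑ i, c i * g' i) by ring]
      refine add_mem (Ideal.mem_sup_left (Ideal.sum_mem _ fun i _ => ?_)) (Ideal.mem_sup_right h1)
      exact Ideal.mul_mem_right _ _ (Ideal.subset_span ⟨i, rfl⟩)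
    · intro hx
      obtain ⟨y, hy, z, hz, rfl⟩ := Submodule.mem_sup.1 hx
      obtain ⟨g, rfl⟩ := Ideal.mem_span_range_iff_exists_fun.1 hy
      refine ⟨fun i => Ideal.Quotient.mk W (g i), ?_⟩
      rw [hμ, map_add, Ideal.Quotient.eq_zero_iff_mem.2 hz, add_zero, map_sum]
      exact Finset.sum_congr rfl fun i _ => by rw [map_mul, mul_comm]
  have hfin := finite_setOf_finrank_range_add_smul_lt (μ a) (μ b)
  obtain ⟨ε, hε⟩ := ((hS.union hfin).infinite_compl).nonempty
  simp only [Set.mem_compl_iff, Set.mem_union, not_or] at hε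
  refine ⟨ε, hε.1, ?_⟩
  have h1 : Module.finrank k (LinearMap.range (μ a)) ≤
      Module.finrank k (LinearMap.range (μ (fun i => a i + ε • b i))) := by
    rw [← hμadd]
    exact not_lt.1 hε.2
  have h2 := Submodule.finrank_quotient_add_finrank (LinearMap.range (μ a))
  have h3 := Submodule.finrank_quotient_add_finrank
    (LinearMap.range (μ (fun i => a i + ε • b i)))
  have h4 : Module.finrank k (Q ⧸ LinearMap.range (μ a)) ≤ l := by
    rw [← hker a] at he
    have h5 := span_range_comp_eq_top (hq a) he
    rw [← Set.range_comp] at h5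
    have h6 := finrank_range_le_card (R := k) (q a ∘ e)
    rw [Set.finrank, h5, finrank_top, Fintype.card_fin] at h6
    exact h6
  obtain ⟨e1, he1⟩ := exists_fin_span_eq_top_of_finrank_le (k := k)
    (V := Q ⧸ LinearMap.range (μ (fun i => a i + ε • b i))) (l := l) (by omega)
  obtain ⟨e2, he2⟩ := exists_fin_top_le_span_sup_ker (hq _) he1
  exact ⟨e2, by rwa [hker] at he2⟩

end LowerBound

/-! ### Upper bounds for colengths: rewriting and Nakayama's lemma. -/

section UpperBound

variable {k R ι : Type*} [Field k] [CommRing R] [Algebra k R] [Fintype ι]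
  {X : ι → R} {w : ι → ℕ}

/-- Rewriting bounds the dimensions of the quotients by `I ⊔ wIdeal X w N` independently of `N`, so
these ideals become stationary. From then on the weight ideal lies in `I` plus the maximal ideal
times itself, and Nakayama's lemma puts it inside `I`. -/
theorem exists_wIdeal_le_of_forall_mon [IsNoetherianRing R] [IsLocalRing R]
    (hw : ∀ i, 0 < w i) (hX : ∀ i, X i ∈ IsLocalRing.maximalIdeal R)
    (hgen : ∀ g : R, ∃ c : k, g - algebraMap k R c ∈ Ideal.span (Set.range X))
    {I : Ideal R} {B : Set R} (hBf : B.Finite)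
    (hB : ∀ β, mon X β ∈ Submodule.span k B ⊔
      (I ⊔ wIdeal X w (wt w β + 1)).restrictScalars k) :
    ∃ N, wIdeal X w N ≤ I := by
  classical
  have hsup : ∀ J K : Ideal R, (J ⊔ K).restrictScalars k =
      J.restrictScalars k ⊔ K.restrictScalars k := Submodule.restrictScalars_sup k
  have htop : ∀ N, ⊤ ≤ Submodule.span k B ⊔ (I ⊔ wIdeal X w N).restrictScalars k := by
    intro N
    rw [hsup, ← sup_assoc]
    refine top_le_sup_wIdeal hw hgen N fun β _ => ?_
    rw [sup_assoc, ← hsup]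
    exact hB β
  have hfinite : ∀ N, Module.Finite k (R ⧸ (I ⊔ wIdeal X w N)) ∧
      Module.finrank k (R ⧸ (I ⊔ wIdeal X w N)) ≤ B.ncard := by
    intro N
    let q := (Ideal.Quotient.mkₐ k (I ⊔ wIdeal X w N)).toLinearMap
    have hq : Function.Surjective q := Ideal.Quotient.mk_surjective
    have hk : LinearMap.ker q = (I ⊔ wIdeal X w N).restrictScalars k := by
      ext x
      exact Ideal.Quotient.eq_zero_iff_mem
    have h1 := span_range_comp_eq_top hq (B := B) (by rw [hk]; exact htop N)
    have hf : (q '' B).Finite := hBf.image _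
    have := hf.fintype
    refine ⟨⟨Submodule.fg_def.2 ⟨q '' B, hf, h1⟩⟩, ?_⟩
    have h2 := finrank_span_le_card (R := k) (q '' B)
    rw [h1, finrank_top, ← Set.ncard_eq_toFinset_card'] at h2
    exact h2.trans (Set.ncard_image_le hBf)
  -- `N` is an index at which the bounded dimension attains its maximum.
  obtain ⟨n, ⟨N, hN⟩, hmax⟩ := Nat.findGreatest_spec (P := fun n => ∃ N,
    n = Module.finrank k (R ⧸ (I ⊔ wIdeal X w N))) (n := B.ncard) (hfinite 0).2 ⟨0, rfl⟩ |>
    fun h => (⟨_, h, fun N' => Nat.le_findGreatest (hfinite N').2 ⟨N', rfl⟩⟩ :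
      ∃ n, (∃ N, n = Module.finrank k (R ⧸ (I ⊔ wIdeal X w N))) ∧
        ∀ N', Module.finrank k (R ⧸ (I ⊔ wIdeal X w N')) ≤ n)
  have hstab : ∀ N' ≥ N, I ⊔ wIdeal X w N ≤ I ⊔ wIdeal X w N' := by
    intro N' hN'
    have := (hfinite N).1
    have := (hfinite N').1
    have hle : I ⊔ wIdeal X w N' ≤ I ⊔ wIdeal X w N := sup_le_sup_left (wIdeal_anti hN') _
    let φ := (Ideal.Quotient.factorₐ k hle).toLinearMap
    have hφ : Function.Surjective φ := Ideal.Quotient.factor_surjective hle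
    have heq : Module.finrank k (R ⧸ (I ⊔ wIdeal X w N')) =
        Module.finrank k (R ⧸ (I ⊔ wIdeal X w N)) :=
      le_antisymm (hN ▸ hmax N') (LinearMap.finrank_le_finrank_of_surjective hφ)
    have hinj : Function.Injective φ :=
      (LinearMap.injective_iff_surjective_of_finrank_eq_finrank heq).2 hφ
    intro x hx
    rw [← Ideal.Quotient.eq_zero_iff_mem]
    apply hinj
    rw [map_zero]
    exact Ideal.Quotient.eq_zero_iff_mem.2 hx
  refine ⟨N, ?_⟩
  -- A monomial of weight at least `N + c` is nonconstant, and still has weight at least `N` after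
  -- one variable is removed.
  let c := ∑ i, w i + 1
  have h1 : wIdeal X w N ≤ I ⊔ IsLocalRing.maximalIdeal R • wIdeal X w N := by
    refine (le_sup_right.trans (hstab (N + c) (by omega))).trans (sup_le_sup_left ?_ _)
    rw [wIdeal, Ideal.span_le]
    rintro _ ⟨β, hβ, rfl⟩
    have hβ : N + c ≤ wt w β := hβ
    have hne : ∃ i, β i ≠ 0 := by
      by_contra hall
      push Not at hall
      rw [show β = 0 from funext hall, wt_zero] at hβ
      omega
    obtain ⟨i, hi⟩ := hne
    have hdec : β = Pi.single i 1 + (β - Pi.single i 1) := by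
      ext j
      by_cases hj : j = i
      · subst hj; simp; omega
      · simp [Pi.single_eq_of_ne hj]
    have hwi : w i ≤ ∑ i, w i := Finset.single_le_sum (fun _ _ => Nat.zero_le _) (Finset.mem_univ i)
    have hwt : wt w β = w i + wt w (β - Pi.single i 1) := by
      conv_lhs => rw [hdec, wt_add, wt_single, mul_one]
    rw [hdec, mon_add, mon_single, pow_one]
    exact Ideal.mul_mem_mul (hX i) (mon_mem_wIdeal (by omega))
  exact Submodule.le_of_le_smul_of_le_jacobson_bot (IsNoetherian.noetherian _)
    (IsLocalRing.maximalIdeal_le_jacobson _) h1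

/-- Since `I` contains all terms of sufficiently high weight, the rewriting up to heavier terms
stops after finitely many steps. -/
theorem top_le_span_sup_of_forall_mon [IsNoetherianRing R] [IsLocalRing R]
    (hw : ∀ i, 0 < w i) (hX : ∀ i, X i ∈ IsLocalRing.maximalIdeal R)
    (hgen : ∀ g : R, ∃ c : k, g - algebraMap k R c ∈ Ideal.span (Set.range X))
    {I : Ideal R} {B : Set R} (hBf : B.Finite)
    (hB : ∀ β, mon X β ∈ Submodule.span k B ⊔
      (I ⊔ wIdeal X w (wt w β + 1)).restrictScalars k) :
    ⊤ ≤ Submodule.span k B ⊔ I.restrictScalars k := by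
  obtain ⟨N, hN⟩ := exists_wIdeal_le_of_forall_mon hw hX hgen hBf hB
  have hsup : ∀ J K : Ideal R, (J ⊔ K).restrictScalars k =
      J.restrictScalars k ⊔ K.restrictScalars k := Submodule.restrictScalars_sup k
  have h := top_le_sup_wIdeal (k := k) hw hgen (B := Submodule.span k B ⊔ I.restrictScalars k) N
    fun β _ => by
      rw [sup_assoc, ← hsup]
      exact hB β
  refine h.trans (sup_le le_rfl (le_sup_of_le_right ?_))
  exact fun x hx => hN hx

end UpperBound


/-! ### Power series and their variables -/

section PowerSeries

/-- Variables are treated one at a time: the terms involving the new variable are divisible by it,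
and the others are covered by the remaining variables. -/
theorem mem_span_X_of_coeff_eq_zero {σ S : Type*} [CommRing S] (s : Finset σ)
    (g : MvPowerSeries σ S) (hg : ∀ m : σ →₀ ℕ, (∀ i ∈ s, m i = 0) → coeff m g = 0) :
    g ∈ Ideal.span ((X : σ → MvPowerSeries σ S) '' s) := by
  classical
  induction s using Finset.induction_on generalizing g with
  | empty =>
    have : g = 0 := MvPowerSeries.ext fun m => by simpa using hg m (by simp)
    rw [this]; exact zero_mem _
  | insert a s ha ih =>
    let g1 : MvPowerSeries σ S := fun m => if m a = 0 then coeff m g else 0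
    have hg1 : ∀ m, coeff m g1 = if m a = 0 then coeff m g else 0 := fun m => rfl
    have h1 : g1 ∈ Ideal.span ((X : σ → MvPowerSeries σ S) '' s) := by
      refine ih g1 fun m hm => ?_
      rw [hg1]
      split_ifs with h
      · exact hg m (by simpa [h] using hm)
      · rfl
    have h2 : (X a : MvPowerSeries σ S) ∣ g - g1 := by
      rw [X_dvd_iff]
      intro m hm
      rw [map_sub, hg1, if_pos hm, sub_self]
    rw [show g = g1 + (g - g1) by ring, Finset.coe_insert, Set.image_insert_eq]
    refine add_mem (Ideal.span_mono (Set.subset_insert _ _) h1) ?_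
    exact Ideal.mem_of_dvd _ h2 (Ideal.subset_span (Set.mem_insert _ _))

theorem sub_C_constantCoeff_mem_span_X {σ S : Type*} [Fintype σ] [CommRing S]
    (g : MvPowerSeries σ S) :
    g - C (constantCoeff g) ∈ Ideal.span (Set.range (X : σ → MvPowerSeries σ S)) := by
  classical
  have := mem_span_X_of_coeff_eq_zero Finset.univ (g - C (constantCoeff g)) (by
    intro m hm
    have hm0 : m = 0 := Finsupp.ext fun i => hm i (Finset.mem_univ i)
    rw [hm0]
    simp)
  simpa using this

theorem mon_X_eq_monomial {σ S : Type*} [Fintype σ] [CommRing S] (β : σ → ℕ) :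
    mon (X : σ → MvPowerSeries σ S) β = monomial (Finsupp.equivFunOnFinite.symm β) 1 := by
  rw [monomial_one_eq, mon, Finsupp.prod_fintype _ _ (by simp)]
  rfl

end PowerSeries

/-! ### Power series in the parameters and the two coordinates. -/

section Family

variable {k : Type*} [Field k] {r : ℕ}

/-- The coordinate ring `k[[t_1, …, t_r]][[x, y]]`. -/
abbrev BigRing (k : Type*) [Field k] (r : ℕ) : Type _ :=
  MvPowerSeries (Fin 2) (MvPowerSeries (Fin r) k)

/-- The variables `t_1, …, t_r, x, y`. -/
def vars (k : Type*) [Field k] (r : ℕ) : Fin r ⊕ Fin 2 → BigRing k r :=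
  Sum.elim (fun j => C (X j)) X

theorem algebraMap_bigRing (c : k) : algebraMap k (BigRing k r) c = C (C c) := by
  rw [MvPowerSeries.algebraMap_apply, MvPowerSeries.algebraMap_apply]
  simp

/-- The value of a power series at the origin. -/
def value (k : Type*) [Field k] (r : ℕ) : BigRing k r →+* k := constantCoeff.comp constantCoeff

theorem sub_value_mem_span_vars (g : BigRing k r) :
    g - algebraMap k (BigRing k r) (value k r g) ∈ Ideal.span (Set.range (vars k r)) := by
  have h1 := sub_C_constantCoeff_mem_span_X g
  have h2 := Ideal.mem_map_of_mem (C (σ := Fin 2))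
    (sub_C_constantCoeff_mem_span_X (constantCoeff g))
  rw [Ideal.map_span, ← Set.range_comp] at h2
  rw [algebraMap_bigRing, show g - C (C (value k r g)) = (g - C (constantCoeff g)) +
    C (constantCoeff g - C (constantCoeff (constantCoeff g))) by rw [map_sub]; simp [value]]
  refine add_mem (Ideal.span_mono ?_ h1) (Ideal.span_mono ?_ h2)
  · rintro _ ⟨i, rfl⟩; exact ⟨Sum.inr i, rfl⟩
  · rintro _ ⟨i, rfl⟩; exact ⟨Sum.inl i, rfl⟩

theorem isUnit_iff_value {g : BigRing k r} : IsUnit g ↔ value k r g ≠ 0 := by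
  rw [isUnit_iff_constantCoeff, isUnit_iff_constantCoeff, isUnit_iff_ne_zero]
  rfl

theorem mem_maximalIdeal_iff_value {g : BigRing k r} :
    g ∈ IsLocalRing.maximalIdeal (BigRing k r) ↔ value k r g = 0 := by
  rw [IsLocalRing.mem_maximalIdeal, mem_nonunits_iff, isUnit_iff_value, not_not]

@[simp] theorem value_vars (i : Fin r ⊕ Fin 2) : value k r (vars k r i) = 0 := by
  rcases i with i | i <;> simp [value, vars]

@[simp] theorem value_algebraMap (c : k) : value k r (algebraMap k (BigRing k r) c) = c := by
  rw [algebraMap_bigRing]; simp [value]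

theorem vars_mem_maximalIdeal (i : Fin r ⊕ Fin 2) :
    vars k r i ∈ IsLocalRing.maximalIdeal (BigRing k r) :=
  mem_maximalIdeal_iff_value.2 (value_vars i)

theorem exists_sub_algebraMap_mem (g : BigRing k r) :
    ∃ c : k, g - algebraMap k (BigRing k r) c ∈ Ideal.span (Set.range (vars k r)) :=
  ⟨_, sub_value_mem_span_vars g⟩

theorem mon_vars (β : Fin r ⊕ Fin 2 → ℕ) : mon (vars k r) β =
    C (monomial (Finsupp.equivFunOnFinite.symm (β ∘ Sum.inl)) 1) *
      monomial (Finsupp.equivFunOnFinite.symm (β ∘ Sum.inr)) 1 := by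
  rw [← mon_X_eq_monomial, ← mon_X_eq_monomial, mon, Fintype.prod_sum_type]
  simp [mon, vars]

/-- The coefficient of a monomial in all variables. -/
def bigCoeff (β : Fin r ⊕ Fin 2 → ℕ) : BigRing k r →ₗ[k] k where
  toFun g := coeff (Finsupp.equivFunOnFinite.symm (β ∘ Sum.inl))
    (coeff (Finsupp.equivFunOnFinite.symm (β ∘ Sum.inr)) g)
  map_add' := by simp
  map_smul' c g := by
    rw [Algebra.smul_def, algebraMap_bigRing]
    simp [coeff_C_mul]

theorem bigCoeff_mon_mul (β γ : Fin r ⊕ Fin 2 → ℕ) (g : BigRing k r) (h : ¬ γ ≤ β) :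
    bigCoeff β (mon (vars k r) γ * g) = 0 := by
  rw [mon_vars]
  simp only [bigCoeff, LinearMap.coe_mk, AddHom.coe_mk]
  rw [mul_assoc, coeff_C_mul, coeff_monomial_mul, coeff_monomial_mul]
  split_ifs with h1 h2
  · exact absurd (fun i => by rcases i with i | i; exacts [h1 i, h2 i]) h
  all_goals simp

theorem bigCoeff_mon (β γ : Fin r ⊕ Fin 2 → ℕ) :
    bigCoeff β (mon (vars k r) γ) = if β = γ then 1 else 0 := by
  classical
  rw [mon_vars]
  simp only [bigCoeff, LinearMap.coe_mk, AddHom.coe_mk]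
  rw [coeff_C_mul, coeff_monomial]
  have h1 : β = γ ↔ β ∘ Sum.inl = γ ∘ Sum.inl ∧ β ∘ Sum.inr = γ ∘ Sum.inr := by
    constructor
    · rintro rfl; simp
    · rintro ⟨ha, hb⟩
      funext i
      rcases i with i | i
      exacts [congrFun ha i, congrFun hb i]
  by_cases ha : β ∘ Sum.inl = γ ∘ Sum.inl <;> by_cases hb : β ∘ Sum.inr = γ ∘ Sum.inr <;>
    simp [h1, ha, hb, coeff_monomial]

theorem bigCoeff_eq_zero_of_mem_wIdeal {w : Fin r ⊕ Fin 2 → ℕ} {N : ℕ} {g : BigRing k r}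
    (hg : g ∈ wIdeal (vars k r) w N) {β : Fin r ⊕ Fin 2 → ℕ} (hβ : wt w β < N) :
    bigCoeff β g = 0 := by
  refine Submodule.span_induction (p := fun g _ => ∀ a, bigCoeff β (g * a) = 0) ?_ ?_ ?_ ?_ hg 1 |>
    fun h => by simpa using h
  · rintro _ ⟨γ, hγ, rfl⟩ a
    refine bigCoeff_mon_mul β γ a fun hle => ?_
    have h1 : wt w γ ≤ wt w β := Finset.sum_le_sum fun i _ => Nat.mul_le_mul_left _ (hle i)
    have h2 : N ≤ wt w γ := hγ
    omega
  · simp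
  · intro a b _ _ ha hb c
    rw [add_mul, map_add, ha, hb, add_zero]
  · intro a b _ hb c
    rw [smul_eq_mul, mul_comm a, mul_assoc]
    exact hb _

/-- The coefficient functionals of weight below `N` vanish on the weight ideal, hence read off the
coefficients of a relation. -/
theorem linearIndependent_mon {w : Fin r ⊕ Fin 2 → ℕ} (hw : ∀ i, 0 < w i) (N : ℕ) :
    LinearIndependent k (fun β : lowExp w N =>
      Ideal.Quotient.mk (wIdeal (vars k r) w N) (mon (vars k r) β)) := by
  classical
  have := (lowExp_finite hw N).fintype
  rw [Fintype.linearIndependent_iff]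
  intro g hg β
  have h1 : ∑ γ, g γ • mon (vars k r) γ.1 ∈ wIdeal (vars k r) w N := by
    rw [← Ideal.Quotient.eq_zero_iff_mem, map_sum, ← hg]
    refine Finset.sum_congr rfl fun γ _ => ?_
    rfl
  have h2 := bigCoeff_eq_zero_of_mem_wIdeal h1 β.2
  rw [map_sum, Finset.sum_eq_single β] at h2
  · simpa [bigCoeff_mon] using h2
  · intro γ _ hγ
    rw [map_smul, bigCoeff_mon, if_neg (fun h => hγ (Subtype.ext h.symm)), smul_zero]
  · simp

end Family

/-! ### Rewriting monomials in the plane -/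

section Reduction

/-- The weights of the variables `t_1, …, t_r, x, y` adapted to the singularity
`y ^ t - x ^ s`. -/
def wts (r s t : ℕ) : Fin r ⊕ Fin 2 → ℕ :=
  Sum.elim (fun _ => (s - 1) * (t - 1)) ![t - 1, s - 1]

theorem wts_pos {r s t : ℕ} (ht : 2 ≤ t) (hst : t ≤ s) (i : Fin r ⊕ Fin 2) :
    0 < wts r s t i := by
  rcases i with i | i
  · exact Nat.mul_pos (by omega) (by omega)
  · fin_cases i <;> simp [wts] <;> omega

variable {k R : Type*} [Field k] [CommRing R] [Algebra k R] {r s t : ℕ}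
  {X : Fin r ⊕ Fin 2 → R}

theorem X_inl_mem_wIdeal (j : Fin r) :
    X (Sum.inl j) ∈ wIdeal X (wts r s t) ((s - 1) * (t - 1)) := X_mem_wIdeal (Sum.inl j)

theorem pow_mul_pow_mem_wIdeal (i j : ℕ) : X (Sum.inr 0) ^ i * X (Sum.inr 1) ^ j ∈
    wIdeal X (wts r s t) (i * (t - 1) + j * (s - 1)) :=
  mul_mem_wIdeal (pow_mem_wIdeal (X_mem_wIdeal (Sum.inr 0)) i)
    (pow_mem_wIdeal (X_mem_wIdeal (Sum.inr 1)) j)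

/-- The standard monomials. -/
def stdMon (X : Fin r ⊕ Fin 2 → R) (a b : ℕ) : Set R :=
  (fun p : ℕ × ℕ => X (Sum.inr 0) ^ p.1 * X (Sum.inr 1) ^ p.2) '' (Set.Iio a ×ˢ Set.Iio b)

theorem stdMon_finite (a b : ℕ) : (stdMon X a b).Finite :=
  ((Set.finite_Iio a).prod (Set.finite_Iio b)).image _

theorem ncard_stdMon_le (a b : ℕ) : (stdMon X a b).ncard ≤ a * b := by
  refine (Set.ncard_image_le ((Set.finite_Iio a).prod (Set.finite_Iio b))).trans ?_
  rw [Set.ncard_prod]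
  simp [Set.ncard_eq_toFinset_card']

/-- Monomials in all variables are rewritten as soon as those in `x` and `y` are. -/
theorem mon_mem_of_forall_pow_mul_pow_mem {I : Ideal R} {B : Submodule k R}
    (h1 : ∀ j, ∃ c : k, X (Sum.inl j) - c • X (Sum.inr 0) ^ (s - 1) ∈
      I ⊔ wIdeal X (wts r s t) ((s - 1) * (t - 1) + 1))
    (h : ∀ i j n : ℕ, n = i * (t - 1) + j * (s - 1) → X (Sum.inr 0) ^ i * X (Sum.inr 1) ^ j ∈
      B ⊔ (I ⊔ wIdeal X (wts r s t) (n + 1)).restrictScalars k) (β : Fin r ⊕ Fin 2 → ℕ) :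
    mon X β ∈ B ⊔ (I ⊔ wIdeal X (wts r s t) (wt (wts r s t) β + 1)).restrictScalars k := by
  classical
  obtain ⟨q, hq⟩ : ∃ q, ∑ j, β (Sum.inl j) = q := ⟨_, rfl⟩
  induction q generalizing β with
  | zero =>
    have hz : ∀ j, β (Sum.inl j) = 0 := by simpa using hq
    have h2 : mon X β = X (Sum.inr 0) ^ β (Sum.inr 0) * X (Sum.inr 1) ^ β (Sum.inr 1) := by
      simp [mon, Fintype.prod_sum_type, hz]
    rw [h2]
    refine h _ _ _ ?_
    simp [wt, Fintype.sum_sum_type, hz, wts, mul_comm]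
  | succ q ih =>
    obtain ⟨j, hj⟩ : ∃ j, β (Sum.inl j) ≠ 0 := by
      by_contra hall
      push Not at hall
      simp [hall] at hq
    obtain ⟨γ, rfl⟩ : ∃ γ : Fin r ⊕ Fin 2 → ℕ, β = γ + Pi.single (Sum.inl j) 1 := by
      refine ⟨β - Pi.single (Sum.inl j) 1, ?_⟩
      funext i
      rw [Pi.add_apply, Pi.sub_apply]
      by_cases hi : i = Sum.inl j
      · rw [hi, Pi.single_eq_same]; omega
      · rw [Pi.single_eq_of_ne hi]; omega
    -- One factor t_j is traded for a multiple of x^(s-1). Both have weight D, so the total weight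
    -- is unchanged while the degree `q` in the parameters drops.
    obtain ⟨c, hc⟩ := h1 j
    have hsum : ∑ j', γ (Sum.inl j') = q := by
      simp only [Pi.add_apply, Finset.sum_add_distrib] at hq
      have : ∑ j', (Pi.single (Sum.inl j) 1 : Fin r ⊕ Fin 2 → ℕ) (Sum.inl j') = 1 := by
        rw [Finset.sum_eq_single j]
        · simp
        · intro b _ hb
          exact Pi.single_eq_of_ne (by simpa using hb) _
        · simp
      omega
    have h3 := ih (γ + Pi.single (Sum.inr 0) (s - 1)) (by
      rw [← hsum]
      refine Finset.sum_congr rfl fun j' _ => ?_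
      simp)
    have hwt : wt (wts r s t) (γ + Pi.single (Sum.inr 0) (s - 1)) =
        wt (wts r s t) (γ + Pi.single (Sum.inl j) 1) := by
      rw [wt_add, wt_add, wt_single, wt_single]
      simp [wts, mul_comm]
    rw [hwt] at h3
    rw [show mon X (γ + Pi.single (Sum.inl j) 1) =
      c • mon X (γ + Pi.single (Sum.inr 0) (s - 1)) +
        mon X γ * (X (Sum.inl j) - c • X (Sum.inr 0) ^ (s - 1)) by
      rw [mon_add, mon_add, mon_single, mon_single, pow_one, mul_sub, mul_smul_comm]; ring]
    refine add_mem (Submodule.smul_mem _ _ h3) (Submodule.mem_sup_right ?_)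
    rw [Submodule.restrictScalars_mem]
    obtain ⟨a, ha, b, hb, hab⟩ := Submodule.mem_sup.1 hc
    rw [← hab, mul_add]
    refine add_mem (Ideal.mem_sup_left (Ideal.mul_mem_left _ _ ha)) (Ideal.mem_sup_right ?_)
    have := mul_mem_wIdeal (mon_mem_wIdeal (X := X) (w := wts r s t) (β := γ) le_rfl) hb
    rw [wt_add, wt_single]
    simpa [wts, mul_comm, add_assoc] using this

/-- Rewriting rules suffice to express all monomials in `x` and `y` through standard ones, up to
terms of higher weight. -/
theorem pow_mul_pow_mem_span_stdMon (ht : 2 ≤ t) (hst : t ≤ s) {I : Ideal R} {c c' : k}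
    (h2 : X (Sum.inr 0) ^ (s - 1) - c • X (Sum.inr 1) ^ (t - 1) ∈
      I ⊔ wIdeal X (wts r s t) ((s - 1) * (t - 1) + 1))
    (h3 : X (Sum.inr 1) ^ (t - 2) - c' • X (Sum.inr 0) ^ (s - 2) ∈
      I ⊔ wIdeal X (wts r s t) ((t - 2) * (s - 1) + 1))
    (h4 : s = t → c ^ (t - 2) * c' ^ (t - 1) ≠ 1)
    (i j n : ℕ) (hn : n = i * (t - 1) + j * (s - 1)) :
    X (Sum.inr 0) ^ i * X (Sum.inr 1) ^ j ∈ Submodule.span k (stdMon X (s - 1) (t - 2)) ⊔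
      (I ⊔ wIdeal X (wts r s t) (n + 1)).restrictScalars k := by
  set x := X (Sum.inr 0) with hx
  set y := X (Sum.inr 1) with hy
  set J : ℕ → Ideal R := fun n => I ⊔ wIdeal X (wts r s t) (n + 1) with hJ
  have hmul : ∀ (a : R) (m n i j : ℕ), a ∈ J m → n = m + (i * (t - 1) + j * (s - 1)) →
      a * (x ^ i * y ^ j) ∈ J n := by
    intro a m n i j ha hn
    obtain ⟨a1, ha1, a2, ha2, rfl⟩ := Submodule.mem_sup.1 ha
    rw [add_mul]
    refine add_mem (Ideal.mem_sup_left (Ideal.mul_mem_right _ _ ha1)) (Ideal.mem_sup_right ?_)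
    have := mul_mem_wIdeal ha2 (pow_mul_pow_mem_wIdeal (X := X) (s := s) (t := t) i j)
    rwa [hn, show m + (i * (t - 1) + j * (s - 1)) + 1 = m + 1 + (i * (t - 1) + j * (s - 1)) by
      ring]
  have rule2 : ∀ i j n, n = (i + (s - 1)) * (t - 1) + j * (s - 1) →
      x ^ (i + (s - 1)) * y ^ j - c • (x ^ i * y ^ (j + (t - 1))) ∈ J n := by
    intro i j n hn
    have := hmul _ _ n i j h2 (by rw [hn]; ring)
    convert this using 1
    rw [sub_mul, smul_mul_assoc, pow_add, pow_add]
    congr 1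
    · ring
    · congr 1; ring
  have rule3 : ∀ i j n, n = i * (t - 1) + (j + (t - 2)) * (s - 1) →
      x ^ i * y ^ (j + (t - 2)) - c' • (x ^ (i + (s - 2)) * y ^ j) ∈ J n := by
    intro i j n hn
    have := hmul _ _ n i j h3 (by rw [hn]; ring)
    convert this using 1
    rw [sub_mul, smul_mul_assoc, pow_add, pow_add]
    congr 1
    · ring
    · congr 1; ring
  set Z : ℕ → Submodule k R := fun n =>
    Submodule.span k (stdMon X (s - 1) (t - 2)) ⊔ (J n).restrictScalars k with hZ
  have hJZ : ∀ n, ∀ a ∈ J n, a ∈ Z n := fun n a ha => Submodule.mem_sup_right ha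
  have hBZ : ∀ n i j, i < s - 1 → j < t - 2 → x ^ i * y ^ j ∈ Z n := fun n i j hi hj =>
    Submodule.mem_sup_left (Submodule.subset_span ⟨(i, j), ⟨hi, hj⟩, rfl⟩)
  have hsm : ∀ n (d : k) (a : R), a ∈ J n → d • a ∈ J n := fun n d a ha =>
    Submodule.smul_mem ((J n).restrictScalars k) d ha
  change x ^ i * y ^ j ∈ Z n
  -- For s = t both rules are homogeneous, and rewriting ends only because the forms x^(t-1) - c
  -- y^(t-1) and y^(t-2) - c' x^(t-2) have no common zero, which `h4` guarantees. For t < s the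
  -- monomial x^(s-2) is heavier than y^(t-2), so the second rule simply kills y^(t-2).
  rcases eq_or_lt_of_le hst with heq | hlt
  · obtain rfl : t = s := heq
    have h4 := h4 rfl
    have rule23 : ∀ i j n, n = (i + (t - 1)) * (t - 1) + j * (t - 1) →
        x ^ (i + (t - 1)) * y ^ j - (c * c') • (x ^ (i + (t - 2)) * y ^ (j + 1)) ∈ J n := by
      intro i j n hn
      have e1 := rule2 i j n hn
      have e2 := rule3 i (j + 1) n (by
        rw [hn, show j + 1 + (t - 2) = j + (t - 1) by omega]; ring)
      rw [show j + 1 + (t - 2) = j + (t - 1) by omega] at e2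
      have := add_mem e1 (hsm n c _ e2)
      convert this using 1
      rw [smul_sub, smul_smul]; ring
    have ruleIter : ∀ e i j n, n = (i + (t - 2) + e) * (t - 1) + j * (t - 1) →
        x ^ (i + (t - 2) + e) * y ^ j - (c * c') ^ e • (x ^ (i + (t - 2)) * y ^ (j + e)) ∈
          J n := by
      intro e
      induction e with
      | zero => intro i j n _; simp
      | succ e ih =>
        intro i j n hn
        have e1 := rule23 (i + e) j n (by
          rw [hn]; congr 2; omega)
        have e2 := ih i (j + 1) n (by
          rw [hn, show i + (t - 2) + (e + 1) = i + (t - 2) + e + 1 by ring]; ring)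
        have := add_mem e1 (hsm n (c * c') _ e2)
        convert this using 1
        rw [show i + e + (t - 1) = i + (t - 2) + (e + 1) by omega,
          show i + e + (t - 2) = i + (t - 2) + e by omega,
          show j + (e + 1) = j + 1 + e by ring, smul_sub, smul_smul, pow_succ' (c * c')]
        ring
    -- For q ≥ t-2 one goes round a cycle: turn y^(t-2) into c' x^(t-2), then trade t-2 factors x
    -- for y. The monomial returns multiplied by c^(t-2) c'^(t-1), which differs from 1, so it is
    -- zero up to heavier terms.
    have main : ∀ q n, n = (t - 2) * (t - 1) + q * (t - 1) → x ^ (t - 2) * y ^ q ∈ Z n := by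
      intro q n hn
      by_cases hq : q < t - 2
      · exact hBZ n _ _ (by omega) hq
      · obtain ⟨q', rfl⟩ : ∃ q', q = q' + (t - 2) := ⟨q - (t - 2), by omega⟩
        have e1 := rule3 (t - 2) q' n hn
        have e2 := ruleIter (t - 2) 0 q' n (by rw [hn]; ring)
        simp only [zero_add] at e2
        have e3 := add_mem e1 (hsm n c' _ e2)
        have e4 : (1 - c ^ (t - 2) * c' ^ (t - 1)) • (x ^ (t - 2) * y ^ (q' + (t - 2))) ∈ J n := by
          convert e3 using 1
          rw [smul_sub, smul_smul, sub_smul, one_smul, mul_pow,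
            show c' * (c ^ (t - 2) * c' ^ (t - 2)) = c ^ (t - 2) * c' ^ (t - 1) by
              rw [show t - 1 = t - 2 + 1 by omega, pow_succ c']; ring]
          ring
        have e5 := hsm n (1 - c ^ (t - 2) * c' ^ (t - 1))⁻¹ _ e4
        rw [smul_smul, inv_mul_cancel₀ (sub_ne_zero.2 (Ne.symm h4)), one_smul] at e5
        exact hJZ n _ e5
    have main2 : ∀ i j n, n = (i + (t - 2)) * (t - 1) + j * (t - 1) →
        x ^ (i + (t - 2)) * y ^ j ∈ Z n := by
      intro i j n hn
      have e1 := ruleIter i 0 j n (by rw [hn]; ring)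
      have e2 := main (j + i) n (by rw [hn]; ring)
      simp only [zero_add] at e1
      have := add_mem (hJZ n _ e1) (Submodule.smul_mem _ ((c * c') ^ i) e2)
      convert this using 1
      rw [sub_add_cancel, add_comm i]
    by_cases hi : t - 2 ≤ i
    · obtain ⟨i', rfl⟩ : ∃ i', i = i' + (t - 2) := ⟨i - (t - 2), by omega⟩
      exact main2 i' j n hn
    · by_cases hj : j < t - 2
      · exact hBZ n _ _ (by omega) hj
      · obtain ⟨j', rfl⟩ : ∃ j', j = j' + (t - 2) := ⟨j - (t - 2), by omega⟩
        have e1 := rule3 i j' n hn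
        have e2 := main2 i j' n (by rw [hn]; ring)
        have := add_mem (hJZ n _ e1) (Submodule.smul_mem _ c' e2)
        rwa [sub_add_cancel] at this
  -- The weights of x^(s-2) and y^(t-2) differ by s - t > 0.
  · have kill : ∀ i j n, n = i * (t - 1) + (j + (t - 2)) * (s - 1) →
        x ^ i * y ^ (j + (t - 2)) ∈ J n := by
      intro i j n hn
      have e1 := rule3 i j n hn
      have e2 : x ^ (i + (s - 2)) * y ^ j ∈ J n := by
        refine Ideal.mem_sup_right (wIdeal_anti ?_ (pow_mul_pow_mem_wIdeal (i + (s - 2)) j))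
        rw [hn]
        obtain ⟨a, rfl⟩ : ∃ a, t = a + 2 := ⟨t - 2, by omega⟩
        obtain ⟨b, rfl⟩ : ∃ b, s = a + 2 + b + 1 := ⟨s - (a + 3), by omega⟩
        simp only [show a + 2 - 1 = a + 1 by omega, show a + 2 - 2 = a by omega,
          show a + 2 + b + 1 - 1 = a + b + 2 by omega, show a + 2 + b + 1 - 2 = a + b + 1 by omega]
        nlinarith
      have := add_mem e1 (hsm n c' _ e2)
      rwa [sub_add_cancel] at this
    by_cases hj : j < t - 2
    · by_cases hi : i < s - 1
      · exact hBZ n _ _ hi hj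
      · obtain ⟨i', rfl⟩ : ∃ i', i = i' + (s - 1) := ⟨i - (s - 1), by omega⟩
        have e1 := rule2 i' j n hn
        have e2 := kill i' (j + 1) n (by
          rw [hn, show j + 1 + (t - 2) = j + (t - 1) by omega]; ring)
        rw [show j + 1 + (t - 2) = j + (t - 1) by omega] at e2
        have := add_mem e1 (hsm n c _ e2)
        rw [sub_add_cancel] at this
        exact hJZ n _ this
    · obtain ⟨j', rfl⟩ : ∃ j', j = j' + (t - 2) := ⟨j - (t - 2), by omega⟩
      exact hJZ n _ (kill i j' n hn)

end Reduction


/-! ### The dual of the module of principal parts -/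

section PrincipalParts

variable {T : Type*} [CommRing T]

/-- Restriction to the diagonal `u = x`, `v = y`. -/
def diag (T : Type*) [CommRing T] :
    MvPowerSeries (Fin 2 ⊕ Fin 2) T →ₐ[T] MvPowerSeries (Fin 2) T :=
  rename (Sum.elim id id)

@[simp] theorem diag_rename_inl (g : MvPowerSeries (Fin 2) T) :
    diag T (rename Sum.inl g) = g := by
  rw [diag, rename_rename]
  exact rename_id_apply g

@[simp] theorem diag_rename_inr (g : MvPowerSeries (Fin 2) T) :
    diag T (rename Sum.inr g) = g := by
  rw [diag, rename_rename]
  exact rename_id_apply g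

/-- The equations `u - x`, `v - y` of the diagonal. -/
def diagEq (T : Type*) [CommRing T] (i : Fin 2) : MvPowerSeries (Fin 2 ⊕ Fin 2) T :=
  X (Sum.inr i) - X (Sum.inl i)

@[simp] theorem diag_diagEq (i : Fin 2) : diag T (diagEq T i) = 0 := by
  rw [diagEq, map_sub, diag, rename_X, rename_X]
  simp

/-- The ideal of the diagonal. -/
def diagIdeal (T : Type*) [CommRing T] : Ideal (MvPowerSeries (Fin 2 ⊕ Fin 2) T) :=
  Ideal.span (Set.range (diagEq T))

theorem diagEq_mem (i : Fin 2) : diagEq T i ∈ diagIdeal T := Ideal.subset_span ⟨i, rfl⟩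

theorem diag_eq_zero_of_mem {g : MvPowerSeries (Fin 2 ⊕ Fin 2) T} (hg : g ∈ diagIdeal T) :
    diag T g = 0 := by
  have h : diagIdeal T ≤ RingHom.ker (diag T) := by
    rw [diagIdeal, Ideal.span_le]
    rintro _ ⟨i, rfl⟩
    exact diag_diagEq i
  exact h hg

/-- The series `c` is `g` at u = v = 0; every term of the difference involves u or v. -/
theorem exists_eq_rename_add (g : MvPowerSeries (Fin 2 ⊕ Fin 2) T) :
    ∃ c h₀ h₁, g = rename Sum.inl c + X (Sum.inr 0) * h₀ + X (Sum.inr 1) * h₁ := by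
  classical
  let c := killCompl (R := T) (Function.Embedding.inl : Fin 2 ↪ Fin 2 ⊕ Fin 2) g
  have h1 : g - rename Sum.inl c ∈ Ideal.span ((X : _ → MvPowerSeries (Fin 2 ⊕ Fin 2) T) ''
      (({Sum.inr 0, Sum.inr 1} : Finset (Fin 2 ⊕ Fin 2)) : Set _)) := by
    refine mem_span_X_of_coeff_eq_zero _ _ fun m hm => ?_
    have hm' : m = Finsupp.embDomain (Function.Embedding.inl : Fin 2 ↪ Fin 2 ⊕ Fin 2)
        (m.comapDomain Sum.inl Sum.inl_injective.injOn) := by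
      ext i
      rcases i with i | i
      · rw [show (Sum.inl i : Fin 2 ⊕ Fin 2) = Function.Embedding.inl i from rfl,
          Finsupp.embDomain_apply_self]
        rfl
      · rw [Finsupp.embDomain_of_notMem_range]
        · fin_cases i
          · exact hm _ (by simp)
          · exact hm _ (by simp)
        · rintro ⟨j, hj⟩
          simp at hj
    have h2 : coeff m (rename (R := T) (Sum.inl : Fin 2 → Fin 2 ⊕ Fin 2) c) = coeff m g := by
      rw [hm']
      have := coeff_embDomain_rename (Function.Embedding.inl : Fin 2 ↪ Fin 2 ⊕ Fin 2) c
        (m.comapDomain Sum.inl Sum.inl_injective.injOn)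
      refine Eq.trans this ?_
      rw [coeff_killCompl]
    rw [map_sub, h2, sub_self]
  rw [Finset.coe_insert, Finset.coe_singleton, Set.image_insert_eq, Set.image_singleton,
    Ideal.mem_span_pair] at h1
  obtain ⟨a, b, hab⟩ := h1
  exact ⟨c, a, b, by linear_combination -hab⟩

/-- First-order Taylor expansion along the diagonal. -/
theorem exists_taylor (g : MvPowerSeries (Fin 2 ⊕ Fin 2) T) :
    ∃ h₀ h₁, g = rename Sum.inl (diag T g) + diagEq T 0 * h₀ + diagEq T 1 * h₁ := by
  -- The substitution `a` moves the diagonal to u = v = 0 and `b` undoes it, so the expansion at u =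
  -- v = 0 becomes an expansion along the diagonal.
  let a : Fin 2 ⊕ Fin 2 → MvPowerSeries (Fin 2 ⊕ Fin 2) T :=
    Sum.elim (fun i => X (Sum.inl i)) fun i => X (Sum.inr i) + X (Sum.inl i)
  let b : Fin 2 ⊕ Fin 2 → MvPowerSeries (Fin 2 ⊕ Fin 2) T :=
    Sum.elim (fun i => X (Sum.inl i)) (diagEq T)
  have ha : HasSubst a := hasSubst_of_constantCoeff_zero fun i => by
    rcases i with i | i <;> simp [a]
  have hb : HasSubst b := hasSubst_of_constantCoeff_zero fun i => by
    rcases i with i | i <;> simp [b, diagEq]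
  have hbX : ∀ i, subst (R := T) b (X i) = b i := fun i => subst_X hb i
  have hab : subst b (subst a g) = g := by
    rw [subst_comp_subst_apply ha hb]
    have : (fun i => subst (R := T) b (a i)) = X := by
      funext i
      rcases i with i | i
      · simp only [a, Sum.elim_inl, hbX]; rfl
      · simp only [a, Sum.elim_inr, subst_add hb, hbX]
        simp [b, diagEq]
    rw [this, subst_self]
    rfl
  obtain ⟨c, h₀, h₁, h⟩ := exists_eq_rename_add (subst a g)
  rw [h, subst_add hb, subst_add hb, subst_mul hb, subst_mul hb, hbX, hbX,
    rename_eq_subst, subst_comp_subst_apply (HasSubst.X_comp _) hb] at hab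
  have h2 : (fun i => subst (R := T) b ((X ∘ Sum.inl : Fin 2 → _) i)) = X ∘ Sum.inl := by
    funext i
    exact hbX _
  rw [h2, ← rename_eq_subst] at hab
  have h3 : g = rename Sum.inl c + diagEq T 0 * subst b h₀ + diagEq T 1 * subst b h₁ := hab.symm
  have h4 : diag T g = c := by
    rw [h3]
    simp
  exact ⟨subst b h₀, subst b h₁, by rw [h4]; exact h3⟩

theorem sub_rename_diag_mem (g : MvPowerSeries (Fin 2 ⊕ Fin 2) T) :
    g - rename Sum.inl (diag T g) ∈ diagIdeal T := by
  obtain ⟨h₀, h₁, h⟩ := exists_taylor g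
  rw [show g - rename Sum.inl (diag T g) = diagEq T 0 * h₀ + diagEq T 1 * h₁ by
    linear_combination h]
  exact add_mem (Ideal.mul_mem_right _ _ (diagEq_mem 0)) (Ideal.mul_mem_right _ _ (diagEq_mem 1))

theorem notMem_range_embDomain_inr {n : Fin 2 ⊕ Fin 2 →₀ ℕ} {i : Fin 2} (h : n (Sum.inl i) ≠ 0) :
    n ∉ Set.range (Finsupp.mapDomain (M := ℕ) (Sum.inr : Fin 2 → Fin 2 ⊕ Fin 2)) := by
  rintro ⟨m, rfl⟩
  apply h
  rw [Finsupp.mapDomain_of_notMem_range]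
  rintro ⟨j, hj⟩
  simp at hj

@[simp] theorem pderiv_inr_rename_inl (i : Fin 2) (g : MvPowerSeries (Fin 2) T) :
    pderiv T (Sum.inr i) (rename (Sum.inl : Fin 2 → Fin 2 ⊕ Fin 2) g) = 0 := by
  classical
  ext n
  rw [coeff_pderiv, coeff_rename_eq_zero, map_zero]
  · simp
  · rintro ⟨m, hm⟩
    have h1 := DFunLike.congr_fun hm (Sum.inr i)
    rw [Finsupp.mapDomain_of_notMem_range] at h1
    · simp at h1
    · rintro ⟨j, hj⟩
      simp at hj

@[simp] theorem pderiv_inr_rename_inr (i : Fin 2) (g : MvPowerSeries (Fin 2) T) :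
    pderiv T (Sum.inr i) (rename (Sum.inr : Fin 2 → Fin 2 ⊕ Fin 2) g) =
      rename Sum.inr (pderiv T i g) := by
  classical
  ext n
  by_cases hn : ∃ j, n (Sum.inl j) ≠ 0
  · obtain ⟨j, hj⟩ := hn
    rw [coeff_pderiv, coeff_rename_eq_zero, coeff_rename_eq_zero]
    · simp
    · exact notMem_range_embDomain_inr hj
    · exact notMem_range_embDomain_inr (i := j) (by simpa using hj)
  · push Not at hn
    let e : Fin 2 ↪ Fin 2 ⊕ Fin 2 := Function.Embedding.inr
    obtain ⟨m, rfl⟩ : ∃ m : Fin 2 →₀ ℕ, n = Finsupp.embDomain e m := by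
      refine ⟨n.comapDomain Sum.inr Sum.inr_injective.injOn, ?_⟩
      ext j
      rcases j with j | j
      · rw [Finsupp.embDomain_of_notMem_range _ _ _ (by rintro ⟨j', hj'⟩; simp [e] at hj')]
        exact hn j
      · exact (Finsupp.embDomain_apply_self e
          (n.comapDomain Sum.inr Sum.inr_injective.injOn) j).symm
    rw [coeff_pderiv]
    have h1 : Finsupp.embDomain e m + Finsupp.single (Sum.inr i) 1 =
        Finsupp.embDomain e (m + Finsupp.single i 1) := by
      rw [Finsupp.embDomain_add, Finsupp.embDomain_single]
      rfl
    have h2 : Finsupp.embDomain e m (Sum.inr i) = m i := Finsupp.embDomain_apply_self e m i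
    rw [h1, h2]
    have h3 := coeff_embDomain_rename e g (m + Finsupp.single i 1)
    have h4 := coeff_embDomain_rename e (pderiv T i g) m
    refine Eq.trans ?_ h4.symm
    rw [coeff_pderiv]
    congr 1

/-- By the Leibniz rule a derivation loses at most one power of an ideal. Hence `n` derivatives
followed by restriction to the diagonal kill the power `n + 1` of its ideal. -/
theorem derivation_mem_pow {S : Type*} [CommRing S] [Algebra T S] (θ : Derivation T S S)
    (I : Ideal S) (n : ℕ) {g : S} (hg : g ∈ I ^ (n + 1)) : θ g ∈ I ^ n := by
  induction n generalizing g with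
  | zero => simp
  | succ n ih =>
    rw [pow_succ] at hg
    refine Submodule.mul_induction_on hg ?_ ?_
    · intro a ha b hb
      rw [Derivation.leibniz, smul_eq_mul, smul_eq_mul]
      refine add_mem (Ideal.mul_mem_right _ _ ha) ?_
      rw [pow_succ']
      exact Ideal.mul_mem_mul hb (ih ha)
    · intro a b ha hb
      rw [map_add]
      exact add_mem ha hb

variable (F : MvPowerSeries (Fin 2) T)

/-- The Hamiltonian derivation in the variables `u`, `v`, which kills `F(u, v)`. -/
def hamilton : Derivation T (MvPowerSeries (Fin 2 ⊕ Fin 2) T) (MvPowerSeries (Fin 2 ⊕ Fin 2) T) :=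
  (rename Sum.inr (pderiv T 1 F) : MvPowerSeries (Fin 2 ⊕ Fin 2) T) • pderiv T (Sum.inr 0) -
    (rename Sum.inr (pderiv T 0 F) : MvPowerSeries (Fin 2 ⊕ Fin 2) T) • pderiv T (Sum.inr 1)

theorem hamilton_apply (g : MvPowerSeries (Fin 2 ⊕ Fin 2) T) : hamilton F g =
    rename Sum.inr (pderiv T 1 F) * pderiv T (Sum.inr 0) g -
      rename Sum.inr (pderiv T 0 F) * pderiv T (Sum.inr 1) g := rfl

@[simp] theorem hamilton_rename_inl (c : MvPowerSeries (Fin 2) T) :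
    hamilton F (rename Sum.inl c) = 0 := by
  simp [hamilton_apply]

@[simp] theorem hamilton_rename_inr_self : hamilton F (rename Sum.inr F) = 0 := by
  simp only [hamilton_apply, pderiv_inr_rename_inr]
  ring

@[simp] theorem pderiv_diagEq_self (i : Fin 2) : pderiv T (Sum.inr i) (diagEq T i) = 1 := by
  rw [diagEq, map_sub, pderiv_X_self, pderiv_X_of_ne (by simp), sub_zero]

theorem pderiv_diagEq_of_ne {i j : Fin 2} (h : j ≠ i) :
    pderiv T (Sum.inr i) (diagEq T j) = 0 := by
  rw [diagEq, map_sub, pderiv_X_of_ne (by simpa using h), pderiv_X_of_ne (by simp), sub_zero]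

theorem hamilton_diagEq_zero : hamilton F (diagEq T 0) = rename Sum.inr (pderiv T 1 F) := by
  rw [hamilton_apply, pderiv_diagEq_self, pderiv_diagEq_of_ne (by decide)]
  ring

theorem hamilton_diagEq_one : hamilton F (diagEq T 1) = -rename Sum.inr (pderiv T 0 F) := by
  rw [hamilton_apply, pderiv_diagEq_self, pderiv_diagEq_of_ne (by decide)]
  ring

theorem principalPartsIdeal_eq (m : ℕ) : principalPartsIdeal F m =
    Ideal.span {rename Sum.inl F, rename Sum.inr F} ⊔ diagIdeal T ^ m := rfl

theorem diagIdeal_pow_le (m : ℕ) : diagIdeal T ^ m ≤ principalPartsIdeal F m := le_sup_right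

theorem rename_inr_mem : rename Sum.inr F ∈ principalPartsIdeal F 3 :=
  Ideal.mem_sup_left (Ideal.subset_span (by simp))

/-- Operators `T[[x, y, u, v]] → T[[x, y]]` that induce functionals on the principal parts. -/
def dualOfOperator (Λ : MvPowerSeries (Fin 2 ⊕ Fin 2) T →+ MvPowerSeries (Fin 2) T)
    (hl : ∀ c g, Λ (rename Sum.inl c * g) = c * Λ g)
    (hr : ∀ g, Λ (rename Sum.inr F * g) = F * Λ g) (hd : ∀ g ∈ diagIdeal T ^ 3, Λ g = 0) :
    Module.Dual (TotalRing F) (PrincipalParts F 3) where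
  toFun := QuotientAddGroup.lift (principalPartsIdeal F 3).toAddSubgroup
    ((Ideal.Quotient.mk (Ideal.span {F})).toAddMonoidHom.comp Λ) (by
      intro g hg
      have hg' : g ∈ principalPartsIdeal F 3 := hg
      change Ideal.Quotient.mk (Ideal.span {F}) (Λ g) = 0
      rw [Ideal.Quotient.eq_zero_iff_mem, Ideal.mem_span_singleton]
      rw [principalPartsIdeal_eq] at hg'
      obtain ⟨a, ha, b, hb, rfl⟩ := Submodule.mem_sup.1 hg'
      obtain ⟨c, d, rfl⟩ := Ideal.mem_span_pair.1 ha
      rw [map_add, map_add, hd b hb, mul_comm c, mul_comm d, hl, hr]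
      exact ⟨Λ c + Λ d, by ring⟩)
  map_add' := map_add _
  map_smul' a p := by
    obtain ⟨c, rfl⟩ := Ideal.Quotient.mk_surjective a
    obtain ⟨g, rfl⟩ := Ideal.Quotient.mk_surjective p
    change Ideal.Quotient.mk (Ideal.span {F}) (Λ (rename Sum.inl c * g)) =
      Ideal.Quotient.mk (Ideal.span {F}) c * Ideal.Quotient.mk (Ideal.span {F}) (Λ g)
    rw [hl, map_mul]

/-- The value along the diagonal, as a functional on the principal parts. -/
def dualZero : Module.Dual (TotalRing F) (PrincipalParts F 3) :=
  dualOfOperator F (diag T : _ →+ _) (by simp) (by simp)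
    fun g hg => diag_eq_zero_of_mem (Ideal.pow_le_self (by norm_num) hg)

/-- The Hamiltonian derivative along the diagonal, as a functional on the principal parts. -/
def dualOne : Module.Dual (TotalRing F) (PrincipalParts F 3) :=
  dualOfOperator F ((diag T).toRingHom.toAddMonoidHom.comp (hamilton F).toLinearMap.toAddMonoidHom)
    (fun c g => by simp)
    (fun g => by simp)
    fun g hg => diag_eq_zero_of_mem (Ideal.pow_le_self (by norm_num)
      (derivation_mem_pow (hamilton F) _ 2 hg))

/-- The second Hamiltonian derivative along the diagonal, as a functional on the principal
parts. -/
def dualTwo : Module.Dual (TotalRing F) (PrincipalParts F 3) :=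
  dualOfOperator F ((diag T).toRingHom.toAddMonoidHom.comp
      ((hamilton F).toLinearMap.toAddMonoidHom.comp (hamilton F).toLinearMap.toAddMonoidHom))
    (fun c g => by simp)
    (fun g => by simp)
    fun g hg => diag_eq_zero_of_mem (by
      have := derivation_mem_pow (hamilton F) _ 1 (derivation_mem_pow (hamilton F) _ 2 hg)
      simpa using this)

theorem dualZero_mk (g : MvPowerSeries (Fin 2 ⊕ Fin 2) T) :
    dualZero F (Ideal.Quotient.mk _ g) = Ideal.Quotient.mk _ (diag T g) := rfl

theorem dualOne_mk (g : MvPowerSeries (Fin 2 ⊕ Fin 2) T) :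
    dualOne F (Ideal.Quotient.mk _ g) = Ideal.Quotient.mk _ (diag T (hamilton F g)) := rfl

theorem dualTwo_mk (g : MvPowerSeries (Fin 2 ⊕ Fin 2) T) :
    dualTwo F (Ideal.Quotient.mk _ g) =
      Ideal.Quotient.mk _ (diag T (hamilton F (hamilton F g))) := rfl

theorem diag_hamilton (g : MvPowerSeries (Fin 2 ⊕ Fin 2) T) : diag T (hamilton F g) =
    pderiv T 1 F * diag T (pderiv T (Sum.inr 0) g) -
      pderiv T 0 F * diag T (pderiv T (Sum.inr 1) g) := by
  simp [hamilton_apply]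

theorem diag_hamilton_hamilton (g : MvPowerSeries (Fin 2 ⊕ Fin 2) T) :
    diag T (hamilton F (hamilton F g)) =
      pderiv T 1 F * (pderiv T 0 (pderiv T 1 F) * diag T (pderiv T (Sum.inr 0) g) +
        pderiv T 1 F * diag T (pderiv T (Sum.inr 0) (pderiv T (Sum.inr 0) g)) -
        pderiv T 0 (pderiv T 0 F) * diag T (pderiv T (Sum.inr 1) g) -
        pderiv T 0 F * diag T (pderiv T (Sum.inr 0) (pderiv T (Sum.inr 1) g))) -
      pderiv T 0 F * (pderiv T 1 (pderiv T 1 F) * diag T (pderiv T (Sum.inr 0) g) +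
        pderiv T 1 F * diag T (pderiv T (Sum.inr 1) (pderiv T (Sum.inr 0) g)) -
        pderiv T 1 (pderiv T 0 F) * diag T (pderiv T (Sum.inr 1) g) -
        pderiv T 0 F * diag T (pderiv T (Sum.inr 1) (pderiv T (Sum.inr 1) g))) := by
  rw [diag_hamilton, hamilton_apply]
  simp only [map_sub, Derivation.leibniz, smul_eq_mul, map_add, map_mul, pderiv_inr_rename_inr,
    diag_rename_inr]
  ring

theorem dual_rename_inl_mul (φ : Module.Dual (TotalRing F) (PrincipalParts F 3))
    (c : MvPowerSeries (Fin 2) T) (g : MvPowerSeries (Fin 2 ⊕ Fin 2) T) :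
    φ (Ideal.Quotient.mk _ (rename Sum.inl c * g)) =
      Ideal.Quotient.mk _ c * φ (Ideal.Quotient.mk _ g) :=
  φ.map_smul (Ideal.Quotient.mk _ c) (Ideal.Quotient.mk _ g)

theorem dual_eq_zero_of_mem (φ : Module.Dual (TotalRing F) (PrincipalParts F 3))
    {g : MvPowerSeries (Fin 2 ⊕ Fin 2) T} (hg : g ∈ principalPartsIdeal F 3) :
    φ (Ideal.Quotient.mk _ g) = 0 := by
  rw [Ideal.Quotient.eq_zero_iff_mem.2 hg, map_zero]

/-- Replacing `g` by its restriction to the diagonal changes `q * g` by an element of the cube of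
the diagonal ideal. -/
theorem dual_mul_of_mem_sq (φ : Module.Dual (TotalRing F) (PrincipalParts F 3))
    {q : MvPowerSeries (Fin 2 ⊕ Fin 2) T} (hq : q ∈ diagIdeal T ^ 2)
    (g : MvPowerSeries (Fin 2 ⊕ Fin 2) T) :
    φ (Ideal.Quotient.mk _ (q * g)) =
      Ideal.Quotient.mk _ (diag T g) * φ (Ideal.Quotient.mk _ q) := by
  rw [← dual_rename_inl_mul, ← sub_eq_zero, ← map_sub, ← map_sub]
  refine dual_eq_zero_of_mem F φ (diagIdeal_pow_le F 3 ?_)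
  rw [show q * g - rename Sum.inl (diag T g) * q = q * (g - rename Sum.inl (diag T g)) by ring,
    pow_succ]
  exact Ideal.mul_mem_mul hq (sub_rename_diag_mem g)

theorem diagEq_mul_diagEq_mem (i j : Fin 2) : diagEq T i * diagEq T j ∈ diagIdeal T ^ 2 := by
  rw [sq]
  exact Ideal.mul_mem_mul (diagEq_mem i) (diagEq_mem j)

/-- A functional that kills the products `(u - x)(v - y)` and the like is determined by its
values in order one. -/
theorem dual_diagEq_mul (φ : Module.Dual (TotalRing F) (PrincipalParts F 3))
    (hφ : ∀ i j, φ (Ideal.Quotient.mk _ (diagEq T i * diagEq T j)) = 0) (i : Fin 2)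
    (g : MvPowerSeries (Fin 2 ⊕ Fin 2) T) :
    φ (Ideal.Quotient.mk _ (diagEq T i * g)) =
      Ideal.Quotient.mk _ (diag T g) * φ (Ideal.Quotient.mk _ (diagEq T i)) := by
  obtain ⟨h₀, h₁, h⟩ := exists_taylor g
  conv_lhs => rw [h]
  rw [show diagEq T i * (rename Sum.inl (diag T g) + diagEq T 0 * h₀ + diagEq T 1 * h₁) =
    rename Sum.inl (diag T g) * diagEq T i + diagEq T i * diagEq T 0 * h₀ +
      diagEq T i * diagEq T 1 * h₁ by ring, map_add, map_add, map_add, map_add,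
    dual_rename_inl_mul, dual_mul_of_mem_sq F φ (diagEq_mul_diagEq_mem i 0),
    dual_mul_of_mem_sq F φ (diagEq_mul_diagEq_mem i 1), hφ, hφ]
  ring

/-- By Taylor expansion the principal parts are generated over the left factor by 1, u - x, v - y
and their products of degree two. -/
theorem dual_eq_zero (φ : Module.Dual (TotalRing F) (PrincipalParts F 3))
    (h0 : φ (Ideal.Quotient.mk _ 1) = 0)
    (h1 : ∀ i, φ (Ideal.Quotient.mk _ (diagEq T i)) = 0)
    (h2 : ∀ i j, φ (Ideal.Quotient.mk _ (diagEq T i * diagEq T j)) = 0) : φ = 0 := by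
  refine LinearMap.ext fun p => ?_
  obtain ⟨g, rfl⟩ := Ideal.Quotient.mk_surjective p
  obtain ⟨h₀, h₁, h⟩ := exists_taylor g
  rw [h, map_add, map_add, map_add, map_add, dual_diagEq_mul F φ h2, dual_diagEq_mul F φ h2,
    h1, h1, show (rename Sum.inl (diag T g) : MvPowerSeries (Fin 2 ⊕ Fin 2) T) =
      rename Sum.inl (diag T g) * 1 by ring, dual_rename_inl_mul, h0]
  simp

/-- This turns the equation F(u,v) = 0 in the principal parts into linear relations, with
coefficients F_x and F_y, between the values of a functional. -/
theorem exists_taylor_rename_inr : ∃ h₀ h₁, (rename Sum.inr F : MvPowerSeries (Fin 2 ⊕ Fin 2) T) =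
    rename Sum.inl F + diagEq T 0 * h₀ + diagEq T 1 * h₁ ∧ diag T h₀ = pderiv T 0 F ∧
      diag T h₁ = pderiv T 1 F := by
  obtain ⟨h₀, h₁, h⟩ := exists_taylor (rename Sum.inr F : MvPowerSeries (Fin 2 ⊕ Fin 2) T)
  rw [diag_rename_inr] at h
  refine ⟨h₀, h₁, h, ?_, ?_⟩
  · have h2 := congrArg (fun g => diag T (pderiv T (Sum.inr 0) g)) h
    simp only [map_add, Derivation.leibniz, pderiv_inr_rename_inr, pderiv_inr_rename_inl,
      diag_rename_inr, smul_eq_mul, map_mul, diag_diagEq, pderiv_diagEq_self,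
      pderiv_diagEq_of_ne (T := T) (i := 0) (j := 1) (by decide), map_zero, map_one] at h2
    linear_combination -h2
  · have h2 := congrArg (fun g => diag T (pderiv T (Sum.inr 1) g)) h
    simp only [map_add, Derivation.leibniz, pderiv_inr_rename_inr, pderiv_inr_rename_inl,
      diag_rename_inr, smul_eq_mul, map_mul, diag_diagEq, pderiv_diagEq_self,
      pderiv_diagEq_of_ne (T := T) (i := 1) (j := 0) (by decide), map_zero, map_one] at h2
    linear_combination -h2

/-- If the partial derivatives of `F` form a regular sequence on the total space, the dual of the
module of principal parts is generated by the powers of the Hamiltonian derivation. -/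
theorem exists_dual_eq
    (hex : ∀ a b : TotalRing F,
      Ideal.Quotient.mk _ (pderiv T 0 F) * a + Ideal.Quotient.mk _ (pderiv T 1 F) * b = 0 →
      ∃ e, a = Ideal.Quotient.mk _ (pderiv T 1 F) * e ∧
        b = -(Ideal.Quotient.mk _ (pderiv T 0 F) * e))
    (half : TotalRing F) (hhalf : 2 * half = 1)
    (φ : Module.Dual (TotalRing F) (PrincipalParts F 3)) :
    ∃ c₀ c₁ c₂ : TotalRing F, φ = c₀ • dualZero F + c₁ • dualOne F + c₂ • dualTwo F := by
  obtain ⟨h₀, h₁, hF, hd₀, hd₁⟩ := exists_taylor_rename_inr F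
  set fx : TotalRing F := Ideal.Quotient.mk _ (pderiv T 0 F) with hfx
  set fy : TotalRing F := Ideal.Quotient.mk _ (pderiv T 1 F) with hfy
  let Q : Fin 2 → Fin 2 → TotalRing F := fun i j =>
    φ (Ideal.Quotient.mk _ (diagEq T i * diagEq T j))
  have hF0 : (Ideal.Quotient.mk (Ideal.span {F}) F : TotalRing F) = 0 :=
    Ideal.Quotient.eq_zero_iff_mem.2 (Ideal.mem_span_singleton_self F)
  have hrel : ∀ i, fx * Q i 0 + fy * Q i 1 = 0 := by
    intro i
    -- Evaluate `φ` on `diagEq T i` times F(u,v): the second-order values satisfy the Koszul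
    -- relation of F_x and F_y.
    have h1 := dual_eq_zero_of_mem F φ (Ideal.mul_mem_left _ (diagEq T i) (rename_inr_mem F))
    rw [hF, show diagEq T i * (rename Sum.inl F + diagEq T 0 * h₀ + diagEq T 1 * h₁) =
      rename Sum.inl F * diagEq T i + diagEq T i * diagEq T 0 * h₀ +
        diagEq T i * diagEq T 1 * h₁ by ring, map_add, map_add, map_add, map_add,
      dual_rename_inl_mul, dual_mul_of_mem_sq F φ (diagEq_mul_diagEq_mem i 0),
      dual_mul_of_mem_sq F φ (diagEq_mul_diagEq_mem i 1), hd₀, hd₁, hF0] at h1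
    linear_combination h1
  have hsymm : Q 1 0 = Q 0 1 := by simp only [Q, mul_comm]
  obtain ⟨e₀, he₀, he₀'⟩ := hex _ _ (hrel 0)
  obtain ⟨e₁, he₁, he₁'⟩ := hex _ _ (hrel 1)
  -- The symmetry of `Q` is itself a Koszul relation, between `e₀` and `e₁`. It yields Q_ij = e ξ_i
  -- ξ_j with ξ = (F_y, -F_x).
  obtain ⟨e, he, he'⟩ := hex e₀ e₁ (by linear_combination he₀' - he₁ + hsymm)
  have hval : ∀ i j, dualTwo F (Ideal.Quotient.mk _ (diagEq T i * diagEq T j)) =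
      2 * (![fy, -fx] i * ![fy, -fx] j) := by
    intro i j
    have hh : ∀ i, (Ideal.Quotient.mk (Ideal.span {F}) (diag T (hamilton F (diagEq T i))) :
        TotalRing F) = ![fy, -fx] i := by
      intro i
      fin_cases i
      · simp [hamilton_diagEq_zero, hfy]
      · simp [hamilton_diagEq_one, hfx]
    rw [dualTwo_mk, Derivation.leibniz, map_add, smul_eq_mul, smul_eq_mul, Derivation.leibniz,
      Derivation.leibniz]
    simp only [smul_eq_mul, map_add, map_mul, diag_diagEq, hh, zero_mul, map_zero]
    ring
  have hval1 : ∀ i j, dualOne F (Ideal.Quotient.mk _ (diagEq T i * diagEq T j)) = 0 := by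
    intro i j
    rw [dualOne_mk, Derivation.leibniz]
    simp
  have hval0 : ∀ i j, dualZero F (Ideal.Quotient.mk _ (diagEq T i * diagEq T j)) = 0 := by
    intro i j
    rw [dualZero_mk]
    simp
  -- H² takes the value 2 ξ_i ξ_j on the products, hence the factor one half. What remains has no
  -- second-order part and is treated by the same argument one order lower.
  let ψ := φ - (half * e) • dualTwo F
  have hψ : ∀ i j, ψ (Ideal.Quotient.mk _ (diagEq T i * diagEq T j)) = 0 := by
    intro i j
    have h1 : Q i j = ![fy, -fx] i * ![fy, -fx] j * e := by
      fin_cases i <;> fin_cases j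
      · simp; linear_combination he₀ + fy * he
      · simp; linear_combination he₀' - fx * he
      · simp; linear_combination he₁ + fy * he'
      · simp; linear_combination he₁' - fx * he'
    simp only [ψ, LinearMap.sub_apply, LinearMap.smul_apply, hval, smul_eq_mul]
    linear_combination h1 - e * (![fy, -fx] i * ![fy, -fx] j) * hhalf
  have hrelψ : fx * ψ (Ideal.Quotient.mk _ (diagEq T 0)) +
      fy * ψ (Ideal.Quotient.mk _ (diagEq T 1)) = 0 := by
    have h1 := dual_eq_zero_of_mem F ψ (rename_inr_mem F)
    rw [hF, map_add, map_add, map_add, map_add, dual_diagEq_mul F ψ hψ, dual_diagEq_mul F ψ hψ,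
      hd₀, hd₁, show (rename Sum.inl F : MvPowerSeries (Fin 2 ⊕ Fin 2) T) =
        rename Sum.inl F * 1 by ring, dual_rename_inl_mul, hF0] at h1
    linear_combination h1
  obtain ⟨η, hη, hη'⟩ := hex _ _ hrelψ
  refine ⟨φ (Ideal.Quotient.mk _ 1), η, half * e, ?_⟩
  rw [← sub_eq_zero]
  refine dual_eq_zero F _ ?_ ?_ ?_
  · simp only [LinearMap.sub_apply, LinearMap.add_apply, LinearMap.smul_apply, dualZero_mk,
      dualOne_mk, dualTwo_mk]
    simp
  · have hc : ∀ i, φ (Ideal.Quotient.mk _ (diagEq T i)) = ψ (Ideal.Quotient.mk _ (diagEq T i)) +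
        half * e * dualTwo F (Ideal.Quotient.mk _ (diagEq T i)) := by
      intro i
      simp [ψ]
    intro i
    have h1 : dualZero F (Ideal.Quotient.mk _ (diagEq T i)) = 0 := by
      rw [dualZero_mk]; simp
    simp only [LinearMap.sub_apply, LinearMap.add_apply, LinearMap.smul_apply, smul_eq_mul, h1, hc]
    rw [dualOne_mk]
    fin_cases i
    · simp only [Fin.zero_eta, Fin.isValue, hamilton_diagEq_zero, diag_rename_inr]
      linear_combination hη
    · simp only [Fin.mk_one, Fin.isValue, hamilton_diagEq_one, map_neg, diag_rename_inr]
      linear_combination hη'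
  · intro i j
    have h1 := hψ i j
    simp only [ψ, LinearMap.sub_apply, LinearMap.smul_apply] at h1
    simp only [LinearMap.sub_apply, LinearMap.add_apply, LinearMap.smul_apply, hval0, hval1,
      smul_zero, zero_add]
    exact h1

end PrincipalParts


/-! ### Regular sequences -/

section Regular

variable {R : Type*} [CommRing R]

theorem isWeaklyRegular_concat_iff (rs : List R) (b : R) :
    IsWeaklyRegular R (rs ++ [b]) ↔ IsWeaklyRegular R rs ∧
      ∀ g, b * g ∈ Ideal.ofList rs → g ∈ Ideal.ofList rs := by
  rw [isWeaklyRegular_append_iff, isWeaklyRegular_singleton_iff]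
  refine and_congr_right fun _ => ?_
  rw [isSMulRegular_iff_right_eq_zero_of_smul]
  have hI : (Ideal.ofList rs • ⊤ : Submodule R R) = Ideal.ofList rs := by simp
  constructor
  · intro h g hg
    have := h (Submodule.Quotient.mk g) (by
      rw [← Submodule.Quotient.mk_smul, Submodule.Quotient.mk_eq_zero, hI]
      exact hg)
    rwa [Submodule.Quotient.mk_eq_zero, hI] at this
  · intro h m
    obtain ⟨g, rfl⟩ := Submodule.Quotient.mk_surjective _ m
    rw [← Submodule.Quotient.mk_smul, Submodule.Quotient.mk_eq_zero,
      Submodule.Quotient.mk_eq_zero, hI]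
    exact h g

/-- The last element of a regular sequence may be exchanged for any element with a power of the
former among its multiples. -/
theorem isWeaklyRegular_exchange {rs : List R} {a b : R} (h : IsWeaklyRegular R (rs ++ [a]))
    {n : ℕ} (hn : a ^ n ∈ Ideal.ofList rs ⊔ Ideal.span {b}) :
    IsWeaklyRegular R (rs ++ [b]) := by
  rw [isWeaklyRegular_concat_iff] at h ⊢
  refine ⟨h.1, fun g hg => ?_⟩
  have hpow : ∀ n g, a ^ n * g ∈ Ideal.ofList rs → g ∈ Ideal.ofList rs := by
    intro n
    induction n with
    | zero => intro g hg; simpa using hg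
    | succ n ih =>
      intro g hg
      rw [pow_succ, mul_assoc] at hg
      exact h.2 g (ih _ hg)
  -- Modulo the ideal of `rs` the power `a ^ n` is a multiple of `b`, so `a ^ n * g` lies in that
  -- ideal, and the factors `a` cancel.
  refine hpow n g ?_
  obtain ⟨i, hi, j, hj, hij⟩ := Submodule.mem_sup.1 hn
  obtain ⟨c, rfl⟩ := Ideal.mem_span_singleton'.1 hj
  rw [← hij, add_mul, mul_assoc]
  exact add_mem (Ideal.mul_mem_right _ _ hi) (Ideal.mul_mem_left _ _ hg)

theorem ofList_pair (a b : R) : Ideal.ofList [a, b] = Ideal.span {a, b} := by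
  simp [Ideal.span_insert]

theorem ofList_triple (a b c : R) : Ideal.ofList [a, b, c] = Ideal.span {a, b, c} := by
  simp [Ideal.span_insert]

/-- Exactness of the Koszul complex of a regular sequence on a quotient ring. -/
theorem exists_of_isWeaklyRegular {F a b : R} (h : IsWeaklyRegular R [F, a, b])
    (u v : R ⧸ Ideal.span {F})
    (huv : Ideal.Quotient.mk _ a * u + Ideal.Quotient.mk _ b * v = 0) :
    ∃ e, u = Ideal.Quotient.mk _ b * e ∧ v = -(Ideal.Quotient.mk _ a * e) := by
  obtain ⟨u, rfl⟩ := Ideal.Quotient.mk_surjective u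
  obtain ⟨v, rfl⟩ := Ideal.Quotient.mk_surjective v
  have h1 := (isWeaklyRegular_concat_iff [F, a] b).1 h
  have h2 := (isWeaklyRegular_concat_iff [F] a).1 h1.1
  have hF : (Ideal.Quotient.mk (Ideal.span {F}) F) = 0 :=
    Ideal.Quotient.eq_zero_iff_mem.2 (Ideal.mem_span_singleton_self F)
  rw [← map_mul, ← map_mul, ← map_add, Ideal.Quotient.eq_zero_iff_mem,
    Ideal.mem_span_singleton'] at huv
  obtain ⟨c, hc⟩ := huv
  have h3 : v ∈ Ideal.ofList [F, a] := h1.2 v (by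
    rw [ofList_pair, Ideal.mem_span_pair]
    exact ⟨c, -u, by linear_combination hc⟩)
  rw [ofList_pair, Ideal.mem_span_pair] at h3
  obtain ⟨p, q, hpq⟩ := h3
  have h4 : u + b * q ∈ Ideal.ofList [F] := h2.2 _ (by
    rw [Ideal.ofList_singleton, Ideal.mem_span_singleton']
    exact ⟨c - b * p, by linear_combination hc - b * hpq⟩)
  rw [Ideal.ofList_singleton, ← Ideal.Quotient.eq_zero_iff_mem, map_add, map_mul] at h4
  refine ⟨-Ideal.Quotient.mk _ q, by linear_combination h4, ?_⟩
  rw [← hpq, map_add, map_mul, map_mul, hF]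
  ring

/-- A prime containing both classes lies over a minimal prime of the class of `a`. That prime has
height at least one since `a` is a nonzerodivisor, and it misses `b`, which is a nonzerodivisor
modulo `a`; so the inclusion is strict. -/
theorem two_le_height_of_isWeaklyRegular {F a b : R} (h : IsWeaklyRegular R [F, a, b])
    {I : Ideal (R ⧸ Ideal.span {F})} (ha : Ideal.Quotient.mk _ a ∈ I)
    (hb : Ideal.Quotient.mk _ b ∈ I) : 2 ≤ I.height := by
  have h1 := (isWeaklyRegular_concat_iff [F, a] b).1 h
  have h2 := (isWeaklyRegular_concat_iff [F] a).1 h1.1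
  set fa := Ideal.Quotient.mk (Ideal.span {F}) a with hfa
  set fb := Ideal.Quotient.mk (Ideal.span {F}) b with hfb
  have hnzd : fa ∈ nonZeroDivisors (R ⧸ Ideal.span {F}) := by
    rw [mem_nonZeroDivisors_iff_right]
    intro g hg
    obtain ⟨g, rfl⟩ := Ideal.Quotient.mk_surjective g
    rw [Ideal.Quotient.eq_zero_iff_mem, ← Ideal.ofList_singleton]
    refine h2.2 _ ?_
    rwa [Ideal.ofList_singleton, ← Ideal.Quotient.eq_zero_iff_mem, map_mul, mul_comm]
  have hnzd2 : ∀ g, fb * g ∈ Ideal.span {fa} → g ∈ Ideal.span {fa} := by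
    intro g hg
    obtain ⟨g, rfl⟩ := Ideal.Quotient.mk_surjective g
    rw [Ideal.mem_span_singleton'] at hg
    obtain ⟨c, hc⟩ := hg
    obtain ⟨c, rfl⟩ := Ideal.Quotient.mk_surjective c
    rw [hfa, hfb, ← map_mul, ← map_mul, Ideal.Quotient.eq, Ideal.mem_span_singleton'] at hc
    obtain ⟨d, hd⟩ := hc
    have h3 : g ∈ Ideal.ofList [F, a] := h1.2 g (by
      rw [ofList_pair, Ideal.mem_span_pair]
      exact ⟨-d, c, by linear_combination -hd⟩)
    rw [ofList_pair, Ideal.mem_span_pair] at h3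
    obtain ⟨p, q, hpq⟩ := h3
    rw [Ideal.mem_span_singleton']
    refine ⟨Ideal.Quotient.mk _ q, ?_⟩
    rw [hfa, ← map_mul, Ideal.Quotient.eq, Ideal.mem_span_singleton']
    exact ⟨-p, by linear_combination -hpq⟩
  rw [Ideal.height_eq_inf_minimalPrimes]
  refine le_iInf₂ fun P hP => ?_
  have hPp : P.IsPrime := hP.1.1
  obtain ⟨P', hP', hle⟩ := Ideal.exists_minimalPrimes_le
    (I := Ideal.span {fa}) (J := P) (by
      rw [Ideal.span_singleton_le_iff_mem]; exact hP.1.2 ha)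
  have hP'p : P'.IsPrime := hP'.1.1
  have hlt : P' < P := by
    refine lt_of_le_of_ne hle fun heq => ?_
    obtain ⟨y, hy, hxy⟩ := Ideal.exists_mul_mem_of_mem_minimalPrimes hP'
      (show fb ∈ P' from heq ▸ hP.1.2 hb)
    exact hy (hnzd2 y hxy)
  have h5 : 1 ≤ P'.height :=
    (Ideal.one_le_height_span_singleton_of_mem_nonZeroDivisors hnzd).trans
      (Ideal.height_mono hP'.1.2)
  calc (2 : ℕ∞) = 1 + 1 := by norm_num
    _ ≤ P'.height + 1 := by gcongr
    _ ≤ P.height := Ideal.height_add_one_le_of_lt_of_isPrime hlt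

theorem X_dvd_of_X_dvd_X_mul {σ S : Type*} [CommRing S] {i j : σ} (hij : i ≠ j)
    {g : MvPowerSeries σ S} (h : (X i : MvPowerSeries σ S) ∣ X j * g) : X i ∣ g := by
  classical
  rw [X_dvd_iff] at h ⊢
  intro m hm
  have := h (Finsupp.single j 1 + m) (by simp [hm, hij.symm])
  rwa [X, coeff_add_monomial_mul, one_mul] at this

theorem mem_span_X_pair_iff {S : Type*} [CommRing S] (g : MvPowerSeries (Fin 2) S) :
    g ∈ Ideal.span {(X 0 : MvPowerSeries (Fin 2) S), X 1} ↔ constantCoeff g = 0 := by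
  constructor
  · intro h
    obtain ⟨a, b, rfl⟩ := Ideal.mem_span_pair.1 h
    simp
  · intro h
    have := sub_C_constantCoeff_mem_span_X g
    rw [h, map_zero, sub_zero, show Set.range (X : Fin 2 → MvPowerSeries (Fin 2) S) =
      {X 0, X 1} by ext; simp [eq_comm]] at this
    exact this

end Regular

/-! ### The variables as a regular sequence. -/

section Variables

variable {k : Type*} [Field k]

theorem X_ne_zero' {σ S : Type*} [CommRing S] [Nontrivial S] (i : σ) :
    (X i : MvPowerSeries σ S) ≠ 0 := by
  classical
  intro h
  have := congrArg (coeff (Finsupp.single i 1)) h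
  rw [coeff_X, if_pos rfl] at this
  simp at this

theorem isWeaklyRegular_X_X {S : Type*} [CommRing S] [NoZeroDivisors S] [Nontrivial S] :
    IsWeaklyRegular (MvPowerSeries (Fin 2) S) [(X 0 : MvPowerSeries (Fin 2) S), X 1] := by
  refine (isWeaklyRegular_concat_iff [X 0] (X 1)).2 ⟨?_, ?_⟩
  · refine (isWeaklyRegular_concat_iff [] (X 0)).2 ⟨IsWeaklyRegular.nil _ _, fun g hg => ?_⟩
    rw [Ideal.ofList_nil, Ideal.mem_bot, mul_eq_zero] at hg
    rw [Ideal.ofList_nil, Ideal.mem_bot]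
    exact hg.resolve_left (X_ne_zero' 0)
  · intro g hg
    rw [Ideal.ofList_singleton, Ideal.mem_span_singleton] at hg ⊢
    exact X_dvd_of_X_dvd_X_mul (by decide) hg

theorem isWeaklyRegular_vars_one : IsWeaklyRegular (BigRing k 1)
    [vars k 1 (Sum.inr 0), vars k 1 (Sum.inr 1), vars k 1 (Sum.inl 0)] := by
  refine (isWeaklyRegular_concat_iff [_, _] _).2 ⟨isWeaklyRegular_X_X, fun g hg => ?_⟩
  rw [ofList_pair] at hg ⊢
  change g ∈ Ideal.span {X 0, X 1}
  have hg' := (mem_span_X_pair_iff _).1 hg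
  rw [mem_span_X_pair_iff]
  simp only [vars, Sum.elim_inl, map_mul, constantCoeff_C, mul_eq_zero] at hg'
  exact hg'.resolve_left (X_ne_zero' 0)

theorem isWeaklyRegular_vars_two : IsWeaklyRegular (BigRing k 2)
    [vars k 2 (Sum.inr 0), vars k 2 (Sum.inr 1), vars k 2 (Sum.inl 0), vars k 2 (Sum.inl 1)] := by
  refine (isWeaklyRegular_concat_iff [_, _, _] _).2
    ⟨(isWeaklyRegular_concat_iff [_, _] _).2 ⟨isWeaklyRegular_X_X, fun g hg => ?_⟩, fun g hg => ?_⟩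
  · rw [ofList_pair] at hg ⊢
    change g ∈ Ideal.span {X 0, X 1}
    have hg' := (mem_span_X_pair_iff _).1 hg
    rw [mem_span_X_pair_iff]
    simp only [vars, Sum.elim_inl, map_mul, constantCoeff_C, mul_eq_zero] at hg'
    exact hg'.resolve_left (X_ne_zero' 0)
  · have key : ∀ g : BigRing k 2, g ∈ Ideal.ofList
        [vars k 2 (Sum.inr 0), vars k 2 (Sum.inr 1), vars k 2 (Sum.inl 0)] ↔
        (X 0 : MvPowerSeries (Fin 2) k) ∣ constantCoeff g := by
      intro g
      rw [show [vars k 2 (Sum.inr 0), vars k 2 (Sum.inr 1), vars k 2 (Sum.inl 0)] =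
        [vars k 2 (Sum.inr 0), vars k 2 (Sum.inr 1)] ++ [vars k 2 (Sum.inl 0)] from rfl,
        Ideal.ofList_append, ofList_pair, Ideal.ofList_singleton]
      constructor
      · intro h
        obtain ⟨a, ha, b, hb, rfl⟩ := Submodule.mem_sup.1 h
        obtain ⟨c, rfl⟩ := Ideal.mem_span_singleton'.1 hb
        rw [map_add, (mem_span_X_pair_iff a).1 ha, zero_add, map_mul]
        simp only [vars, Sum.elim_inl, constantCoeff_C]
        exact dvd_mul_left _ _
      · rintro ⟨c, hc⟩
        rw [show g = (g - C c * vars k 2 (Sum.inl 0)) + C c * vars k 2 (Sum.inl 0) by ring]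
        refine add_mem (Ideal.mem_sup_left ?_)
          (Ideal.mem_sup_right (Ideal.mem_span_singleton'.2 ⟨_, rfl⟩))
        refine (mem_span_X_pair_iff _).2 ?_
        simp [vars, hc, mul_comm]
    rw [key] at hg ⊢
    simp only [vars, Sum.elim_inl, map_mul, constantCoeff_C] at hg
    exact X_dvd_of_X_dvd_X_mul (by decide) hg

end Variables


/-! ### Deformations of `y ^ t - x ^ s` -/

section Deformations

variable {k : Type*} [Field k] {r : ℕ}

theorem pderiv_map_C (i : Fin 2) (g : MvPowerSeries (Fin 2) k) :
    pderiv (MvPowerSeries (Fin r) k) i (map C g) = map C (pderiv k i g) := by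
  ext1 n
  rw [coeff_pderiv, coeff_map, coeff_map, coeff_pderiv, map_mul, map_add, map_one, map_natCast]

/-- The perturbation `∑_j t_j η_j`. -/
def perturb (η : Fin r → MvPowerSeries (Fin 2) k) : BigRing k r :=
  ∑ j, vars k r (Sum.inl j) * map C (η j)

theorem pderiv_perturb (i : Fin 2) (η : Fin r → MvPowerSeries (Fin 2) k) :
    pderiv (MvPowerSeries (Fin r) k) i (perturb η) = perturb fun j => pderiv k i (η j) := by
  simp only [perturb, map_sum, vars, Sum.elim_inl]
  refine Finset.sum_congr rfl fun j _ => ?_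
  rw [Derivation.leibniz, pderiv_C, smul_zero, add_zero, smul_eq_mul, pderiv_map_C]

@[simp] theorem value_perturb (η : Fin r → MvPowerSeries (Fin 2) k) :
    value k r (perturb η) = 0 := by
  simp [perturb, map_sum]

theorem value_map_C (g : MvPowerSeries (Fin 2) k) : value k r (map C g) = constantCoeff g := by
  simp [value]

theorem perturb_mem_wIdeal (s t : ℕ) (η : Fin r → MvPowerSeries (Fin 2) k) :
    perturb η ∈ wIdeal (vars k r) (wts r s t) ((s - 1) * (t - 1)) :=
  Ideal.sum_mem _ fun j _ => Ideal.mul_mem_right _ _ (X_inl_mem_wIdeal j)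

theorem sub_value_mem_wIdeal {s t : ℕ} (ht : 2 ≤ t) (hst : t ≤ s) (g : BigRing k r) :
    g - algebraMap k _ (value k r g) ∈ wIdeal (vars k r) (wts r s t) 1 := by
  have h1 : Ideal.span (Set.range (vars k r)) ≤ wIdeal (vars k r) (wts r s t) 1 := by
    rw [Ideal.span_le]
    rintro _ ⟨i, rfl⟩
    exact wIdeal_anti (wts_pos ht hst i) (X_mem_wIdeal i)
  exact h1 (sub_value_mem_span_vars g)

theorem mul_sub_smul_mem_wIdeal {s t : ℕ} (ht : 2 ≤ t) (hst : t ≤ s) (g : BigRing k r)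
    {a : BigRing k r} {n : ℕ} (ha : a ∈ wIdeal (vars k r) (wts r s t) n) :
    g * a - value k r g • a ∈ wIdeal (vars k r) (wts r s t) (n + 1) := by
  rw [Algebra.smul_def, ← sub_mul, add_comm]
  exact mul_mem_wIdeal (sub_value_mem_wIdeal ht hst g) ha

theorem perturb_sub_mem_wIdeal {s t : ℕ} (ht : 2 ≤ t) (hst : t ≤ s)
    (η : Fin r → MvPowerSeries (Fin 2) k) :
    perturb η - ∑ j, constantCoeff (η j) • vars k r (Sum.inl j) ∈
      wIdeal (vars k r) (wts r s t) ((s - 1) * (t - 1) + 1) := by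
  rw [perturb, ← Finset.sum_sub_distrib]
  refine Ideal.sum_mem _ fun j _ => ?_
  have h := mul_sub_smul_mem_wIdeal ht hst (map C (η j)) (X_inl_mem_wIdeal (X := vars k r) j)
  rwa [value_map_C, mul_comm (map C (η j))] at h

/-- The deformation `y ^ t - x ^ s + ∑_j t_j η_j`. -/
def family (s t : ℕ) (η : Fin r → MvPowerSeries (Fin 2) k) : BigRing k r :=
  vars k r (Sum.inr 1) ^ t - vars k r (Sum.inr 0) ^ s + perturb η

theorem deformation_eq_family {s t : ℕ} {f : MvPowerSeries (Fin 2) k}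
    (hf : f = X 1 ^ t - X 0 ^ s) {d : ℕ} (δ : Fin d → MvPowerSeries (Fin 2) k)
    (a : Fin r → Fin d → k) :
    deformation f δ a = family s t fun j => ∑ i, a j i • δ i := by
  rw [deformation, family, hf]
  simp [perturb, vars]

/-- The partial derivative by `x`. -/
abbrev dx (g : BigRing k r) : BigRing k r := pderiv (MvPowerSeries (Fin r) k) 0 g

/-- The partial derivative by `y`. -/
abbrev dy (g : BigRing k r) : BigRing k r := pderiv (MvPowerSeries (Fin r) k) 1 g

variable (s t : ℕ) (η : Fin r → MvPowerSeries (Fin 2) k)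

theorem dx_x_pow (n : ℕ) : dx (vars k r (Sum.inr 0) ^ n) = n * vars k r (Sum.inr 0) ^ (n - 1) := by
  rw [dx, pderiv_pow]; simp [vars]

theorem dx_y_pow (n : ℕ) : dx (vars k r (Sum.inr 1) ^ n) = 0 := by
  rw [dx, pderiv_pow]; simp [vars]

theorem dy_y_pow (n : ℕ) : dy (vars k r (Sum.inr 1) ^ n) = n * vars k r (Sum.inr 1) ^ (n - 1) := by
  rw [dy, pderiv_pow]; simp [vars]

theorem dy_x_pow (n : ℕ) : dy (vars k r (Sum.inr 0) ^ n) = 0 := by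
  rw [dy, pderiv_pow]; simp [vars]

theorem dx_natCast_mul (n : ℕ) (g : BigRing k r) :
    dx ((n : BigRing k r) * g) = (n : BigRing k r) * dx g := by
  rw [dx, Derivation.leibniz]; simp

theorem dy_natCast_mul (n : ℕ) (g : BigRing k r) :
    dy ((n : BigRing k r) * g) = (n : BigRing k r) * dy g := by
  rw [dy, Derivation.leibniz]; simp

theorem dx_family : dx (family s t η) =
    -(s * vars k r (Sum.inr 0) ^ (s - 1)) + perturb fun j => pderiv k 0 (η j) := by
  have h1 := dx_x_pow (k := k) (r := r) s
  have h2 := dx_y_pow (k := k) (r := r) t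
  rw [dx] at h1 h2
  rw [family, dx, map_add, map_sub, h1, h2, pderiv_perturb, zero_sub]

theorem dy_family : dy (family s t η) =
    t * vars k r (Sum.inr 1) ^ (t - 1) + perturb fun j => pderiv k 1 (η j) := by
  have h1 := dy_x_pow (k := k) (r := r) s
  have h2 := dy_y_pow (k := k) (r := r) t
  rw [dy] at h1 h2
  rw [family, dy, map_add, map_sub, h1, h2, pderiv_perturb, sub_zero]

theorem dx_dx_family : dx (dx (family s t η)) =
    -(s * ((s - 1 : ℕ) * vars k r (Sum.inr 0) ^ (s - 2))) +
      perturb fun j => pderiv k 0 (pderiv k 0 (η j)) := by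
  have h1 := dx_natCast_mul (k := k) (r := r) s (vars k r (Sum.inr 0) ^ (s - 1))
  rw [dx_x_pow, dx] at h1
  rw [dx_family, dx, map_add, map_neg, h1, pderiv_perturb]
  rfl

theorem dy_dx_family : dy (dx (family s t η)) =
    perturb fun j => pderiv k 1 (pderiv k 0 (η j)) := by
  have h1 := dy_natCast_mul (k := k) (r := r) s (vars k r (Sum.inr 0) ^ (s - 1))
  rw [dy_x_pow, dy] at h1
  rw [dx_family, dy, map_add, map_neg, h1, pderiv_perturb]
  simp

theorem dx_dy_family : dx (dy (family s t η)) =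
    perturb fun j => pderiv k 0 (pderiv k 1 (η j)) := by
  have h1 := dx_natCast_mul (k := k) (r := r) t (vars k r (Sum.inr 1) ^ (t - 1))
  rw [dx_y_pow, dx] at h1
  rw [dy_family, dx, map_add, h1, pderiv_perturb]
  simp

theorem dy_dy_family : dy (dy (family s t η)) =
    t * ((t - 1 : ℕ) * vars k r (Sum.inr 1) ^ (t - 2)) +
      perturb fun j => pderiv k 1 (pderiv k 1 (η j)) := by
  have h1 := dy_natCast_mul (k := k) (r := r) t (vars k r (Sum.inr 1) ^ (t - 1))
  rw [dy_y_pow, dy] at h1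
  rw [dy_family, dy, map_add, h1, pderiv_perturb]
  rfl

variable {s t}

theorem value_family (ht : 2 ≤ t) (hst : t ≤ s) : value k r (family s t η) = 0 := by
  simp only [family, map_add, map_sub, map_pow, value_vars, value_perturb]
  rw [zero_pow (by omega), zero_pow (by omega)]
  simp

theorem value_dx_family (ht : 2 ≤ t) (hst : t ≤ s) : value k r (dx (family s t η)) = 0 := by
  rw [dx_family]
  simp only [map_add, map_neg, map_mul, map_pow, value_vars, value_perturb]
  rw [zero_pow (by omega)]
  simp

theorem value_dy_family (ht : 2 ≤ t) : value k r (dy (family s t η)) = 0 := by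
  rw [dy_family]
  simp only [map_add, map_mul, map_pow, value_vars, value_perturb]
  rw [zero_pow (by omega)]
  simp

theorem isUnit_natCast [CharZero k] {n : ℕ} (hn : n ≠ 0) : IsUnit (n : BigRing k r) := by
  rw [isUnit_iff_value, map_natCast]
  exact_mod_cast hn

theorem mem_of_natCast_mul_mem [CharZero k] {n : ℕ} (hn : n ≠ 0) {I : Ideal (BigRing k r)}
    {g : BigRing k r} (h : (n : BigRing k r) * g ∈ I) : g ∈ I :=
  (Ideal.unit_mul_mem_iff_mem I (isUnit_natCast hn)).1 h

theorem perturb_mem {I : Ideal (BigRing k r)} (h : ∀ j, vars k r (Sum.inl j) ∈ I) :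
    perturb η ∈ I := Ideal.sum_mem _ fun j _ => Ideal.mul_mem_right _ _ (h j)

/-- Given the parameters, the variables `x`, `y` can be exchanged for the partial derivatives of
the equation. -/
theorem isWeaklyRegular_dx_dy [CharZero k] (ht : 2 ≤ t) (hst : t ≤ s) {rs : List (BigRing k r)}
    (hrs : ∀ j, vars k r (Sum.inl j) ∈ rs) (hm : ∀ a ∈ rs, value k r a = 0)
    (h : IsWeaklyRegular (BigRing k r) (rs ++ [vars k r (Sum.inr 1), vars k r (Sum.inr 0)])) :
    IsWeaklyRegular (BigRing k r) (rs ++ [dx (family s t η), dy (family s t η)]) := by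
  have hin : ∀ (I : Ideal (BigRing k r)), Ideal.ofList rs ≤ I → ∀ η' : Fin r → _,
      perturb (k := k) η' ∈ I := fun I hI η' =>
    perturb_mem η' fun j => hI (Ideal.subset_span (hrs j))
  have hmax : ∀ a b, value k r a = 0 → value k r b = 0 →
      ∀ c ∈ rs ++ [a, b], c ∈ IsLocalRing.maximalIdeal (BigRing k r) := by
    intro a b ha hb c hc
    rw [mem_maximalIdeal_iff_value]
    simp only [List.mem_append, List.mem_cons, List.not_mem_nil, or_false] at hc
    rcases hc with hc | rfl | rfl
    exacts [hm c hc, ha, hb]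
  -- Modulo the parameters, F_x is a unit times x^(s-1) and F_y a unit times y^(t-1), so each
  -- exchange is licensed by a power of a variable.
  have h1 : IsWeaklyRegular (BigRing k r) (rs ++ [vars k r (Sum.inr 1)] ++ [dx (family s t η)]) := by
    refine isWeaklyRegular_exchange (a := vars k r (Sum.inr 0)) (n := s - 1) (by simpa using h) ?_
    refine mem_of_natCast_mul_mem (n := s) (by omega) ?_
    rw [show (s : BigRing k r) * vars k r (Sum.inr 0) ^ (s - 1) =
      perturb (fun j => pderiv k 0 (η j)) - dx (family s t η) by rw [dx_family]; ring]
    refine sub_mem (hin _ ?_ _) (Ideal.mem_sup_right (Ideal.mem_span_singleton_self _))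
    rw [Ideal.ofList_append]
    exact le_sup_of_le_left le_sup_left
  have h2 := IsLocalRing.isWeaklyRegular_of_perm_of_subset_maximalIdeal
    (rs' := rs ++ [dx (family s t η)] ++ [vars k r (Sum.inr 1)]) h1
    (by simpa using List.Perm.append_left rs (List.Perm.swap _ _ []))
    (by simpa using hmax _ _ (value_vars _) (value_dx_family η ht hst))
  have h3 : IsWeaklyRegular (BigRing k r) (rs ++ [dx (family s t η)] ++ [dy (family s t η)]) := by
    refine isWeaklyRegular_exchange (n := t - 1) h2 ?_
    refine mem_of_natCast_mul_mem (n := t) (by omega) ?_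
    rw [show (t : BigRing k r) * vars k r (Sum.inr 1) ^ (t - 1) =
      dy (family s t η) - perturb (fun j => pderiv k 1 (η j)) by rw [dy_family]; ring]
    refine sub_mem (Ideal.mem_sup_right (Ideal.mem_span_singleton_self _)) (hin _ ?_ _)
    rw [Ideal.ofList_append]
    exact le_sup_of_le_left le_sup_left
  simpa using h3

theorem perm_regular {rs rs' : List (BigRing k r)} (h : IsWeaklyRegular (BigRing k r) rs)
    (hp : rs.Perm rs') (hm : ∀ a ∈ rs, value k r a = 0) : IsWeaklyRegular (BigRing k r) rs' :=
  IsLocalRing.isWeaklyRegular_of_perm_of_subset_maximalIdeal h hp fun a ha =>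
    mem_maximalIdeal_iff_value.2 (hm a ha)

theorem perm_rotate_three {α : Type*} (a b c : α) : List.Perm [a, b, c] [c, a, b] :=
  (List.perm_append_comm (l₁ := [a, b]) (l₂ := [c]))

/-- The sequence t_0, y, x becomes t_0, F_x, F_y; then t_0 is exchanged for F, some power of t_0
being in the ideal by hypothesis. -/
theorem isWeaklyRegular_family_one [CharZero k] (ht : 2 ≤ t) (hst : t ≤ s)
    (η : Fin 1 → MvPowerSeries (Fin 2) k) {n : ℕ}
    (hn : vars k 1 (Sum.inl 0) ^ n ∈
      Ideal.span {family s t η, dx (family s t η), dy (family s t η)}) :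
    IsWeaklyRegular (BigRing k 1) [family s t η, dx (family s t η), dy (family s t η)] := by
  have h0 := perm_regular (isWeaklyRegular_vars_one (k := k))
    (rs' := [vars k 1 (Sum.inl 0)] ++ [vars k 1 (Sum.inr 1), vars k 1 (Sum.inr 0)])
    (List.reverse_perm [vars k 1 (Sum.inl 0), vars k 1 (Sum.inr 1), vars k 1 (Sum.inr 0)])
    (by simp)
  have h1 := isWeaklyRegular_dx_dy η ht hst (rs := [vars k 1 (Sum.inl 0)])
    (by intro j; fin_cases j; simp) (by simp) h0
  have h2 := perm_regular h1 (rs' := [dx (family s t η), dy (family s t η)] ++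
    [vars k 1 (Sum.inl 0)]) (List.perm_append_comm)
    (by simp [value_dx_family η ht hst, value_dy_family η ht])
  have h3 := isWeaklyRegular_exchange (b := family s t η) (n := n) h2 (by
    rw [ofList_pair, ← Ideal.span_union]
    refine Ideal.span_mono ?_ hn
    rintro a (rfl | rfl | rfl) <;> simp)
  exact perm_regular h3 (perm_rotate_three _ _ _)
    (by simp [value_dx_family η ht hst, value_dy_family η ht, value_family η ht hst])

/-- The Euler relation. -/
theorem natCast_mul_family (ht : 2 ≤ t) (hst : t ≤ s) :
    ((s * t : ℕ) : BigRing k r) * family s t η =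
      t * (vars k r (Sum.inr 0) * dx (family s t η)) +
      s * (vars k r (Sum.inr 1) * dy (family s t η)) +
      ∑ j, vars k r (Sum.inl j) * (map C (((s * t : ℕ) : MvPowerSeries (Fin 2) k) * η j -
        (t : MvPowerSeries (Fin 2) k) * (X 0 * pderiv k 0 (η j)) -
        (s : MvPowerSeries (Fin 2) k) * (X 1 * pderiv k 1 (η j)))) := by
  have hs : vars k r (Sum.inr 0) * vars k r (Sum.inr 0) ^ (s - 1) = vars k r (Sum.inr 0) ^ s := by
    rw [← pow_succ', Nat.sub_add_cancel (by omega)]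
  have ht' : vars k r (Sum.inr 1) * vars k r (Sum.inr 1) ^ (t - 1) = vars k r (Sum.inr 1) ^ t := by
    rw [← pow_succ', Nat.sub_add_cancel (by omega)]
  have hsum : ∑ j, vars k r (Sum.inl j) * (map C (((s * t : ℕ) : MvPowerSeries (Fin 2) k) * η j -
        (t : MvPowerSeries (Fin 2) k) * (X 0 * pderiv k 0 (η j)) -
        (s : MvPowerSeries (Fin 2) k) * (X 1 * pderiv k 1 (η j)))) =
      ((s * t : ℕ) : BigRing k r) * perturb η -
        t * (vars k r (Sum.inr 0) * perturb fun j => pderiv k 0 (η j)) -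
        s * (vars k r (Sum.inr 1) * perturb fun j => pderiv k 1 (η j)) := by
    simp only [perturb, Finset.mul_sum, ← Finset.sum_sub_distrib]
    refine Finset.sum_congr rfl fun j _ => ?_
    simp only [map_sub, map_mul, map_natCast, map_X]
    simp only [vars, Sum.elim_inl, Sum.elim_inr]
    ring
  rw [hsum, dx_family, dy_family, family]
  push_cast
  linear_combination (t : BigRing k r) * s * hs - (t : BigRing k r) * s * ht'

theorem isWeaklyRegular_family_two [CharZero k] (ht : 2 ≤ t) (hst : t ≤ s)
    (η : Fin 2 → MvPowerSeries (Fin 2) k) (h1 : constantCoeff (η 1) ≠ 0) :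
    IsWeaklyRegular (BigRing k 2) [family s t η, dx (family s t η), dy (family s t η)] := by
  have h0 := perm_regular (isWeaklyRegular_vars_two (k := k))
    (rs' := [vars k 2 (Sum.inl 1), vars k 2 (Sum.inl 0)] ++
      [vars k 2 (Sum.inr 1), vars k 2 (Sum.inr 0)])
    (List.reverse_perm [vars k 2 (Sum.inl 1), vars k 2 (Sum.inl 0), vars k 2 (Sum.inr 1),
      vars k 2 (Sum.inr 0)])
    (by simp)
  have h2 := isWeaklyRegular_dx_dy η ht hst (rs := [vars k 2 (Sum.inl 1), vars k 2 (Sum.inl 0)])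
    (by intro j; fin_cases j <;> simp) (by simp) h0
  have h3 := perm_regular h2
    (rs' := [vars k 2 (Sum.inl 0), dx (family s t η), dy (family s t η)] ++ [vars k 2 (Sum.inl 1)])
    (List.perm_append_comm (l₁ := [vars k 2 (Sum.inl 1)])
      (l₂ := [vars k 2 (Sum.inl 0), dx (family s t η), dy (family s t η)]))
    (by simp [value_dx_family η ht hst, value_dy_family η ht])
  set I : Ideal (BigRing k 2) := Ideal.ofList [vars k 2 (Sum.inl 0), dx (family s t η),
    dy (family s t η)] ⊔ Ideal.span {family s t η} with hI
  have hle : ∀ a ∈ [vars k 2 (Sum.inl 0), dx (family s t η), dy (family s t η)], a ∈ I :=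
    fun a ha => Ideal.mem_sup_left (Ideal.subset_span ha)
  -- In the Euler relation the coefficient of t_1 has value s t η_1(0) at the origin, so it is a
  -- unit and t_1 lies in the ideal of t_0, F_x, F_y, F.
  have hmem : vars k 2 (Sum.inl 1) ^ 1 ∈ I := by
    have hE := natCast_mul_family η ht hst
    rw [Fin.sum_univ_two] at hE
    set u : BigRing k 2 := map C (((s * t : ℕ) : MvPowerSeries (Fin 2) k) * η 1 -
        (t : MvPowerSeries (Fin 2) k) * (X 0 * pderiv k 0 (η 1)) -
        (s : MvPowerSeries (Fin 2) k) * (X 1 * pderiv k 1 (η 1))) with hu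
    obtain ⟨w, hw⟩ : ∃ w : BigRing k 2, ((s * t : ℕ) : BigRing k 2) * family s t η =
      t * (vars k 2 (Sum.inr 0) * dx (family s t η)) +
      s * (vars k 2 (Sum.inr 1) * dy (family s t η)) +
      (vars k 2 (Sum.inl 0) * w + vars k 2 (Sum.inl 1) * u) := ⟨_, hE⟩
    have hunit : IsUnit u := by
      rw [isUnit_iff_value, hu, value_map_C]
      simp only [map_sub, map_mul, constantCoeff_X, map_natCast]
      simp only [zero_mul, mul_zero, sub_zero]
      exact mul_ne_zero (by exact_mod_cast Nat.mul_ne_zero (by omega) (by omega)) h1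
    rw [pow_one, ← Ideal.unit_mul_mem_iff_mem I hunit]
    rw [show u * vars k 2 (Sum.inl 1) = ((s * t : ℕ) : BigRing k 2) * family s t η -
      (t * (vars k 2 (Sum.inr 0) * dx (family s t η)) +
      s * (vars k 2 (Sum.inr 1) * dy (family s t η)) + vars k 2 (Sum.inl 0) * w) by
        rw [hw]; ring]
    refine sub_mem (Ideal.mul_mem_left _ _ (Ideal.mem_sup_right
      (Ideal.mem_span_singleton_self _))) (add_mem (add_mem ?_ ?_) ?_)
    · exact Ideal.mul_mem_left _ _ (Ideal.mul_mem_left _ _ (hle _ (by simp)))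
    · exact Ideal.mul_mem_left _ _ (Ideal.mul_mem_left _ _ (hle _ (by simp)))
    · exact Ideal.mul_mem_right _ _ (hle _ (by simp))
  have h4 := isWeaklyRegular_exchange h3 hmem
  have h5 := perm_regular h4
    (rs' := [family s t η, dx (family s t η), dy (family s t η)] ++ [vars k 2 (Sum.inl 0)])
    (by
      refine List.Perm.trans (List.perm_append_comm
        (l₁ := [vars k 2 (Sum.inl 0), dx (family s t η), dy (family s t η)])
        (l₂ := [family s t η])) ?_
      exact List.Perm.cons _ (List.perm_append_comm (l₁ := [vars k 2 (Sum.inl 0)])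
        (l₂ := [dx (family s t η), dy (family s t η)])))
    (by simp [value_dx_family η ht hst, value_dy_family η ht, value_family η ht hst])
  -- The parameter t_0 only helped with the exchanges and is dropped from the end.
  exact ((isWeaklyRegular_concat_iff _ _).1 h5).1

/-- In an admissible one-parameter family the singular locus is supported at the origin. -/
theorem exists_pow_mem_of_admissible (ht : 2 ≤ t) (hst : t ≤ s)
    (η : Fin 1 → MvPowerSeries (Fin 2) k) (hadm : Admissible (family s t η)) :
    ∃ n, vars k 1 (Sum.inl 0) ^ n ∈
      Ideal.span {family s t η, dx (family s t η), dy (family s t η)} := by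
  set F := family s t η with hF
  let A := TotalRing F
  let q : BigRing k 1 →+* A := Ideal.Quotient.mk (Ideal.span {F})
  have hFm : Ideal.span {F} ≤ IsLocalRing.maximalIdeal (BigRing k 1) := by
    rw [Ideal.span_singleton_le_iff_mem, mem_maximalIdeal_iff_value]
    exact value_family η ht hst
  have hnt : Nontrivial A := Ideal.Quotient.nontrivial_iff.2 fun h =>
    (IsLocalRing.maximalIdeal.isMaximal _).ne_top (top_le_iff.1 (h ▸ hFm))
  have hloc : IsLocalRing A := IsLocalRing.of_surjective' q Ideal.Quotient.mk_surjective
  set M := IsLocalRing.maximalIdeal A with hM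
  have hvars : ∀ Q : Ideal A, Q.IsPrime → q (vars k 1 (Sum.inl 0)) ∈ Q →
      q (vars k 1 (Sum.inr 0)) ∈ Q → M ≤ Q := by
    intro Q hQ h0 h1
    have h2 : q (vars k 1 (Sum.inr 1)) ∈ Q := by
      refine hQ.mem_of_pow_mem t ?_
      have h3 : q (vars k 1 (Sum.inr 1)) ^ t = q (vars k 1 (Sum.inr 0)) ^ s - q (perturb η) := by
        have h4 : q F = 0 := Ideal.Quotient.eq_zero_iff_mem.2 (Ideal.mem_span_singleton_self F)
        have h5 : q F = q (vars k 1 (Sum.inr 1)) ^ t - q (vars k 1 (Sum.inr 0)) ^ s +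
            q (perturb η) := by
          rw [← map_pow, ← map_pow, ← map_sub, ← map_add]; rfl
        rw [h5] at h4
        linear_combination h4
      rw [h3]
      refine sub_mem (Ideal.pow_mem_of_mem _ h1 _ (by omega)) ?_
      exact perturb_mem (I := Q.comap q) η fun j => by fin_cases j; exact h0
    intro g hg
    obtain ⟨g, rfl⟩ := Ideal.Quotient.mk_surjective g
    have hv : value k 1 g = 0 := by
      by_contra hne
      exact (IsLocalRing.mem_maximalIdeal _).1 hg ((isUnit_iff_value.2 hne).map q)
    have h5 := sub_value_mem_span_vars g
    rw [hv, map_zero, sub_zero] at h5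
    have h6 : Ideal.span (Set.range (vars k 1)) ≤ Q.comap q := by
      rw [Ideal.span_le]
      rintro _ ⟨i, rfl⟩
      rcases i with i | i <;> fin_cases i
      exacts [h0, h1, h2]
    exact h6 h5
  have hmemM : ∀ i, q (vars k 1 i) ∈ M := fun i => by
    rw [hM, IsLocalRing.mem_maximalIdeal, mem_nonunits_iff]
    intro hu
    obtain ⟨v, hv⟩ := hu.exists_right_inv
    obtain ⟨v, rfl⟩ := Ideal.Quotient.mk_surjective v
    rw [← map_mul, ← map_one q, Ideal.Quotient.eq] at hv
    have := mem_maximalIdeal_iff_value.1 (hFm hv)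
    simp at this
  -- Modulo t_0 and x the equation makes y nilpotent, so the maximal ideal is minimal over two
  -- elements and Krull's theorem applies.
  have hheight : M.height ≤ 2 := by
    classical
    have h1 : M ∈ (Ideal.span (({q (vars k 1 (Sum.inl 0)), q (vars k 1 (Sum.inr 0))} : Finset A) :
        Set A)).minimalPrimes := by
      refine ⟨⟨(IsLocalRing.maximalIdeal.isMaximal A).isPrime, ?_⟩, ?_⟩
      · rw [Ideal.span_le]
        intro a ha
        simp only [Finset.coe_insert, Finset.coe_singleton, Set.mem_insert_iff,
          Set.mem_singleton_iff] at ha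
        rcases ha with rfl | rfl <;> exact hmemM _
      · intro Q hQ _
        exact hvars Q hQ.1 (hQ.2 (Ideal.subset_span (by simp)))
          (hQ.2 (Ideal.subset_span (by simp)))
    refine (Ideal.height_le_card_of_mem_minimalPrimes_span_finset h1).trans ?_
    exact_mod_cast Finset.card_le_two
  -- A prime over the singular ideal that misses t_0 would lie strictly below the maximal ideal
  -- while having height at least two, forcing that ideal to height three.
  have hrad : q (vars k 1 (Sum.inl 0)) ∈ (singIdeal F).radical := by
    rw [Ideal.radical_eq_sInf, Ideal.mem_sInf]
    rintro P ⟨hle, hP⟩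
    by_contra hnot
    have hlt : P < M := lt_of_le_of_ne (IsLocalRing.le_maximalIdeal hP.ne_top)
      fun h => hnot (h ▸ hmemM _)
    have h1 : (2 : ℕ∞) ≤ P.height := le_trans hadm (Ideal.height_mono hle)
    have h2 := Ideal.height_add_one_le_of_lt_of_isPrime hlt
    have h3 : (2 : ℕ∞) + 1 ≤ 2 := (by gcongr : (2 : ℕ∞) + 1 ≤ P.height + 1).trans (h2.trans hheight)
    exact absurd h3 (by decide)
  obtain ⟨n, hn⟩ := hrad
  refine ⟨n, ?_⟩
  rw [← map_pow, singIdeal, show (Set.range fun i : Fin 2 => Ideal.Quotient.mk (Ideal.span {F})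
    (pderiv (MvPowerSeries (Fin 1) k) i F)) = {q (dx F), q (dy F)} by ext; simp [eq_comm, q],
    Ideal.mem_span_pair] at hn
  obtain ⟨a, b, hab⟩ := hn
  obtain ⟨a, rfl⟩ := Ideal.Quotient.mk_surjective a
  obtain ⟨b, rfl⟩ := Ideal.Quotient.mk_surjective b
  change q a * q (dx F) + q b * q (dy F) = _ at hab
  rw [← map_mul, ← map_mul, ← map_add, Ideal.Quotient.eq, Ideal.mem_span_singleton'] at hab
  obtain ⟨c, hc⟩ := hab
  rw [Ideal.mem_span_insert]
  refine ⟨-c, a * dx F + b * dy F, Ideal.mem_span_pair.2 ⟨a, b, rfl⟩, ?_⟩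
  linear_combination hc

end Deformations


/-! ### The degeneracy ideal of a pair of principal parts of order three -/

section Minors

variable {T : Type*} [CommRing T] (F : MvPowerSeries (Fin 2) T)

/-- The `n`-th Hamiltonian derivative along the diagonal. -/
def jet (n : ℕ) (g : MvPowerSeries (Fin 2 ⊕ Fin 2) T) : MvPowerSeries (Fin 2) T :=
  diag T ((hamilton F)^[n] g)

/-- The minors of the matrix of the Hamiltonian derivatives of two power series. -/
def minor (g : Fin 2 → MvPowerSeries (Fin 2 ⊕ Fin 2) T) (i j : ℕ) : MvPowerSeries (Fin 2) T :=
  jet F i (g 0) * jet F j (g 1) - jet F i (g 1) * jet F j (g 0)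

/-- The functionals 1, H, H² generate the dual, so by Cauchy–Binet every determinant is a
combination of the three minors, and each minor is itself such a determinant. -/
theorem degeneracyIdeal_eq_map
    (hex : ∀ a b : TotalRing F,
      Ideal.Quotient.mk _ (pderiv T 0 F) * a + Ideal.Quotient.mk _ (pderiv T 1 F) * b = 0 →
      ∃ e, a = Ideal.Quotient.mk _ (pderiv T 1 F) * e ∧
        b = -(Ideal.Quotient.mk _ (pderiv T 0 F) * e))
    (half : TotalRing F) (hhalf : 2 * half = 1) (g : Fin 2 → MvPowerSeries (Fin 2 ⊕ Fin 2) T) :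
    degeneracyIdeal (TotalRing F) (fun i => (Ideal.Quotient.mk _ (g i) : PrincipalParts F 3)) =
      (Ideal.span {minor F g 0 1, minor F g 0 2, minor F g 1 2}).map
        (Ideal.Quotient.mk (Ideal.span {F})) := by
  apply le_antisymm
  · rw [degeneracyIdeal, Ideal.span_le]
    rintro _ ⟨φ, rfl⟩
    obtain ⟨c₀, c₁, c₂, hc⟩ := exists_dual_eq F hex half hhalf (φ 0)
    obtain ⟨d₀, d₁, d₂, hd⟩ := exists_dual_eq F hex half hhalf (φ 1)
    have hmem : ∀ a ∈ ({minor F g 0 1, minor F g 0 2, minor F g 1 2} : Set _), ∀ c,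
        c * Ideal.Quotient.mk (Ideal.span {F}) a ∈
          (Ideal.span {minor F g 0 1, minor F g 0 2, minor F g 1 2}).map
            (Ideal.Quotient.mk (Ideal.span {F})) := fun a ha c =>
      Ideal.mul_mem_left _ _ (Ideal.mem_map_of_mem _ (Ideal.subset_span ha))
    have h := add_mem (add_mem (hmem (minor F g 0 1) (by simp) (c₀ * d₁ - c₁ * d₀))
      (hmem (minor F g 0 2) (by simp) (c₀ * d₂ - c₂ * d₀)))
      (hmem (minor F g 1 2) (by simp) (c₁ * d₂ - c₂ * d₁))
    beta_reduce
    rw [SetLike.mem_coe, Matrix.det_fin_two]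
    convert h using 1
    simp only [Matrix.of_apply, hc, hd, LinearMap.add_apply, LinearMap.smul_apply, dualZero_mk,
      dualOne_mk, dualTwo_mk, smul_eq_mul, minor, jet, map_sub, map_mul, Function.iterate_zero,
      Function.iterate_succ, Function.comp_apply, id]
    ring
  · rw [Ideal.map_le_iff_le_comap, Ideal.span_le]
    rintro _ (rfl | rfl | rfl)
    · refine Ideal.subset_span ⟨![dualZero F, dualOne F], ?_⟩
      beta_reduce
      rw [Matrix.det_fin_two]
      simp [dualZero_mk, dualOne_mk, minor, jet]
    · refine Ideal.subset_span ⟨![dualZero F, dualTwo F], ?_⟩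
      beta_reduce
      rw [Matrix.det_fin_two]
      simp [dualZero_mk, dualTwo_mk, minor, jet]
    · refine Ideal.subset_span ⟨![dualOne F, dualTwo F], ?_⟩
      beta_reduce
      rw [Matrix.det_fin_two]
      simp [dualOne_mk, dualTwo_mk, minor, jet]

theorem comap_degeneracyIdeal
    (hex : ∀ a b : TotalRing F,
      Ideal.Quotient.mk _ (pderiv T 0 F) * a + Ideal.Quotient.mk _ (pderiv T 1 F) * b = 0 →
      ∃ e, a = Ideal.Quotient.mk _ (pderiv T 1 F) * e ∧
        b = -(Ideal.Quotient.mk _ (pderiv T 0 F) * e))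
    (half : TotalRing F) (hhalf : 2 * half = 1) (g : Fin 2 → MvPowerSeries (Fin 2 ⊕ Fin 2) T) :
    (degeneracyIdeal (TotalRing F)
        (fun i => (Ideal.Quotient.mk _ (g i) : PrincipalParts F 3))).comap
      (Ideal.Quotient.mk (Ideal.span {F})) =
      Ideal.span {F, minor F g 0 1, minor F g 0 2, minor F g 1 2} := by
  rw [degeneracyIdeal_eq_map F hex half hhalf,
    Ideal.comap_map_of_surjective _ Ideal.Quotient.mk_surjective, ← RingHom.ker_eq_comap_bot,
    Ideal.mk_ker, Ideal.span_insert F, sup_comm]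

/-- Laplace expansion of the vanishing 3×3 determinant with columns g_0, g_0, g_1. It makes the
minor M_12 redundant as soon as g_0 is a unit on the diagonal. -/
theorem jet_zero_mul_minor (g : Fin 2 → MvPowerSeries (Fin 2 ⊕ Fin 2) T) :
    jet F 0 (g 0) * minor F g 1 2 = jet F 1 (g 0) * minor F g 0 2 - jet F 2 (g 0) * minor F g 0 1 := by
  simp only [minor]
  ring

theorem span_minors_eq_of_isUnit {g : Fin 2 → MvPowerSeries (Fin 2 ⊕ Fin 2) T}
    (hu : IsUnit (diag T (g 0))) :
    Ideal.span {F, minor F g 0 1, minor F g 0 2, minor F g 1 2} =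
      Ideal.span {F, minor F g 0 1, minor F g 0 2} := by
  apply le_antisymm
  · rw [Ideal.span_le]
    have h : ∀ a ∈ ({F, minor F g 0 1, minor F g 0 2} : Set (MvPowerSeries (Fin 2) T)),
        a ∈ Ideal.span {F, minor F g 0 1, minor F g 0 2} := fun a ha => Ideal.subset_span ha
    rintro _ (rfl | rfl | rfl | rfl)
    · exact h _ (by simp)
    · exact h _ (by simp)
    · exact h _ (by simp)
    · rw [SetLike.mem_coe, ← Ideal.unit_mul_mem_iff_mem _ hu]
      change jet F 0 (g 0) * _ ∈ _
      rw [jet_zero_mul_minor]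
      exact sub_mem (Ideal.mul_mem_left _ _ (h _ (by simp))) (Ideal.mul_mem_left _ _ (h _ (by simp)))
  · refine Ideal.span_mono ?_
    rintro _ (rfl | rfl | rfl) <;> simp

/-- The second factor of the second minor. -/
def cofactor (ρ σ : MvPowerSeries (Fin 2) T) : MvPowerSeries (Fin 2) T :=
  pderiv T 1 (pderiv T 1 F) - ρ * pderiv T 0 (pderiv T 1 F) - ρ * pderiv T 1 (pderiv T 0 F) +
    ρ ^ 2 * pderiv T 0 (pderiv T 0 F) + pderiv T 0 F * σ

/-- The first minor, up to a unit. -/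
def slope (ρ : MvPowerSeries (Fin 2) T) : MvPowerSeries (Fin 2) T :=
  pderiv T 1 F - ρ * pderiv T 0 F

/-- With Q and R the Wronskians of g_0, g_1 for ∂_u and ∂_v and ρ = R/Q, the first minor is Q F_y -
R F_x = Q G. Putting F_y = ρ F_x in the second minor leaves -Q F_x K. -/
theorem exists_span_minors_eq {g : Fin 2 → MvPowerSeries (Fin 2 ⊕ Fin 2) T}
    (hu : IsUnit (diag T (g 0)))
    (hQ : IsUnit (diag T (g 0) * diag T (pderiv T (Sum.inr 0) (g 1)) -
      diag T (g 1) * diag T (pderiv T (Sum.inr 0) (g 0)))) :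
    ∃ ρ σ, ρ * (diag T (g 0) * diag T (pderiv T (Sum.inr 0) (g 1)) -
        diag T (g 1) * diag T (pderiv T (Sum.inr 0) (g 0))) =
      diag T (g 0) * diag T (pderiv T (Sum.inr 1) (g 1)) -
        diag T (g 1) * diag T (pderiv T (Sum.inr 1) (g 0)) ∧
      Ideal.span {F, minor F g 0 1, minor F g 0 2, minor F g 1 2} =
        Ideal.span {F, slope F ρ, pderiv T 0 F * cofactor F ρ σ} := by
  obtain ⟨Qi, hQi⟩ := hQ.exists_right_inv
  set p := fun i => diag T (g i) with hp
  set q := fun i => diag T (pderiv T (Sum.inr 0) (g i)) with hq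
  set r := fun i => diag T (pderiv T (Sum.inr 1) (g i)) with hr
  set Q := p 0 * q 1 - p 1 * q 0 with hQdef
  set R := p 0 * r 1 - p 1 * r 0 with hRdef
  change Q * Qi = 1 at hQi
  set D := fun a b : Fin 2 => p 0 * diag T (pderiv T (Sum.inr a) (pderiv T (Sum.inr b) (g 1))) -
    p 1 * diag T (pderiv T (Sum.inr a) (pderiv T (Sum.inr b) (g 0))) with hD
  set ρ := R * Qi with hρ
  have hρQ : ρ * Q = R := by rw [hρ]; linear_combination R * hQi
  -- Modulo G the second derivatives of g_0, g_1 enter the second minor only through a multiple of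
  -- F_x²; `σ` records that multiple, divided by -Q.
  set σ := -(Qi * (ρ ^ 2 * D 0 0 - ρ * D 0 1 - ρ * D 1 0 + D 1 1)) with hσ
  refine ⟨ρ, σ, hρQ, ?_⟩
  have h1 : minor F g 0 1 = Q * slope F ρ := by
    change diag T (g 0) * diag T (hamilton F (g 1)) - diag T (g 1) * diag T (hamilton F (g 0)) = _
    rw [diag_hamilton, diag_hamilton, slope]
    linear_combination (pderiv T 0 F) * hρQ
  have hQσ : Q * σ = -(ρ ^ 2 * D 0 0 - ρ * D 0 1 - ρ * D 1 0 + D 1 1) := by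
    rw [hσ]
    linear_combination (-(ρ ^ 2 * D 0 0 - ρ * D 0 1 - ρ * D 1 0 + D 1 1)) * hQi
  have h2 : minor F g 0 2 = (pderiv T 0 (pderiv T 1 F) * Q - pderiv T 0 (pderiv T 0 F) * R -
      pderiv T 0 F * D 0 1 + pderiv T 1 F * D 0 0 + ρ * pderiv T 0 F * D 0 0 -
      pderiv T 0 F * D 1 0) * slope F ρ - Q * (pderiv T 0 F * cofactor F ρ σ) := by
    change diag T (g 0) * diag T (hamilton F (hamilton F (g 1))) -
      diag T (g 1) * diag T (hamilton F (hamilton F (g 0))) = _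
    rw [diag_hamilton_hamilton, diag_hamilton_hamilton, slope, cofactor]
    clear_value σ ρ
    linear_combination (ρ * pderiv T 0 F * pderiv T 0 (pderiv T 0 F) -
      pderiv T 0 F * pderiv T 1 (pderiv T 0 F)) * hρQ + pderiv T 0 F ^ 2 * hQσ
  rw [span_minors_eq_of_isUnit F hu, h1, h2]
  have hQ' : IsUnit Q := hQ
  generalize (pderiv T 0 (pderiv T 1 F) * Q - pderiv T 0 (pderiv T 0 F) * R -
      pderiv T 0 F * D 0 1 + pderiv T 1 F * D 0 0 + ρ * pderiv T 0 F * D 0 0 -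
      pderiv T 0 F * D 1 0) = c
  generalize pderiv T 0 F * cofactor F ρ σ = z
  generalize slope F ρ = y
  have hle : ∀ {A B : Set (MvPowerSeries (Fin 2) T)}, (∀ a ∈ A, a ∈ Ideal.span B) →
    Ideal.span A ≤ Ideal.span B := fun h => Ideal.span_le.2 h
  apply le_antisymm
  · refine hle ?_
    have h : ∀ a ∈ ({F, y, z} : Set (MvPowerSeries (Fin 2) T)), a ∈ Ideal.span {F, y, z} :=
      fun a ha => Ideal.subset_span ha
    rintro _ (rfl | rfl | rfl)
    · exact h _ (by simp)
    · exact Ideal.mul_mem_left _ _ (h _ (by simp))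
    · exact sub_mem (Ideal.mul_mem_left _ _ (h _ (by simp)))
        (Ideal.mul_mem_left _ _ (h _ (by simp)))
  · refine hle ?_
    have h : ∀ a ∈ ({F, Q * y, c * y - Q * z} : Set (MvPowerSeries (Fin 2) T)),
      a ∈ Ideal.span {F, Q * y, c * y - Q * z} := fun a ha => Ideal.subset_span ha
    have hy : y ∈ Ideal.span {F, Q * y, c * y - Q * z} :=
      (Ideal.unit_mul_mem_iff_mem _ hQ').1 (h _ (by simp))
    rintro _ (rfl | rfl | rfl)
    · exact h _ (by simp)
    · exact hy
    · refine (Ideal.unit_mul_mem_iff_mem _ hQ').1 ?_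
      have h3 := sub_mem (Ideal.mul_mem_left _ c hy) (h _ (Or.inr (Or.inr rfl)))
      rwa [sub_sub_cancel] at h3

end Minors


/-! ### Leading forms -/

section Leading

variable {k : Type*} [Field k] {r s t : ℕ} (η : Fin r → MvPowerSeries (Fin 2) k)

/-- The leading form of a perturbation. -/
def lead (c : Fin r → k) : BigRing k r := ∑ j, c j • vars k r (Sum.inl j)

theorem x_pow_mem_wIdeal (n : ℕ) :
    vars k r (Sum.inr 0) ^ n ∈ wIdeal (vars k r) (wts r s t) (n * (t - 1)) :=
  pow_mem_wIdeal (X_mem_wIdeal (Sum.inr 0)) n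

theorem y_pow_mem_wIdeal (n : ℕ) :
    vars k r (Sum.inr 1) ^ n ∈ wIdeal (vars k r) (wts r s t) (n * (s - 1)) :=
  pow_mem_wIdeal (X_mem_wIdeal (Sum.inr 1)) n

theorem lead_mem_wIdeal (c : Fin r → k) :
    lead c ∈ wIdeal (vars k r) (wts r s t) ((s - 1) * (t - 1)) :=
  Ideal.sum_mem _ fun j _ => Submodule.smul_of_tower_mem _ _ (X_inl_mem_wIdeal j)

theorem perturb_sub_lead_mem (ht : 2 ≤ t) (hst : t ≤ s) :
    perturb η - lead (fun j => constantCoeff (η j)) ∈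
      wIdeal (vars k r) (wts r s t) ((s - 1) * (t - 1) + 1) :=
  perturb_sub_mem_wIdeal ht hst η

theorem family_sub_lead_mem (ht : 2 ≤ t) (hst : t ≤ s) :
    family s t η - lead (fun j => constantCoeff (η j)) ∈
      wIdeal (vars k r) (wts r s t) ((s - 1) * (t - 1) + 1) := by
  rw [family, add_sub_assoc]
  refine add_mem (sub_mem (wIdeal_anti ?_ (y_pow_mem_wIdeal t))
    (wIdeal_anti ?_ (x_pow_mem_wIdeal s))) (perturb_sub_lead_mem η ht hst)
  · obtain ⟨a, rfl⟩ := Nat.exists_eq_add_of_le ht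
    obtain ⟨b, rfl⟩ := Nat.exists_eq_add_of_le hst
    simp only [show 2 + a + b - 1 = a + b + 1 by omega, show 2 + a - 1 = a + 1 by omega]
    nlinarith
  · obtain ⟨a, rfl⟩ := Nat.exists_eq_add_of_le ht
    obtain ⟨b, rfl⟩ := Nat.exists_eq_add_of_le hst
    simp only [show 2 + a + b - 1 = a + b + 1 by omega, show 2 + a - 1 = a + 1 by omega]
    nlinarith

theorem dx_family_sub_lead_mem (ht : 2 ≤ t) (hst : t ≤ s) :
    dx (family s t η) - (lead (fun j => constantCoeff (pderiv k 0 (η j))) -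
      (s : k) • vars k r (Sum.inr 0) ^ (s - 1)) ∈
      wIdeal (vars k r) (wts r s t) ((s - 1) * (t - 1) + 1) := by
  have h := perturb_sub_lead_mem (fun j => pderiv k 0 (η j)) ht hst
  rw [dx_family, Algebra.smul_def, map_natCast]
  convert h using 1
  ring

theorem dy_family_sub_lead_mem (ht : 2 ≤ t) (hst : t ≤ s) :
    dy (family s t η) - (lead (fun j => constantCoeff (pderiv k 1 (η j))) +
      (t : k) • vars k r (Sum.inr 1) ^ (t - 1)) ∈
      wIdeal (vars k r) (wts r s t) ((s - 1) * (t - 1) + 1) := by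
  have h := perturb_sub_lead_mem (fun j => pderiv k 1 (η j)) ht hst
  rw [dy_family, Algebra.smul_def, map_natCast]
  convert h using 1
  ring

theorem family_mem_wIdeal (ht : 2 ≤ t) (hst : t ≤ s) :
    family s t η ∈ wIdeal (vars k r) (wts r s t) ((s - 1) * (t - 1)) := by
  have h := add_mem (wIdeal_anti (Nat.le_succ _) (family_sub_lead_mem η ht hst))
    (lead_mem_wIdeal (s := s) (t := t) fun j => constantCoeff (η j))
  rwa [sub_add_cancel] at h

theorem dx_family_mem_wIdeal :
    dx (family s t η) ∈ wIdeal (vars k r) (wts r s t) ((s - 1) * (t - 1)) := by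
  rw [dx_family]
  exact add_mem (neg_mem (Ideal.mul_mem_left _ _ (x_pow_mem_wIdeal _))) (perturb_mem_wIdeal s t _)

theorem dy_family_mem_wIdeal :
    dy (family s t η) ∈ wIdeal (vars k r) (wts r s t) ((s - 1) * (t - 1)) := by
  rw [dy_family, mul_comm (s - 1)]
  refine add_mem (Ideal.mul_mem_left _ _ (y_pow_mem_wIdeal _)) ?_
  rw [mul_comm]
  exact perturb_mem_wIdeal s t _

theorem weight_add (ht : 2 ≤ t) : (t - 2) * (s - 1) + (s - 1) = (s - 1) * (t - 1) := by
  rw [show t - 1 = t - 2 + 1 by omega]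
  ring

/-- For t ≥ 2 the difference of the two sides is s - t; so F_xx is never lighter than F_yy. -/
theorem weight_x_le (hst : t ≤ s) : (t - 2) * (s - 1) ≤ (s - 2) * (t - 1) := by
  rcases Nat.lt_or_ge t 2 with h | h
  · rw [show t - 2 = 0 by omega, zero_mul]; exact Nat.zero_le _
  · obtain ⟨a, rfl⟩ := Nat.exists_eq_add_of_le h
    obtain ⟨b, rfl⟩ := Nat.exists_eq_add_of_le hst
    simp only [show 2 + a + b - 1 = a + b + 1 by omega, show 2 + a - 1 = a + 1 by omega,
      show 2 + a + b - 2 = a + b by omega, show 2 + a - 2 = a by omega]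
    nlinarith

theorem wIdeal_D_le (ht : 2 ≤ t) (hst : t ≤ s) : wIdeal (vars k r) (wts r s t) ((s - 1) * (t - 1)) ≤
    wIdeal (vars k r) (wts r s t) ((t - 2) * (s - 1) + 1) := by
  refine wIdeal_anti ?_
  rw [← weight_add (s := s) ht]
  omega

theorem dx_dx_family_mem_wIdeal (ht : 2 ≤ t) (hst : t ≤ s) :
    dx (dx (family s t η)) ∈ wIdeal (vars k r) (wts r s t) ((t - 2) * (s - 1)) := by
  rw [dx_dx_family]
  exact add_mem (neg_mem (Ideal.mul_mem_left _ _ (Ideal.mul_mem_left _ _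
    (wIdeal_anti (weight_x_le hst) (x_pow_mem_wIdeal _)))))
    (wIdeal_anti (Nat.le_succ _) (wIdeal_D_le ht hst (perturb_mem_wIdeal s t _)))

theorem dy_dy_family_mem_wIdeal (ht : 2 ≤ t) (hst : t ≤ s) :
    dy (dy (family s t η)) ∈ wIdeal (vars k r) (wts r s t) ((t - 2) * (s - 1)) := by
  rw [dy_dy_family]
  exact add_mem (Ideal.mul_mem_left _ _ (Ideal.mul_mem_left _ _ (y_pow_mem_wIdeal _)))
    (wIdeal_anti (Nat.le_succ _) (wIdeal_D_le ht hst (perturb_mem_wIdeal s t _)))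

theorem dy_dx_family_mem_wIdeal (ht : 2 ≤ t) (hst : t ≤ s) :
    dy (dx (family s t η)) ∈ wIdeal (vars k r) (wts r s t) ((t - 2) * (s - 1) + 1) := by
  rw [dy_dx_family]
  exact wIdeal_D_le ht hst (perturb_mem_wIdeal s t _)

theorem dx_dy_family_mem_wIdeal (ht : 2 ≤ t) (hst : t ≤ s) :
    dx (dy (family s t η)) ∈ wIdeal (vars k r) (wts r s t) ((t - 2) * (s - 1) + 1) := by
  rw [dx_dy_family]
  exact wIdeal_D_le ht hst (perturb_mem_wIdeal s t _)

theorem jet_one_mem_wIdeal (g : MvPowerSeries (Fin 2 ⊕ Fin 2) (MvPowerSeries (Fin r) k)) :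
    jet (family s t η) 1 g ∈ wIdeal (vars k r) (wts r s t) ((s - 1) * (t - 1)) := by
  change diag _ (hamilton _ g) ∈ _
  rw [diag_hamilton]
  exact sub_mem (Ideal.mul_mem_right _ _ (dy_family_mem_wIdeal η))
    (Ideal.mul_mem_right _ _ (dx_family_mem_wIdeal η))

/-- Every term of H² on the diagonal is a first derivative of F, of weight at least D, times a
factor containing a first or second derivative of F, of weight at least (t-2)(s-1). -/
theorem jet_two_mem_wIdeal (ht : 2 ≤ t) (hst : t ≤ s)
    (g : MvPowerSeries (Fin 2 ⊕ Fin 2) (MvPowerSeries (Fin r) k)) :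
    jet (family s t η) 2 g ∈
      wIdeal (vars k r) (wts r s t) ((s - 1) * (t - 1) + (t - 2) * (s - 1)) := by
  have hx := wIdeal_anti (Nat.le_succ _) (wIdeal_D_le ht hst (dx_family_mem_wIdeal (s := s) (t := t) η))
  have hy := wIdeal_anti (Nat.le_succ _) (wIdeal_D_le ht hst (dy_family_mem_wIdeal (s := s) (t := t) η))
  change diag _ (hamilton _ (hamilton _ g)) ∈ _
  rw [diag_hamilton_hamilton]
  refine sub_mem (mul_mem_wIdeal (dy_family_mem_wIdeal η) (sub_mem (sub_mem (add_mem ?_ ?_) ?_) ?_))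
    (mul_mem_wIdeal (dx_family_mem_wIdeal η) (sub_mem (sub_mem (add_mem ?_ ?_) ?_) ?_))
  · exact Ideal.mul_mem_right _ _ (wIdeal_anti (Nat.le_succ _) (dx_dy_family_mem_wIdeal η ht hst))
  · exact Ideal.mul_mem_right _ _ hy
  · exact Ideal.mul_mem_right _ _ (dx_dx_family_mem_wIdeal η ht hst)
  · exact Ideal.mul_mem_right _ _ hx
  · exact Ideal.mul_mem_right _ _ (dy_dy_family_mem_wIdeal η ht hst)
  · exact Ideal.mul_mem_right _ _ hy
  · exact Ideal.mul_mem_right _ _ (wIdeal_anti (Nat.le_succ _) (dy_dx_family_mem_wIdeal η ht hst))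
  · exact Ideal.mul_mem_right _ _ hx

theorem slope_mem_wIdeal (ρ : BigRing k r) :
    slope (family s t η) ρ ∈ wIdeal (vars k r) (wts r s t) ((s - 1) * (t - 1)) :=
  sub_mem (dy_family_mem_wIdeal η) (Ideal.mul_mem_left _ _ (dx_family_mem_wIdeal η))

theorem cofactor_mem_wIdeal (ht : 2 ≤ t) (hst : t ≤ s) (ρ σ : BigRing k r) :
    cofactor (family s t η) ρ σ ∈ wIdeal (vars k r) (wts r s t) ((t - 2) * (s - 1)) := by
  refine add_mem (add_mem (sub_mem (sub_mem (dy_dy_family_mem_wIdeal η ht hst)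
    (Ideal.mul_mem_left _ _ ?_)) (Ideal.mul_mem_left _ _ ?_)) (Ideal.mul_mem_left _ _ ?_))
    (Ideal.mul_mem_right _ _ ?_)
  · exact wIdeal_anti (Nat.le_succ _) (dx_dy_family_mem_wIdeal η ht hst)
  · exact wIdeal_anti (Nat.le_succ _) (dy_dx_family_mem_wIdeal η ht hst)
  · exact dx_dx_family_mem_wIdeal η ht hst
  · exact wIdeal_anti (Nat.le_succ _) (wIdeal_D_le ht hst (dx_family_mem_wIdeal η))

theorem slope_sub_lead_mem (ht : 2 ≤ t) (hst : t ≤ s) (ρ : BigRing k r) :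
    slope (family s t η) ρ - (lead (fun j => constantCoeff (pderiv k 1 (η j)) -
        value k r ρ * constantCoeff (pderiv k 0 (η j))) +
      (t : k) • vars k r (Sum.inr 1) ^ (t - 1) +
      (value k r ρ * s) • vars k r (Sum.inr 0) ^ (s - 1)) ∈
      wIdeal (vars k r) (wts r s t) ((s - 1) * (t - 1) + 1) := by
  have h1 := dy_family_sub_lead_mem η ht hst
  have h2 := mul_sub_smul_mem_wIdeal ht hst ρ (dx_family_mem_wIdeal (s := s) (t := t) η)
  have h3 := Submodule.smul_of_tower_mem _ (value k r ρ) (dx_family_sub_lead_mem η ht hst)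
  have h4 : lead (fun j => constantCoeff (pderiv k 1 (η j)) -
        value k r ρ * constantCoeff (pderiv k 0 (η j))) =
      lead (fun j => constantCoeff (pderiv k 1 (η j))) -
        value k r ρ • lead (fun j => constantCoeff (pderiv k 0 (η j))) := by
    simp only [lead, Finset.smul_sum, ← Finset.sum_sub_distrib, sub_smul, mul_smul]
  have h5 := sub_mem (sub_mem h1 h2) h3
  convert h5 using 1
  rw [h4, slope, mul_smul]
  simp only [smul_sub]
  abel

/-- Only the pure second derivatives of y^t - x^s survive: the mixed derivatives, the perturbation
terms and σ F_x all have weight at least D, which exceeds (t-2)(s-1). -/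
theorem cofactor_sub_lead_mem (ht : 2 ≤ t) (hst : t ≤ s) (ρ σ : BigRing k r) :
    cofactor (family s t η) ρ σ - ((t * (t - 1 : ℕ) : k) • vars k r (Sum.inr 1) ^ (t - 2) -
      (value k r ρ ^ 2 * (s * (s - 1 : ℕ)) : k) • vars k r (Sum.inr 0) ^ (s - 2)) ∈
      wIdeal (vars k r) (wts r s t) ((t - 2) * (s - 1) + 1) := by
  have hp := fun η' => wIdeal_D_le ht hst (perturb_mem_wIdeal (k := k) (r := r) s t η')
  have h1 : dy (dy (family s t η)) - (t * (t - 1 : ℕ) : k) • vars k r (Sum.inr 1) ^ (t - 2) ∈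
      wIdeal (vars k r) (wts r s t) ((t - 2) * (s - 1) + 1) := by
    rw [dy_dy_family, Algebra.smul_def, map_mul, map_natCast, map_natCast, mul_assoc,
      add_sub_cancel_left]
    exact hp _
  have h2 : ρ ^ 2 * dx (dx (family s t η)) + (value k r ρ ^ 2 * (s * (s - 1 : ℕ)) : k) •
      vars k r (Sum.inr 0) ^ (s - 2) ∈
      wIdeal (vars k r) (wts r s t) ((t - 2) * (s - 1) + 1) := by
    have h3 := wIdeal_anti (Nat.succ_le_succ (weight_x_le hst)) (mul_sub_smul_mem_wIdeal ht hst
      (ρ ^ 2) (x_pow_mem_wIdeal (k := k) (r := r) (s := s) (t := t) (s - 2)))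
    have h4 := Ideal.mul_mem_left _ (ρ ^ 2) (hp fun j => pderiv k 0 (pderiv k 0 (η j)))
    have h5 := sub_mem h4 (Submodule.smul_of_tower_mem _ (s * (s - 1 : ℕ) : k) h3)
    convert h5 using 1
    rw [dx_dx_family, map_pow]
    simp only [Algebra.smul_def, map_mul, map_natCast, map_pow]
    ring
  have h6 := add_mem (add_mem (sub_mem (sub_mem h1
    (Ideal.mul_mem_left _ ρ (dx_dy_family_mem_wIdeal η ht hst)))
    (Ideal.mul_mem_left _ ρ (dy_dx_family_mem_wIdeal η ht hst))) h2)
    (Ideal.mul_mem_right σ _ (wIdeal_D_le ht hst (dx_family_mem_wIdeal η)))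
  convert h6 using 1
  rw [cofactor]
  ring

end Leading


/-! ### The degeneracy of one-parameter families -/

section Quotients

variable {k R : Type*} [Field k] [CommRing R] [Algebra k R]

/-- The projection to an iterated quotient. -/
def projQuot (k : Type*) [Field k] {R : Type*} [CommRing R] [Algebra k R] (J : Ideal R)
    (I : Ideal (R ⧸ J)) : R →ₗ[k] (R ⧸ J) ⧸ I :=
  ((Ideal.Quotient.mkₐ k I).comp (Ideal.Quotient.mkₐ k J)).toLinearMap

theorem projQuot_surjective (J : Ideal R) (I : Ideal (R ⧸ J)) :
    Function.Surjective (projQuot k J I) :=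
  (Ideal.Quotient.mk_surjective (I := I)).comp (Ideal.Quotient.mk_surjective (I := J))

theorem ker_projQuot (J : Ideal R) (I : Ideal (R ⧸ J)) :
    LinearMap.ker (projQuot k J I) = (I.comap (Ideal.Quotient.mk J)).restrictScalars k := by
  ext g
  exact Ideal.Quotient.eq_zero_iff_mem

end Quotients

/-! ### The lower bound for admissible one-parameter families. -/

section OneParameter

variable {k : Type*} [Field k] {r s t : ℕ}

theorem exists_half [CharZero k] (F : BigRing k r) : ∃ half : TotalRing F, 2 * half = 1 := by
  refine ⟨Ideal.Quotient.mk _ (algebraMap k _ 2⁻¹), ?_⟩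
  rw [← map_ofNat (Ideal.Quotient.mk (Ideal.span {F})), ← map_mul,
    ← map_ofNat (algebraMap k (BigRing k r)), ← map_mul, mul_inv_cancel₀ two_ne_zero, map_one,
    map_one]

theorem comap_degeneracyIdeal_of_isWeaklyRegular [CharZero k] {F : BigRing k r}
    (h : IsWeaklyRegular (BigRing k r) [F, dx F, dy F])
    (g : Fin 2 → MvPowerSeries (Fin 2 ⊕ Fin 2) (MvPowerSeries (Fin r) k)) :
    (degeneracyIdeal (TotalRing F)
        (fun i => (Ideal.Quotient.mk _ (g i) : PrincipalParts F 3))).comap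
      (Ideal.Quotient.mk (Ideal.span {F})) =
      Ideal.span {F, minor F g 0 1, minor F g 0 2, minor F g 1 2} := by
  obtain ⟨half, hhalf⟩ := exists_half F
  exact comap_degeneracyIdeal F (exists_of_isWeaklyRegular h) half hhalf g

theorem exists_lift {F : BigRing k r} (τ : Fin 2 → PrincipalParts F 3) :
    ∃ g : Fin 2 → MvPowerSeries (Fin 2 ⊕ Fin 2) (MvPowerSeries (Fin r) k),
      τ = fun i => Ideal.Quotient.mk _ (g i) := by
  choose g hg using fun i => Ideal.Quotient.mk_surjective (τ i)
  exact ⟨g, funext fun i => (hg i).symm⟩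

theorem span_range_vec_four {R : Type*} [CommRing R] (a b c d : R) :
    Ideal.span (Set.range ![a, b, c, d]) = Ideal.span {a, b, c, d} := by
  congr 1
  ext z
  simp only [Matrix.range_cons, Matrix.range_empty, Set.union_empty, Set.mem_union,
    Set.mem_singleton_iff, Set.mem_insert_iff]

/-- After a general translation of the first principal part only three minors matter. -/
theorem le_of_top_le_span_sup_minors [CharZero k] (ht : 2 ≤ t) (hst : t ≤ s)
    (η : Fin 1 → MvPowerSeries (Fin 2) k)
    (g : Fin 2 → MvPowerSeries (Fin 2 ⊕ Fin 2) (MvPowerSeries (Fin 1) k)) {l : ℕ}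
    (e : Fin l → BigRing k 1)
    (he : ⊤ ≤ Submodule.span k (Set.range e) ⊔
      (Ideal.span {family s t η, minor (family s t η) g 0 1, minor (family s t η) g 0 2,
        minor (family s t η) g 1 2}).restrictScalars k) :
    (2 * t - 3) * (s - 1) ≤ l := by
  set F := family s t η with hF
  -- Relative to t_0, x and y, the orders of F, M_01 and M_02 are at least 1, s-1 and 2t-3 times the
  -- weight of the variable.
  have hprod : ∏ i, (Sum.elim (fun _ => 1) ![s - 1, 2 * t - 3] : Fin 1 ⊕ Fin 2 → ℕ) i =
      (2 * t - 3) * (s - 1) := by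
    simp [Fintype.prod_sum_type, mul_comm]
  rw [← hprod]
  refine prod_le_of_forall_span (k := k) (X := vars k 1) (wts_pos ht hst) (linearIndependent_mon
    (wts_pos ht hst)) fun N => ?_
  have hfin : Module.Finite k (BigRing k 1 ⧸ wIdeal (vars k 1) (wts 1 s t) N) :=
    finite_quotient_wIdeal (wts_pos ht hst) exists_sub_algebraMap_mem N
  let a : Fin 4 → BigRing k 1 := ![F, minor F g 0 1, minor F g 0 2, minor F g 1 2]
  -- Adding a constant ε to g_0 changes M_01 and M_02 by ε times the jets of g_1. It leaves F and
  -- M_12 alone because H kills constants; the excluded value of ε is the one at which g_0 + ε is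
  -- not a unit on the diagonal.
  let b : Fin 4 → BigRing k 1 := ![0, jet F 1 (g 1), jet F 2 (g 1), 0]
  obtain ⟨ε, hε, e', he'⟩ := exists_perturbed_span (k := k)
    (wIdeal (vars k 1) (wts 1 s t) N) a b e
    (he.trans (sup_le_sup_left (Submodule.restrictScalars_mono k (le_sup_of_le_left
      (span_range_vec_four _ _ _ _).ge)) _))
    (Set.finite_singleton (-value k 1 (diag _ (g 0))))
  let g' : Fin 2 → MvPowerSeries (Fin 2 ⊕ Fin 2) (MvPowerSeries (Fin 1) k) :=
    ![g 0 + algebraMap k _ ε, g 1]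
  have hdiag : diag _ (g' 0) = diag _ (g 0) + algebraMap k _ ε := by
    change diag _ (g 0 + algebraMap k _ ε) = _
    rw [map_add]
    congr 1
    rw [IsScalarTower.algebraMap_apply k (MvPowerSeries (Fin 1) k), AlgHom.commutes,
      ← IsScalarTower.algebraMap_apply]
  have hham : hamilton F (g' 0) = hamilton F (g 0) := by
    change hamilton F (g 0 + algebraMap k _ ε) = _
    rw [map_add, IsScalarTower.algebraMap_apply k (MvPowerSeries (Fin 1) k),
      Derivation.map_algebraMap, add_zero]
  have hu : IsUnit (diag _ (g' 0)) := by
    rw [hdiag, isUnit_iff_value, map_add, value_algebraMap]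
    exact fun h => hε (eq_neg_of_add_eq_zero_right h)
  have hj0 : jet F 0 (g' 0) = jet F 0 (g 0) + algebraMap k _ ε := hdiag
  have hj1 : jet F 1 (g' 0) = jet F 1 (g 0) := congrArg (diag _) hham
  have hj2 : jet F 2 (g' 0) = jet F 2 (g 0) := congrArg (fun z => diag _ (hamilton F z)) hham
  have hg1 : g' 1 = g 1 := rfl
  have hpert : (fun i => a i + ε • b i) =
      ![F, minor F g' 0 1, minor F g' 0 2, minor F g' 1 2] := by
    funext i
    fin_cases i
    · simp [a, b]
    · simp only [a, b, minor, hj0, hj1, hg1, Algebra.smul_def, Matrix.cons_val, Fin.mk_one]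
      ring
    · simp only [a, b, minor, hj0, hj2, hg1, Algebra.smul_def, Matrix.cons_val, Fin.reduceFinMk]
      ring
    · simp only [a, b, minor, hj1, hj2, hg1, Matrix.cons_val, Fin.reduceFinMk, smul_zero, add_zero]
  refine ⟨Sum.elim (fun _ => F) ![minor F g' 0 1, minor F g' 0 2], ?_, e', ?_⟩
  · intro i
    have hM1 : minor F g' 0 1 ∈ wIdeal (vars k 1) (wts 1 s t) ((s - 1) * (t - 1)) :=
      sub_mem (Ideal.mul_mem_left _ _ (jet_one_mem_wIdeal η _))
        (Ideal.mul_mem_left _ _ (jet_one_mem_wIdeal η _))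
    have hM2 : minor F g' 0 2 ∈
        wIdeal (vars k 1) (wts 1 s t) ((s - 1) * (t - 1) + (t - 2) * (s - 1)) :=
      sub_mem (Ideal.mul_mem_left _ _ (jet_two_mem_wIdeal η ht hst _))
        (Ideal.mul_mem_left _ _ (jet_two_mem_wIdeal η ht hst _))
    have hwt : (2 * t - 3) * (s - 1) = (s - 1) * (t - 1) + (t - 2) * (s - 1) := by
      rw [show 2 * t - 3 = (t - 1) + (t - 2) by omega]
      ring
    rcases i with i | i
    · simpa [wts] using family_mem_wIdeal η ht hst
    · fin_cases i
      · simpa [wts] using hM1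
      · simpa [wts, hwt] using hM2
  · refine he'.trans (sup_le_sup_left (Submodule.restrictScalars_mono k (sup_le_sup_right ?_ _)) _)
    rw [hpert, span_range_vec_four, span_minors_eq_of_isUnit F hu]
    refine Ideal.span_mono ?_
    rintro _ (rfl | rfl | rfl)
    exacts [⟨Sum.inl 0, rfl⟩, ⟨Sum.inr 0, rfl⟩, ⟨Sum.inr 1, rfl⟩]

theorem le_edim_of_admissible [CharZero k] (ht : 2 ≤ t) (hst : t ≤ s)
    (η : Fin 1 → MvPowerSeries (Fin 2) k) (hadm : Admissible (family s t η))
    (τ : Fin 2 → PrincipalParts (family s t η) 3) :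
    (((2 * t - 3) * (s - 1) : ℕ) : ℕ∞) ≤ edim k (TotalRing (family s t η) ⧸
      degeneracyIdeal (TotalRing (family s t η)) τ) := by
  obtain ⟨n, hn⟩ := exists_pow_mem_of_admissible ht hst η hadm
  obtain ⟨g, rfl⟩ := exists_lift τ
  refine le_edim_of_forall_span (projQuot_surjective _ _) fun l e he => ?_
  rw [ker_projQuot, comap_degeneracyIdeal_of_isWeaklyRegular
    (isWeaklyRegular_family_one ht hst η hn)] at he
  exact le_of_top_le_span_sup_minors ht hst η g e he

end OneParameter


/-! ### Standard monomials for the ideals at hand -/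

section StandardMonomials

variable {k : Type*} [Field k]

theorem smul_mem_ideal_iff {R : Type*} [CommRing R] [Algebra k R] (I : Ideal R) {c : k}
    (hc : c ≠ 0) {z : R} : c • z ∈ I ↔ z ∈ I :=
  (I.restrictScalars k).smul_mem_iff hc

theorem mem_of_sub_mem_right {R : Type*} [CommRing R] {I : Ideal R} {a b : R} (ha : a ∈ I)
    (h : a - b ∈ I) : b ∈ I := by
  have := sub_mem ha h
  rwa [sub_sub_cancel] at this

variable {r s t : ℕ}

theorem pow_mul_pow_mem_span_stdMon_of_pow_mem {R : Type*} [CommRing R] [Algebra k R]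
    {X : Fin r ⊕ Fin 2 → R} {I : Ideal R} {a b : ℕ}
    (hx : X (Sum.inr 0) ^ a ∈ I ⊔ wIdeal X (wts r s t) (a * (t - 1) + 1))
    (hy : X (Sum.inr 1) ^ b ∈ I ⊔ wIdeal X (wts r s t) (b * (s - 1) + 1))
    (i j n : ℕ) (hn : n = i * (t - 1) + j * (s - 1)) :
    X (Sum.inr 0) ^ i * X (Sum.inr 1) ^ j ∈ Submodule.span k (stdMon X a b) ⊔
      (I ⊔ wIdeal X (wts r s t) (n + 1)).restrictScalars k := by
  have key : ∀ {z y : R} {N M : ℕ}, z ∈ I ⊔ wIdeal X (wts r s t) (N + 1) →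
      y ∈ wIdeal X (wts r s t) M → N + M = n → z * y ∈ I ⊔ wIdeal X (wts r s t) (n + 1) := by
    intro z y N M hz hy hNM
    obtain ⟨u, hu, v, hv, rfl⟩ := Submodule.mem_sup.1 hz
    rw [add_mul]
    refine add_mem (Ideal.mem_sup_left (Ideal.mul_mem_right _ _ hu)) (Ideal.mem_sup_right ?_)
    exact wIdeal_anti (by omega) (mul_mem_wIdeal hv hy)
  by_cases hi : i < a
  · by_cases hj : j < b
    · exact Submodule.mem_sup_left (Submodule.subset_span ⟨(i, j), ⟨hi, hj⟩, rfl⟩)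
    · refine Submodule.mem_sup_right ?_
      obtain ⟨c, rfl⟩ := Nat.exists_eq_add_of_le (not_lt.1 hj)
      change _ ∈ I ⊔ wIdeal X (wts r s t) (n + 1)
      rw [pow_add, mul_left_comm]
      refine key hy (pow_mul_pow_mem_wIdeal i c) ?_
      rw [hn]; ring
  · refine Submodule.mem_sup_right ?_
    obtain ⟨c, rfl⟩ := Nat.exists_eq_add_of_le (not_lt.1 hi)
    change _ ∈ I ⊔ wIdeal X (wts r s t) (n + 1)
    rw [pow_add, mul_assoc]
    refine key hx (pow_mul_pow_mem_wIdeal c j) ?_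
    rw [hn]; ring

variable {η : Fin r → MvPowerSeries (Fin 2) k} {I : Ideal (BigRing k r)}

/-- The leading form of K supplies the rule rewriting y^(t-2) as a multiple of x^(s-2); for s = t
that multiple is ρ(0)². -/
theorem mon_mem_span_of_cofactor_mem [CharZero k] (ht : 2 ≤ t) (hst : t ≤ s)
    {ρ σ : BigRing k r} (hK : cofactor (family s t η) ρ σ ∈ I)
    (h1 : ∀ j, ∃ c : k, vars k r (Sum.inl j) - c • vars k r (Sum.inr 0) ^ (s - 1) ∈
      I ⊔ wIdeal (vars k r) (wts r s t) ((s - 1) * (t - 1) + 1)) {c : k}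
    (h2 : vars k r (Sum.inr 0) ^ (s - 1) - c • vars k r (Sum.inr 1) ^ (t - 1) ∈
      I ⊔ wIdeal (vars k r) (wts r s t) ((s - 1) * (t - 1) + 1))
    (h4 : s = t → c ^ (t - 2) * (value k r ρ ^ 2) ^ (t - 1) ≠ 1) (β : Fin r ⊕ Fin 2 → ℕ) :
    mon (vars k r) β ∈ Submodule.span k (stdMon (vars k r) (s - 1) (t - 2)) ⊔
      (I ⊔ wIdeal (vars k r) (wts r s t) (wt (wts r s t) β + 1)).restrictScalars k := by
  have hne : ((t : k) * (t - 1 : ℕ)) ≠ 0 := by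
    exact_mod_cast Nat.mul_ne_zero (by omega) (by omega)
  refine mon_mem_of_forall_pow_mul_pow_mem h1 (pow_mul_pow_mem_span_stdMon ht hst h2
    (c' := value k r ρ ^ 2 * (s * (s - 1 : ℕ)) / (t * (t - 1 : ℕ))) ?_ ?_) β
  · have h := mem_of_sub_mem_right (Ideal.mem_sup_left hK)
      (Ideal.mem_sup_right (S := I) (cofactor_sub_lead_mem η ht hst ρ σ))
    rw [← smul_mem_ideal_iff _ hne]
    convert h using 1
    rw [smul_sub, smul_smul, mul_div_cancel₀ _ hne]
  · rintro rfl
    rw [mul_div_assoc, div_self hne, mul_one]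
    exact h4 rfl

theorem lead_mem_sup {N : ℕ} (hτ : ∀ j, vars k r (Sum.inl j) ∈
      I ⊔ wIdeal (vars k r) (wts r s t) N) (c : Fin r → k) :
    lead c ∈ I ⊔ wIdeal (vars k r) (wts r s t) N :=
  Ideal.sum_mem _ fun j _ => Submodule.smul_of_tower_mem _ _ (hτ j)

/-- The ideal generated by the parameters modulo higher weight, the slope and the cofactor. -/
theorem mon_mem_span_of_slope_mem [CharZero k] (ht : 2 ≤ t) (hst : t ≤ s)
    {ρ σ : BigRing k r} (hG : slope (family s t η) ρ ∈ I)
    (hK : cofactor (family s t η) ρ σ ∈ I)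
    (hτ : ∀ j, vars k r (Sum.inl j) ∈
      I ⊔ wIdeal (vars k r) (wts r s t) ((s - 1) * (t - 1) + 1))
    (hρ : value k r ρ ≠ 0) (h4 : s = t → (-value k r ρ) ^ t ≠ 1) (β : Fin r ⊕ Fin 2 → ℕ) :
    mon (vars k r) β ∈ Submodule.span k (stdMon (vars k r) (s - 1) (t - 2)) ⊔
      (I ⊔ wIdeal (vars k r) (wts r s t) (wt (wts r s t) β + 1)).restrictScalars k := by
  have hs0 : (s : k) ≠ 0 := by exact_mod_cast (by omega : s ≠ 0)
  have hne : value k r ρ * s ≠ 0 := mul_ne_zero hρ hs0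
  refine mon_mem_span_of_cofactor_mem ht hst hK (c := -(t / (value k r ρ * s)))
    (fun j => ⟨0, by simpa using hτ j⟩) ?_ ?_ β
  · have h := mem_of_sub_mem_right (Ideal.mem_sup_left hG)
      (Ideal.mem_sup_right (S := I) (slope_sub_lead_mem η ht hst ρ))
    rw [add_assoc] at h
    have h' := (Submodule.add_mem_iff_right _ (lead_mem_sup hτ _)).1 h
    rw [← smul_mem_ideal_iff _ hne]
    convert h' using 1
    rw [smul_sub, smul_smul, mul_neg, mul_div_cancel₀ _ hne, neg_smul, sub_neg_eq_add, add_comm]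
  -- For s = t one has c = -1/ρ(0) and c' = ρ(0)², so c^(t-2) c'^(t-1) collapses to (-ρ(0))^t.
  · rintro rfl
    have h5 := h4 rfl
    convert h5 using 1
    obtain ⟨n, rfl⟩ := Nat.exists_eq_add_of_le ht
    have h6 : -(((2 + n : ℕ) : k) / (value k r ρ * (2 + n : ℕ))) = (-value k r ρ)⁻¹ := by
      rw [inv_neg]
      field_simp
    rw [h6, show 2 + n - 2 = n by omega, show 2 + n - 1 = n + 1 by omega, ← neg_sq, ← pow_mul,
      inv_pow, inv_mul_eq_iff_eq_mul₀ (pow_ne_zero _ (neg_ne_zero.2 hρ)), ← pow_add]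
    congr 1
    ring

theorem top_le_span_sup_of_forall_mon_mem (ht : 2 ≤ t) (hst : t ≤ s) {a b : ℕ}
    (h : ∀ β, mon (vars k r) β ∈ Submodule.span k (stdMon (vars k r) a b) ⊔
      (I ⊔ wIdeal (vars k r) (wts r s t) (wt (wts r s t) β + 1)).restrictScalars k) :
    ⊤ ≤ Submodule.span k (stdMon (vars k r) a b) ⊔ I.restrictScalars k := by
  refine top_le_span_sup_of_forall_mon (k := k) (X := vars k r) (w := wts r s t) (wts_pos ht hst)
    ?_ ?_ (stdMon_finite a b) h
  · exact vars_mem_maximalIdeal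
  · exact exists_sub_algebraMap_mem

theorem exists_pow_mem_of_forall_mon_mem (ht : 2 ≤ t) (hst : t ≤ s) {a b : ℕ}
    (h : ∀ β, mon (vars k r) β ∈ Submodule.span k (stdMon (vars k r) a b) ⊔
      (I ⊔ wIdeal (vars k r) (wts r s t) (wt (wts r s t) β + 1)).restrictScalars k)
    (i : Fin r ⊕ Fin 2) : ∃ n, vars k r i ^ n ∈ I := by
  obtain ⟨N, hN⟩ : ∃ N, wIdeal (vars k r) (wts r s t) N ≤ I := by
    refine exists_wIdeal_le_of_forall_mon (k := k) (X := vars k r) (w := wts r s t)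
      (wts_pos ht hst) ?_ ?_ (stdMon_finite a b) h
    · exact vars_mem_maximalIdeal
    · exact exists_sub_algebraMap_mem
  refine ⟨N, hN (wIdeal_anti ?_ (pow_mem_wIdeal (X_mem_wIdeal i) N))⟩
  exact Nat.le_mul_of_pos_right N (wts_pos ht hst i)

/-- The singular ideal modulo the parameters. -/
theorem mon_mem_span_of_dx_dy_mem [CharZero k] (ht : 2 ≤ t) (hst : t ≤ s)
    (hx : dx (family s t η) ∈ I) (hy : dy (family s t η) ∈ I)
    (hτ : ∀ j, vars k r (Sum.inl j) ∈
      I ⊔ wIdeal (vars k r) (wts r s t) ((s - 1) * (t - 1) + 1)) (β : Fin r ⊕ Fin 2 → ℕ) :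
    mon (vars k r) β ∈ Submodule.span k (stdMon (vars k r) (s - 1) (t - 1)) ⊔
      (I ⊔ wIdeal (vars k r) (wts r s t) (wt (wts r s t) β + 1)).restrictScalars k := by
  have hs0 : (s : k) ≠ 0 := by exact_mod_cast (by omega : s ≠ 0)
  have ht0 : (t : k) ≠ 0 := by exact_mod_cast (by omega : t ≠ 0)
  refine mon_mem_of_forall_pow_mul_pow_mem (fun j => ⟨0, by simpa using hτ j⟩)
    (pow_mul_pow_mem_span_stdMon_of_pow_mem ?_ ?_) β
  · have h := mem_of_sub_mem_right (Ideal.mem_sup_left hx)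
      (Ideal.mem_sup_right (S := I) (dx_family_sub_lead_mem η ht hst))
    have h' := mem_of_sub_mem_right (lead_mem_sup hτ _) h
    rwa [smul_mem_ideal_iff _ hs0] at h'
  · have h := mem_of_sub_mem_right (Ideal.mem_sup_left hy)
      (Ideal.mem_sup_right (S := I) (dy_family_sub_lead_mem η ht hst))
    have h' := (Submodule.add_mem_iff_right _ (lead_mem_sup hτ _)).1 h
    rw [smul_mem_ideal_iff _ ht0] at h'
    rwa [mul_comm (t - 1)]

end StandardMonomials

/-! ### One-parameter families attaining the bound. -/

section UpperBound

variable {k : Type*} [Field k] {s t : ℕ} {η : Fin 1 → MvPowerSeries (Fin 2) k}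

/-- The leading form of F is η_0(0) t_0, so F expresses the parameter through heavier terms. -/
theorem parameter_mem_sup (ht : 2 ≤ t) (hst : t ≤ s) (hη : constantCoeff (η 0) ≠ 0)
    {I : Ideal (BigRing k 1)} (hF : family s t η ∈ I) (j : Fin 1) :
    vars k 1 (Sum.inl j) ∈ I ⊔ wIdeal (vars k 1) (wts 1 s t) ((s - 1) * (t - 1) + 1) := by
  have h := mem_of_sub_mem_right (Ideal.mem_sup_left hF)
    (Ideal.mem_sup_right (S := I) (family_sub_lead_mem η ht hst))
  rw [lead, Fin.sum_univ_one, smul_mem_ideal_iff _ hη] at h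
  rwa [Subsingleton.elim j 0]

theorem mon_mem_span_singular [CharZero k] (ht : 2 ≤ t) (hst : t ≤ s)
    (hη : constantCoeff (η 0) ≠ 0)
    (β : Fin 1 ⊕ Fin 2 → ℕ) :
    mon (vars k 1) β ∈ Submodule.span k (stdMon (vars k 1) (s - 1) (t - 1)) ⊔
      (Ideal.span {family s t η, dx (family s t η), dy (family s t η)} ⊔
        wIdeal (vars k 1) (wts 1 s t) (wt (wts 1 s t) β + 1)).restrictScalars k :=
  mon_mem_span_of_dx_dy_mem ht hst (η := η) (Ideal.subset_span (by simp))
    (Ideal.subset_span (by simp))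
    (parameter_mem_sup ht hst hη (Ideal.subset_span (by simp))) β

theorem isWeaklyRegular_of_constantCoeff_ne_zero [CharZero k] (ht : 2 ≤ t) (hst : t ≤ s)
    (hη : constantCoeff (η 0) ≠ 0)
    :
    IsWeaklyRegular (BigRing k 1) [family s t η, dx (family s t η), dy (family s t η)] := by
  obtain ⟨n, hn⟩ := exists_pow_mem_of_forall_mon_mem ht hst (mon_mem_span_singular ht hst hη)
    (Sum.inl 0)
  exact isWeaklyRegular_family_one ht hst η hn

theorem admissible_of_constantCoeff_ne_zero [CharZero k] (ht : 2 ≤ t) (hst : t ≤ s)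
    (hη : constantCoeff (η 0) ≠ 0)
    : Admissible (family s t η) :=
  two_le_height_of_isWeaklyRegular (isWeaklyRegular_of_constantCoeff_ne_zero ht hst hη)
    (Ideal.subset_span ⟨0, rfl⟩) (Ideal.subset_span ⟨1, rfl⟩)

/-- Modulo (F, G), multiplication by F_x maps the quotient by K onto the kernel of passing from (F,
G, F_x K) to (F, G, F_x). Standard monomials for the two outer quotients give (s-1)(t-2) +
(s-1)(t-1) spanning elements. -/
theorem exists_edim_le [CharZero k] (ht : 2 ≤ t) (hst : t ≤ s)
    (hη : constantCoeff (η 0) ≠ 0)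
    : ∃ τ : Fin 2 → PrincipalParts (family s t η) 3,
    edim k (TotalRing (family s t η) ⧸ degeneracyIdeal (TotalRing (family s t η)) τ) ≤
      (((2 * t - 3) * (s - 1) : ℕ) : ℕ∞) := by
  set F := family s t η with hF
  let g : Fin 2 → MvPowerSeries (Fin 2 ⊕ Fin 2) (MvPowerSeries (Fin 1) k) :=
    -- This pair gives ρ = 2; in characteristic zero -2 is not a root of unity, so the exceptional
    -- case s = t is avoided too.
    ![1, diagEq _ 0 + (2 : ℕ) • diagEq _ 1]
  have hg0 : g 0 = 1 := rfl
  have hg1 : g 1 = diagEq _ 0 + (2 : ℕ) • diagEq _ 1 := rfl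
  have hp0 : diag (MvPowerSeries (Fin 1) k) (g 0) = 1 := by rw [hg0, map_one]
  have hp1 : diag (MvPowerSeries (Fin 1) k) (g 1) = 0 := by
    rw [hg1]; simp
  have hq1 : pderiv (MvPowerSeries (Fin 1) k) (Sum.inr 0) (g 1) = 1 := by
    rw [hg1, map_add, map_nsmul, pderiv_diagEq_self, pderiv_diagEq_of_ne (by decide)]
    simp
  have hr1 : pderiv (MvPowerSeries (Fin 1) k) (Sum.inr 1) (g 1) = 2 := by
    rw [hg1, map_add, map_nsmul, pderiv_diagEq_self, pderiv_diagEq_of_ne (by decide)]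
    simp
  obtain ⟨ρ, σ, hρ, hspan⟩ := exists_span_minors_eq F (g := g) (by rw [hp0]; exact isUnit_one)
    (by rw [hp0, hp1, hq1]; simp)
  rw [hp0, hp1, hq1, hr1] at hρ
  have hρ2 : ρ = 2 := by simpa [map_ofNat] using hρ
  have hval : value k 1 ρ = 2 := by rw [hρ2, map_ofNat]
  refine ⟨fun i => Ideal.Quotient.mk _ (g i), ?_⟩
  set G := slope F ρ with hG
  set K := cofactor F ρ σ with hK
  have h1 := top_le_span_sup_of_forall_mon_mem ht hst (mon_mem_span_singular ht hst hη)
  have h2 := top_le_span_sup_of_forall_mon_mem ht hst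
    (mon_mem_span_of_slope_mem (I := Ideal.span {F, G, K}) ht hst (η := η) (ρ := ρ) (σ := σ)
    (Ideal.subset_span (by simp [hG, hF])) (Ideal.subset_span (by simp [hK, hF]))
    (parameter_mem_sup ht hst hη (Ideal.subset_span (by simp [hF])))
    (by rw [hval]; exact two_ne_zero) (by
      intro _ h
      rw [hval, neg_pow] at h
      have h3 := congrArg (fun z => z ^ 2) h
      simp only [mul_pow, one_pow, ← pow_mul] at h3
      rw [mul_comm t 2, pow_mul, neg_one_sq, one_pow, one_mul] at h3
      have h4 : 2 ^ (2 * t) = 1 := by exact_mod_cast h3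
      exact absurd h4 (Nat.one_lt_pow (by omega) (by norm_num)).ne'))
  set B := stdMon (vars k 1) (s - 1) (t - 1) ∪
    (fun z => dx F * z) '' stdMon (vars k 1) (s - 1) (t - 2) with hB
  have hBfin : B.Finite := (stdMon_finite _ _).union ((stdMon_finite _ _).image _)
  have hBcard : B.ncard ≤ (2 * t - 3) * (s - 1) := by
    refine (Set.ncard_union_le _ _).trans ?_
    refine (Nat.add_le_add (ncard_stdMon_le _ _)
      ((Set.ncard_image_le (stdMon_finite _ _)).trans (ncard_stdMon_le _ _))).trans (le_of_eq ?_)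
    rw [show 2 * t - 3 = (t - 1) + (t - 2) by omega]
    ring
  refine (edim_le_of_top_le_span_sup_ker (projQuot_surjective _ _) hBfin ?_).trans
    (Nat.cast_le.2 hBcard)
  rw [ker_projQuot, comap_degeneracyIdeal_of_isWeaklyRegular
    (isWeaklyRegular_of_constantCoeff_ne_zero ht hst hη), hspan]
  set J := Ideal.span {F, G, dx F * K} with hJ
  set S := Submodule.span k B ⊔ J.restrictScalars k with hS
  have hJS : ∀ z ∈ J, z ∈ S := fun z hz => Submodule.mem_sup_right hz
  have hxS : ∀ z, dx F * z ∈ S := by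
    intro z
    obtain ⟨u, hu, v, hv, rfl⟩ := Submodule.mem_sup.1 (h2 (Submodule.mem_top (x := z)))
    rw [mul_add]
    refine add_mem (Submodule.mem_sup_left ?_) (hJS _ ?_)
    · have h3 : Submodule.span k (stdMon (vars k 1) (s - 1) (t - 2)) ≤
          (Submodule.span k B).comap (LinearMap.mulLeft k (dx F)) := by
        rw [Submodule.span_le]
        intro z hz
        exact Submodule.subset_span (Or.inr ⟨z, hz, rfl⟩)
      exact h3 hu
    · have h3 : Ideal.span {F, G, K} ≤ Submodule.comap (LinearMap.mulLeft (BigRing k 1) (dx F)) J := by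
        rw [Ideal.span_le]
        have h4 : ∀ a ∈ ({F, G, dx F * K} : Set (BigRing k 1)), a ∈ J :=
          fun a ha => Ideal.subset_span ha
        rintro _ (rfl | rfl | rfl)
        · exact Ideal.mul_mem_left _ _ (h4 _ (by simp))
        · exact Ideal.mul_mem_left _ _ (h4 _ (by simp))
        · exact h4 _ (by simp)
      exact h3 hv
  intro z _
  obtain ⟨u, hu, v, hv, rfl⟩ := Submodule.mem_sup.1 (h1 (Submodule.mem_top (x := z)))
  refine add_mem (Submodule.mem_sup_left (Submodule.span_mono Set.subset_union_left hu)) ?_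
  obtain ⟨a, w, hw, rfl⟩ := Ideal.mem_span_insert.1 hv
  obtain ⟨b, c, rfl⟩ := Ideal.mem_span_pair.1 hw
  -- Since F_y = G + ρ F_x, an element of (F, F_x, F_y) is an element of (F, G) plus a multiple of
  -- F_x, and such multiples were just treated.
  have h5 : a * F + (b * dx F + c * dy F) = (a * F + c * G) + dx F * (b + c * ρ) := by
    rw [hG, slope]
    ring
  change a * F + (b * dx F + c * dy F) ∈ S
  rw [h5]
  exact add_mem (hJS _ (add_mem (Ideal.mul_mem_left _ _ (Ideal.subset_span (by simp)))
    (Ideal.mul_mem_left _ _ (Ideal.subset_span (by simp))))) (hxS _)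

end UpperBound


/-! ### The automatic degeneracy -/

section AutomaticDegeneracy

variable {k : Type*} [Field k] {f : MvPowerSeries (Fin 2) k} {s t d : ℕ}
  {δ : Fin d → MvPowerSeries (Fin 2) k}

theorem exists_sum_smul_sub_mem (hδ : IsDefBasis f δ) (z : MvPowerSeries (Fin 2) k) :
    ∃ c : Fin d → k, ∑ i, c i • δ i - z ∈ Ideal.span {f, pderiv k 0 f, pderiv k 1 f} := by
  have h : Ideal.Quotient.mk (Ideal.span {f, pderiv k 0 f, pderiv k 1 f}) z ∈
      Submodule.span k (Set.range
        fun i => Ideal.Quotient.mk (Ideal.span {f, pderiv k 0 f, pderiv k 1 f}) (δ i)) := by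
    rw [hδ.2]; trivial
  obtain ⟨c, hc⟩ := (Submodule.mem_span_range_iff_exists_fun k).1 h
  refine ⟨c, ?_⟩
  rw [← Ideal.Quotient.eq, ← hc]
  exact map_sum (Ideal.Quotient.mkₐ k (Ideal.span {f, pderiv k 0 f, pderiv k 1 f})) _ _ |>.trans
    (Finset.sum_congr rfl fun i _ =>
      map_smul (Ideal.Quotient.mkₐ k (Ideal.span {f, pderiv k 0 f, pderiv k 1 f})) _ _)

theorem pderiv_zero_quasiHomogeneous (hf : f = X 1 ^ t - X 0 ^ s) :
    pderiv k 0 f = -((s : MvPowerSeries (Fin 2) k) * X 0 ^ (s - 1)) := by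
  rw [hf, map_sub, pderiv_pow, pderiv_pow]
  simp

theorem pderiv_one_quasiHomogeneous (hf : f = X 1 ^ t - X 0 ^ s) :
    pderiv k 1 f = (t : MvPowerSeries (Fin 2) k) * X 1 ^ (t - 1) := by
  rw [hf, map_sub, pderiv_pow, pderiv_pow]
  simp

theorem constantCoeff_eq_zero_of_mem (ht : 2 ≤ t) (hst : t ≤ s) (hf : f = X 1 ^ t - X 0 ^ s)
    {z : MvPowerSeries (Fin 2) k} (hz : z ∈ Ideal.span {f, pderiv k 0 f, pderiv k 1 f}) :
    constantCoeff z = 0 := by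
  have h : Ideal.span {f, pderiv k 0 f, pderiv k 1 f} ≤ RingHom.ker (constantCoeff (R := k)) := by
    rw [Ideal.span_le, pderiv_zero_quasiHomogeneous hf, pderiv_one_quasiHomogeneous hf, hf]
    rintro _ (rfl | rfl | rfl)
    · rw [SetLike.mem_coe, RingHom.mem_ker]
      simp [show t ≠ 0 by omega, show s ≠ 0 by omega]
    · rw [SetLike.mem_coe, RingHom.mem_ker]
      simp [show s - 1 ≠ 0 by omega]
    · rw [SetLike.mem_coe, RingHom.mem_ker]
      simp [show t - 1 ≠ 0 by omega]
  exact h hz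

theorem autDegTypeA_three [CharZero k] (ht : 2 ≤ t) (hst : t ≤ s) (hf : f = X 1 ^ t - X 0 ^ s)
    (hδ : IsDefBasis f δ) : autDegTypeA f δ 3 = (((2 * t - 3) * (s - 1) : ℕ) : ℕ∞) := by
  apply le_antisymm
  -- The minimum is attained by a deformation direction congruent to 1 modulo the Tjurina ideal,
  -- whose elements vanish at the origin.
  · obtain ⟨c, hc⟩ := exists_sum_smul_sub_mem hδ 1
    have h1 := constantCoeff_eq_zero_of_mem ht hst hf hc
    rw [map_sub, map_one, sub_eq_zero] at h1
    have h2 : ∃ (_ : Admissible (deformation f δ fun _ : Fin 1 => c))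
        (τ : Fin 2 → PrincipalParts (deformation f δ fun _ : Fin 1 => c) 3),
        edim k (TotalRing (deformation f δ fun _ : Fin 1 => c) ⧸
          degeneracyIdeal (TotalRing (deformation f δ fun _ : Fin 1 => c)) τ) ≤
            (((2 * t - 3) * (s - 1) : ℕ) : ℕ∞) := by
      rw [deformation_eq_family hf]
      have h3 : constantCoeff ((fun _ : Fin 1 => ∑ i, c i • δ i) 0) ≠ 0 := by
        simp only [h1]; exact one_ne_zero
      exact ⟨admissible_of_constantCoeff_ne_zero ht hst h3, exists_edim_le ht hst h3⟩
    obtain ⟨hadm, τ, hτ⟩ := h2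
    exact iInf_le_of_le _ (iInf_le_of_le hadm (iInf_le_of_le τ hτ))
  · refine le_iInf fun a => le_iInf fun hadm => le_iInf fun τ => ?_
    have h : ∀ F, F = family s t (fun j => ∑ i, a j i • δ i) → Admissible F →
        ∀ τ : Fin 2 → PrincipalParts F 3, (((2 * t - 3) * (s - 1) : ℕ) : ℕ∞) ≤
          edim k (TotalRing F ⧸ degeneracyIdeal (TotalRing F) τ) := by
      rintro _ rfl hadm τ
      exact le_edim_of_admissible ht hst _ hadm τ
    exact h _ (deformation_eq_family hf δ a) hadm τ

end AutomaticDegeneracy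


/-! ### The degeneracy locus in two-parameter families -/

section Closure

variable {A : Type*} [CommRing A]

/-- From `H * J ≤ I` the saturation contains `H`; since `I ≤ H` and `x ∈ J` is regular modulo `H`,
saturating yields nothing more. -/
theorem closureIdeal_eq_of_mul_le {I J H : Ideal A} {x : A} (hx : x ∈ J) (hI : I ≤ H)
    (hreg : ∀ z, x * z ∈ H → z ∈ H) (hH : H * J ≤ I) : closureIdeal I J = H := by
  apply le_antisymm
  · refine iSup_le fun n z hz => ?_
    have h1 : z * x ^ n ∈ H := hI (Submodule.mem_colon.1 hz _ (Ideal.pow_mem_pow hx n))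
    clear hz
    induction n with
    | zero => simpa using h1
    | succ n ih =>
      refine ih (hreg _ ?_)
      convert h1 using 1
      ring
  · refine le_iSup_of_le 1 fun z hz => Submodule.mem_colon.2 fun y hy => ?_
    rw [pow_one] at hy
    exact hH (Ideal.mul_mem_mul hz hy)

end Closure

/-! ### Regular sequences in two-parameter families. -/

section TwoParameter

variable {k : Type*} [Field k] {s t : ℕ} {η : Fin 2 → MvPowerSeries (Fin 2) k}

theorem parameters_mem_sup (ht : 2 ≤ t) (hst : t ≤ s) (hη : constantCoeff (η 1) ≠ 0)
    {I : Ideal (BigRing k 2)} (hF : family s t η ∈ I)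
    (h0 : vars k 2 (Sum.inl 0) ∈ I) (j : Fin 2) :
    vars k 2 (Sum.inl j) ∈ I ⊔ wIdeal (vars k 2) (wts 2 s t) ((s - 1) * (t - 1) + 1) := by
  have h := mem_of_sub_mem_right (Ideal.mem_sup_left hF)
    (Ideal.mem_sup_right (S := I) (family_sub_lead_mem η ht hst))
  rw [lead, Fin.sum_univ_two] at h
  have hmem := (Submodule.add_mem_iff_right _ (Submodule.smul_of_tower_mem _ _
    (Ideal.mem_sup_left h0))).1 h
  rw [smul_mem_ideal_iff _ hη] at hmem
  fin_cases j
  · exact Ideal.mem_sup_left h0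
  · exact hmem

/-- The ideal of the closure of the degeneracy locus meets the singular locus at the origin. -/
theorem mon_mem_span_of_dx_dy_cofactor_mem [CharZero k] (ht : 2 ≤ t) (hst : t ≤ s)
    (hη : constantCoeff (η 1) ≠ 0)
    {I : Ideal (BigRing k 2)} {ρ σ : BigRing k 2}
    (hF : family s t η ∈ I) (hx : dx (family s t η) ∈ I) (hy : dy (family s t η) ∈ I)
    (hK : cofactor (family s t η) ρ σ ∈ I) {a b : k}
    (ha : a = constantCoeff (pderiv k 0 (η 0)) * constantCoeff (η 1) -
      constantCoeff (pderiv k 0 (η 1)) * constantCoeff (η 0)) (ha0 : a ≠ 0)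
    (hb : b = constantCoeff (pderiv k 1 (η 0)) * constantCoeff (η 1) -
      constantCoeff (pderiv k 1 (η 1)) * constantCoeff (η 0)) (hb0 : b ≠ 0)
    (h4 : s = t → (-(a / b)) ^ (t - 2) * (value k 2 ρ ^ 2) ^ (t - 1) ≠ 1)
    (β : Fin 2 ⊕ Fin 2 → ℕ) :
    mon (vars k 2) β ∈ Submodule.span k (stdMon (vars k 2) (s - 1) (t - 2)) ⊔
      (I ⊔ wIdeal (vars k 2) (wts 2 s t) (wt (wts 2 s t) β + 1)).restrictScalars k := by
  have hs0 : (s : k) ≠ 0 := by exact_mod_cast (by omega : s ≠ 0)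
  have ht0 : (t : k) ≠ 0 := by exact_mod_cast (by omega : t ≠ 0)
  set J := I ⊔ wIdeal (vars k 2) (wts 2 s t) ((s - 1) * (t - 1) + 1) with hJ
  have h1 : _ ∈ J := mem_of_sub_mem_right (Ideal.mem_sup_left hF)
    (Ideal.mem_sup_right (S := I) (family_sub_lead_mem η ht hst))
  have h2 : _ ∈ J := mem_of_sub_mem_right (Ideal.mem_sup_left hx)
    (Ideal.mem_sup_right (S := I) (dx_family_sub_lead_mem η ht hst))
  have h3 : _ ∈ J := mem_of_sub_mem_right (Ideal.mem_sup_left hy)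
    (Ideal.mem_sup_right (S := I) (dy_family_sub_lead_mem η ht hst))
  simp only [lead, Fin.sum_univ_two] at h1 h2 h3
  set e₀ := constantCoeff (η 0)
  set e₁ := constantCoeff (η 1)
  set a₀ := constantCoeff (pderiv k 0 (η 0))
  set a₁ := constantCoeff (pderiv k 0 (η 1))
  set b₀ := constantCoeff (pderiv k 1 (η 0))
  set b₁ := constantCoeff (pderiv k 1 (η 1))
  set t₀ := vars k 2 (Sum.inl 0)
  set t₁ := vars k 2 (Sum.inl 1)
  set x := vars k 2 (Sum.inr 0) ^ (s - 1)
  set y := vars k 2 (Sum.inr 1) ^ (t - 1)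
  have hsm : ∀ (c : k) {z}, z ∈ J → c • z ∈ J := fun c _ hz => Submodule.smul_of_tower_mem _ c hz
  -- The leading forms of F, F_x, F_y are three linear forms in t_0, t_1, x^(s-1), y^(t-1). Cramer's
  -- rule expresses t_0 and t_1 through x^(s-1), using a ≠ 0, and x^(s-1) through y^(t-1), using b ≠
  -- 0.
  have h5 : a • t₀ - (e₁ * s) • x ∈ J := by
    convert sub_mem (hsm e₁ h2) (hsm a₁ h1) using 1
    rw [ha]; module
  have h6 : a • t₁ + (e₀ * s) • x ∈ J := by
    convert sub_mem (hsm a₀ h1) (hsm e₀ h2) using 1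
    rw [ha]; module
  have h7 : b • t₀ + (e₁ * t) • y ∈ J := by
    convert sub_mem (hsm e₁ h3) (hsm b₁ h1) using 1
    rw [hb]; module
  have h8 : (b * (e₁ * s)) • x + (a * (e₁ * t)) • y ∈ J := by
    convert sub_mem (hsm a h7) (hsm b h5) using 1
    module
  have hne : b * (e₁ * s) ≠ 0 := mul_ne_zero hb0 (mul_ne_zero hη hs0)
  refine mon_mem_span_of_cofactor_mem ht hst hK (c := -(a * (e₁ * t) / (b * (e₁ * s)))) ?_ ?_ ?_ β
  · intro j
    fin_cases j
    · refine ⟨e₁ * s / a, ?_⟩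
      change t₀ - _ ∈ J
      rw [← smul_mem_ideal_iff _ ha0, smul_sub, smul_smul, mul_div_cancel₀ _ ha0]
      exact h5
    · refine ⟨-(e₀ * s / a), ?_⟩
      change t₁ - _ ∈ J
      rw [← smul_mem_ideal_iff _ ha0, smul_sub, smul_smul, mul_neg, mul_div_cancel₀ _ ha0, neg_smul,
        sub_neg_eq_add]
      exact h6
  · change x - _ • y ∈ J
    rw [← smul_mem_ideal_iff _ hne, smul_sub, smul_smul, mul_neg, mul_div_cancel₀ _ hne, neg_smul,
        sub_neg_eq_add]
    exact h8
  · rintro rfl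
    rw [mul_div_mul_right _ _ (mul_ne_zero hη hs0)]
    exact h4 rfl

theorem value_slope (ht : 2 ≤ t) (hst : t ≤ s)
    (ρ : BigRing k 2) : value k 2 (slope (family s t η) ρ) = 0 := by
  have h1 := value_dx_family η ht hst
  have h2 := value_dy_family (s := s) η ht
  rw [slope, map_sub, map_mul]
  change value k 2 (dy _) - _ * value k 2 (dx _) = 0
  rw [h1, h2, mul_zero, sub_zero]

theorem value_cofactor (ht : 2 ≤ t) (hst : t ≤ s)
    (ρ σ : BigRing k 2) : value k 2 (cofactor (family s t η) ρ σ) =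
    t * (t - 1 : ℕ) * 0 ^ (t - 2) - value k 2 ρ ^ 2 * (s * (s - 1 : ℕ) * 0 ^ (s - 2)) := by
  have h1 := value_dx_family η ht hst
  have h2 : cofactor (family s t η) ρ σ = dy (dy (family s t η)) - ρ * dx (dy (family s t η)) -
    ρ * dy (dx (family s t η)) + ρ ^ 2 * dx (dx (family s t η)) + dx (family s t η) * σ := rfl
  rw [h2]
  simp only [map_add, map_sub, map_mul, map_pow, h1]
  rw [dy_dy_family, dx_dy_family, dy_dx_family, dx_dx_family]
  simp only [map_add, map_neg, map_mul, map_pow, map_natCast, value_perturb, value_vars]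
  ring

theorem isWeaklyRegular_vars_family (ht : 2 ≤ t) (hst : t ≤ s) (hη : constantCoeff (η 1) ≠ 0)
    : IsWeaklyRegular (BigRing k 2)
    [vars k 2 (Sum.inr 0), vars k 2 (Sum.inr 1), vars k 2 (Sum.inl 0), family s t η] := by
  have h0 := isWeaklyRegular_vars_two (k := k)
  refine isWeaklyRegular_exchange (rs := [vars k 2 (Sum.inr 0), vars k 2 (Sum.inr 1),
    vars k 2 (Sum.inl 0)]) (n := 1) h0 ?_
  set I := Ideal.ofList [vars k 2 (Sum.inr 0), vars k 2 (Sum.inr 1), vars k 2 (Sum.inl 0)] ⊔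
    Ideal.span {family s t η}
  have hm : ∀ z ∈ [vars k 2 (Sum.inr 0), vars k 2 (Sum.inr 1), vars k 2 (Sum.inl 0)], z ∈ I :=
    fun z hz => Ideal.mem_sup_left (Ideal.subset_span hz)
  have hu : IsUnit (map C (η 1) : BigRing k 2) := by
    rw [isUnit_iff_value, value_map_C]
    exact hη
  rw [pow_one, ← Ideal.unit_mul_mem_iff_mem I hu, show map C (η 1) * vars k 2 (Sum.inl 1) =
    family s t η - (vars k 2 (Sum.inr 1) ^ t - vars k 2 (Sum.inr 0) ^ s +
      vars k 2 (Sum.inl 0) * map C (η 0)) by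
    rw [family, perturb, Fin.sum_univ_two]
    ring]
  refine sub_mem (Ideal.mem_sup_right (Ideal.mem_span_singleton_self _)) (add_mem (sub_mem ?_ ?_) ?_)
  · exact Ideal.pow_mem_of_mem _ (hm _ (by simp)) _ (by omega)
  · exact Ideal.pow_mem_of_mem _ (hm _ (by simp)) _ (by omega)
  · exact Ideal.mul_mem_right _ _ (hm _ (by simp))

theorem exists_x_pow_mem [CharZero k] (ht : 2 ≤ t) (hst : t ≤ s)
    (hη : constantCoeff (η 1) ≠ 0)
    {I : Ideal (BigRing k 2)} {ρ : BigRing k 2}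
    (hF : family s t η ∈ I) (h0 : vars k 2 (Sum.inl 0) ∈ I) (hy : vars k 2 (Sum.inr 1) ∈ I)
    (hG : slope (family s t η) ρ ∈ I) (hρ : value k 2 ρ ≠ 0) :
    ∃ n, vars k 2 (Sum.inr 0) ^ n ∈ I := by
  have hτ := parameters_mem_sup ht hst hη hF h0
  have hx : vars k 2 (Sum.inr 0) ^ (s - 1) ∈
      I ⊔ wIdeal (vars k 2) (wts 2 s t) ((s - 1) * (t - 1) + 1) := by
    have h := mem_of_sub_mem_right (Ideal.mem_sup_left hG)
      (Ideal.mem_sup_right (S := I) (slope_sub_lead_mem η ht hst ρ))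
    have hy : (t : k) • vars k 2 (Sum.inr 1) ^ (t - 1) ∈
        I ⊔ wIdeal (vars k 2) (wts 2 s t) ((s - 1) * (t - 1) + 1) :=
      Submodule.smul_of_tower_mem _ _ (Ideal.mem_sup_left
        (Ideal.pow_mem_of_mem _ hy _ (by omega)))
    have h' := (Submodule.add_mem_iff_right _ (add_mem (lead_mem_sup hτ _) hy)).1 h
    rwa [smul_mem_ideal_iff _ (mul_ne_zero hρ (by exact_mod_cast (by omega : s ≠ 0)))] at h'
  have hy1 : vars k 2 (Sum.inr 1) ^ 1 ∈
      I ⊔ wIdeal (vars k 2) (wts 2 s t) (1 * (s - 1) + 1) := by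
    rw [pow_one]
    exact Ideal.mem_sup_left hy
  exact exists_pow_mem_of_forall_mon_mem ht hst (I := I) (a := s - 1) (b := 1) (fun β =>
    mon_mem_of_forall_pow_mul_pow_mem (fun j => ⟨0, by simpa using hτ j⟩)
    (pow_mul_pow_mem_span_stdMon_of_pow_mem hx hy1) β) _

/-- The partial derivative is regular modulo the ideal of the closure of the degeneracy locus. -/
theorem isWeaklyRegular_slope_cofactor [CharZero k] (ht : 2 ≤ t) (hst : t ≤ s)
    (hη : constantCoeff (η 1) ≠ 0)
    (ht3 : 3 ≤ t) {ρ σ : BigRing k 2} {a b : k}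
    (ha : a = constantCoeff (pderiv k 0 (η 0)) * constantCoeff (η 1) -
      constantCoeff (pderiv k 0 (η 1)) * constantCoeff (η 0)) (ha0 : a ≠ 0)
    (hb : b = constantCoeff (pderiv k 1 (η 0)) * constantCoeff (η 1) -
      constantCoeff (pderiv k 1 (η 1)) * constantCoeff (η 0)) (hb0 : b ≠ 0)
    (hρ : value k 2 ρ ≠ 0) (h3 : s = t → (-value k 2 ρ) ^ t ≠ 1)
    (h4 : s = t → (-(a / b)) ^ (t - 2) * (value k 2 ρ ^ 2) ^ (t - 1) ≠ 1) :
    IsWeaklyRegular (BigRing k 2) [family s t η, slope (family s t η) ρ,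
      cofactor (family s t η) ρ σ, dx (family s t η)] := by
  have hv1 := value_family η ht hst
  have hv2 := value_slope ht hst (η := η) ρ
  have hv3 : value k 2 (cofactor (family s t η) ρ σ) = 0 := by
    rw [value_cofactor ht hst, zero_pow (by omega), zero_pow (by omega)]
    ring
  set F := family s t η with hF
  set G := slope F ρ with hG
  set K := cofactor F ρ σ with hK
  have hmem : ∀ (l : List (BigRing k 2)) (c : BigRing k 2), ∀ z ∈ c :: l,
      z ∈ Ideal.ofList l ⊔ Ideal.span {c} := by
    intro l c z hz
    rcases List.mem_cons.1 hz with rfl | hz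
    · exact Ideal.mem_sup_right (Ideal.mem_span_singleton_self _)
    · exact Ideal.mem_sup_left (Ideal.subset_span hz)
  -- The elements are exchanged one at a time: x for G, then y for K, then t_0 for F_x. In each case
  -- the rewriting argument puts a power of the old element in the new ideal.
  have r1 := perm_regular (isWeaklyRegular_vars_family ht hst hη)
    (rs' := [vars k 2 (Sum.inl 0), F, vars k 2 (Sum.inr 1)] ++ [vars k 2 (Sum.inr 0)])
    (by
      refine List.Perm.trans (List.perm_append_comm (l₁ := [vars k 2 (Sum.inr 0),
        vars k 2 (Sum.inr 1)]) (l₂ := [vars k 2 (Sum.inl 0), F])) ?_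
      exact List.Perm.append_left [vars k 2 (Sum.inl 0), F] (List.Perm.swap _ _ []))
    (by simp [hv1, ← hF])
  obtain ⟨n₁, hn₁⟩ : ∃ n, vars k 2 (Sum.inr 0) ^ n ∈
      Ideal.ofList [vars k 2 (Sum.inl 0), F, vars k 2 (Sum.inr 1)] ⊔ Ideal.span {G} := by
    have hm := hmem [vars k 2 (Sum.inl 0), F, vars k 2 (Sum.inr 1)] G
    exact exists_x_pow_mem ht hst hη (hm F (by simp)) (hm _ (by simp)) (hm _ (by simp))
      (hm G (by simp)) hρ
  have r2 := isWeaklyRegular_exchange r1 hn₁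
  have r3 := perm_regular r2
    (rs' := [vars k 2 (Sum.inl 0), F, G] ++ [vars k 2 (Sum.inr 1)])
    (List.Perm.append_left [vars k 2 (Sum.inl 0), F] (List.Perm.swap _ _ []))
    (by simp [hv1, hv2])
  obtain ⟨n₂, hn₂⟩ : ∃ n, vars k 2 (Sum.inr 1) ^ n ∈
      Ideal.ofList [vars k 2 (Sum.inl 0), F, G] ⊔ Ideal.span {K} := by
    have hm := hmem [vars k 2 (Sum.inl 0), F, G] K
    exact exists_pow_mem_of_forall_mon_mem (I := Ideal.ofList [vars k 2 (Sum.inl 0), F, G] ⊔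
      Ideal.span {K}) ht hst (mon_mem_span_of_slope_mem ht hst (hm G (by simp))
      (hm K (by simp)) (parameters_mem_sup ht hst hη (hm F (by simp)) (hm _ (by simp))) hρ h3) _
  have r4 := isWeaklyRegular_exchange r3 hn₂
  have r5 := perm_regular r4 (rs' := [F, G, K] ++ [vars k 2 (Sum.inl 0)])
    (List.perm_append_comm (l₁ := [vars k 2 (Sum.inl 0)]) (l₂ := [F, G, K]))
    (by simp [hv1, hv2, hv3])
  obtain ⟨n₃, hn₃⟩ : ∃ n, vars k 2 (Sum.inl 0) ^ n ∈
      Ideal.ofList [F, G, K] ⊔ Ideal.span {dx F} := by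
    have hm := hmem [F, G, K] (dx F)
    have hdy : dy F = G + ρ * dx F := by rw [hG, slope]; ring
    refine exists_pow_mem_of_forall_mon_mem (I := Ideal.ofList [F, G, K] ⊔ Ideal.span {dx F})
      ht hst (mon_mem_span_of_dx_dy_cofactor_mem ht hst hη
      (hm F (by simp)) (hm (dx F) (by simp)) ?_ (hm K (by simp)) ha ha0 hb hb0 h4) _
    change dy F ∈ _
    rw [hdy]
    exact add_mem (hm G (by simp)) (Ideal.mul_mem_left _ _ (hm _ (by simp)))
  exact isWeaklyRegular_exchange r5 hn₃

end TwoParameter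


/-! ### The multiplicity of the closure of the degeneracy locus -/

section Multiplicity

theorem comap_map_sup_span {R : Type*} [CommRing R] {F : R} {I : Ideal R} (hF : F ∈ I) (x : R) :
    (I.map (Ideal.Quotient.mk (Ideal.span {F})) ⊔
      Ideal.span {Ideal.Quotient.mk (Ideal.span {F}) x}).comap (Ideal.Quotient.mk _) =
      I ⊔ Ideal.span {x} := by
  have hmap : Ideal.span {Ideal.Quotient.mk (Ideal.span {F}) x} =
      (Ideal.span {x}).map (Ideal.Quotient.mk (Ideal.span {F})) := by
    rw [Ideal.map_span, Set.image_singleton]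
  rw [hmap, ← Ideal.map_sup, Ideal.comap_map_of_surjective _ Ideal.Quotient.mk_surjective,
    ← RingHom.ker_eq_comap_bot, Ideal.mk_ker, sup_eq_left, Ideal.span_singleton_le_iff_mem]
  exact Ideal.mem_sup_left hF

variable {k : Type*} [Field k] {s t : ℕ} {η : Fin 2 → MvPowerSeries (Fin 2) k}

/-- Multiplicity of the complete intersection given by the slope and the cofactor. -/
theorem edim_eq_of_comap_eq [CharZero k] (ht : 2 ≤ t) (hst : t ≤ s)
    (hη : constantCoeff (η 1) ≠ 0)
    {ρ σ : BigRing k 2} (hρ : value k 2 ρ ≠ 0)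
    (h3 : s = t → (-value k 2 ρ) ^ t ≠ 1) {I : Ideal (TotalRing (family s t η))}
    (hI : I.comap (Ideal.Quotient.mk _) = Ideal.span {family s t η, slope (family s t η) ρ,
      cofactor (family s t η) ρ σ, vars k 2 (Sum.inl 0)}) :
    edim k (TotalRing (family s t η) ⧸ I) = (((t - 2) * (s - 1) : ℕ) : ℕ∞) := by
  apply le_antisymm
  · refine (edim_le_of_top_le_span_sup_ker (k := k) (projQuot_surjective (Ideal.span {family s t η}) I)
      (stdMon_finite (X := vars k 2) (s - 1) (t - 2)) ?_).trans (Nat.cast_le.2 ?_)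
    · rw [ker_projQuot, hI]
      refine top_le_span_sup_of_forall_mon_mem ht hst (mon_mem_span_of_slope_mem (η := η) (ρ := ρ)
        (σ := σ) ht hst (Ideal.subset_span (by simp)) (Ideal.subset_span (by simp)) ?_ hρ h3)
      exact parameters_mem_sup ht hst hη (Ideal.subset_span (by simp)) (Ideal.subset_span (by simp))
    · rw [mul_comm]
      exact ncard_stdMon_le _ _
  · refine le_edim_of_forall_span (projQuot_surjective (Ideal.span {family s t η}) I)
      fun l e he => ?_
    rw [ker_projQuot, hI] at he
    -- Relative to t_0, t_1, x, y, the orders of t_0, F, G, K are at least 1, 1, s-1 and t-2 times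
    -- the weight of the variable.
    have hprod : ∏ i, (Sum.elim (fun _ => 1) ![s - 1, t - 2] : Fin 2 ⊕ Fin 2 → ℕ) i =
        (t - 2) * (s - 1) := by
      simp [Fintype.prod_sum_type, mul_comm]
    rw [← hprod]
    refine prod_le_of_forall_span (k := k) (X := vars k 2) (wts_pos ht hst) (linearIndependent_mon
      (wts_pos ht hst)) fun N => ⟨Sum.elim ![vars k 2 (Sum.inl 0), family s t η]
        ![slope (family s t η) ρ, cofactor (family s t η) ρ σ], ?_, e, ?_⟩
    · intro i
      rcases i with i | i
      · fin_cases i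
        · simpa [wts] using X_inl_mem_wIdeal (X := vars k 2) (s := s) (t := t) 0
        · simpa [wts] using family_mem_wIdeal η ht hst
      · fin_cases i
        · simpa [wts] using slope_mem_wIdeal η ρ
        · simpa [wts] using cofactor_mem_wIdeal η ht hst ρ σ
    · refine he.trans (sup_le_sup_left (Submodule.restrictScalars_mono k (le_sup_of_le_left
        (Ideal.span_mono ?_))) _)
      rintro _ (rfl | rfl | rfl | rfl)
      exacts [⟨Sum.inl 1, rfl⟩, ⟨Sum.inr 0, rfl⟩, ⟨Sum.inr 1, rfl⟩, ⟨Sum.inl 0, rfl⟩]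

theorem singIdeal_eq_map {r : ℕ} (F : BigRing k r) :
    singIdeal F = (Ideal.span {dx F, dy F}).map (Ideal.Quotient.mk (Ideal.span {F})) := by
  rw [Ideal.map_span, singIdeal]
  congr 1
  ext z
  simp [Set.image_pair, eq_comm]

/-- The ideal of the closure of the degeneracy locus. -/
theorem closureIdeal_degeneracyIdeal [CharZero k] (ht : 2 ≤ t) (hst : t ≤ s)
    (hη : constantCoeff (η 1) ≠ 0)
    {g : Fin 2 → MvPowerSeries (Fin 2 ⊕ Fin 2) (MvPowerSeries (Fin 2) k)} {ρ σ : BigRing k 2}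
    (hspan : Ideal.span {family s t η, minor (family s t η) g 0 1, minor (family s t η) g 0 2,
      minor (family s t η) g 1 2} = Ideal.span {family s t η, slope (family s t η) ρ,
        dx (family s t η) * cofactor (family s t η) ρ σ})
    (hreg : ∀ z, dx (family s t η) * z ∈ Ideal.span {family s t η, slope (family s t η) ρ,
        cofactor (family s t η) ρ σ} → z ∈ Ideal.span {family s t η, slope (family s t η) ρ,
        cofactor (family s t η) ρ σ}) :
    closureIdeal (degeneracyIdeal (TotalRing (family s t η))
      (fun i => (Ideal.Quotient.mk _ (g i) : PrincipalParts (family s t η) 3)))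
      (singIdeal (family s t η)) = (Ideal.span {family s t η, slope (family s t η) ρ,
        cofactor (family s t η) ρ σ}).map (Ideal.Quotient.mk _) := by
  have hD := comap_degeneracyIdeal_of_isWeaklyRegular (isWeaklyRegular_family_two ht hst η hη) g
  rw [hspan] at hD
  set F := family s t η with hF
  set G := slope F ρ with hG
  set K := cofactor F ρ σ with hK
  set D := degeneracyIdeal (TotalRing F) (fun i => (Ideal.Quotient.mk _ (g i) : PrincipalParts F 3))
    with hDdef
  have hDmap : D = (Ideal.span {F, G, dx F * K}).map (Ideal.Quotient.mk _) := by
    rw [← hD, Ideal.map_comap_of_surjective _ Ideal.Quotient.mk_surjective]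
  have hcomap : ((Ideal.span {F, G, K}).map (Ideal.Quotient.mk (Ideal.span {F}))).comap
      (Ideal.Quotient.mk _) = Ideal.span {F, G, K} := by
    rw [Ideal.comap_map_of_surjective _ Ideal.Quotient.mk_surjective, ← RingHom.ker_eq_comap_bot,
      Ideal.mk_ker, sup_eq_left]
    exact Ideal.span_mono (by simp)
  refine closureIdeal_eq_of_mul_le (x := Ideal.Quotient.mk _ (dx F)) ?_ ?_ ?_ ?_
  · exact Ideal.subset_span ⟨0, rfl⟩
  · rw [hDmap]
    refine Ideal.map_mono ?_
    rw [Ideal.span_le]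
    have h : ∀ a ∈ ({F, G, K} : Set (BigRing k 2)), a ∈ Ideal.span {F, G, K} :=
      fun a ha => Ideal.subset_span ha
    rintro _ (rfl | rfl | rfl)
    · exact h F (by simp)
    · exact h G (by simp)
    · exact Ideal.mul_mem_left _ _ (h K (by simp))
  · intro z hz
    obtain ⟨z, rfl⟩ := Ideal.Quotient.mk_surjective z
    rw [← map_mul, ← Ideal.mem_comap, hcomap] at hz
    rw [← Ideal.mem_comap, hcomap]
    exact hreg z hz
  · rw [singIdeal_eq_map, ← Ideal.map_mul, hDmap]
    refine Ideal.map_mono ?_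
    rw [Ideal.span_mul_span', Ideal.span_le]
    have h : ∀ a ∈ ({F, G, dx F * K} : Set (BigRing k 2)), a ∈ Ideal.span {F, G, dx F * K} :=
      fun a ha => Ideal.subset_span ha
    rintro _ ⟨a, ha, b, hb, rfl⟩
    change a * b ∈ Ideal.span {F, G, dx F * K}
    rcases ha with rfl | rfl | rfl
    · exact Ideal.mul_mem_right _ _ (h F (by simp))
    · exact Ideal.mul_mem_right _ _ (h G (by simp))
    · rcases hb with rfl | rfl
      · rw [show K * dx F = dx F * K from mul_comm _ _]
        exact h _ (Or.inr (Or.inr rfl))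
      -- F_y K lies in the degeneracy ideal because F_y = G + ρ F_x; this is why the whole singular
      -- ideal carries (F, G, K) into it.
      · rw [show K * dy F = K * G + ρ * (dx F * K) by rw [hG, slope]; ring]
        exact add_mem (Ideal.mul_mem_left _ _ (h G (by simp)))
          (Ideal.mul_mem_left _ _ (h _ (by simp)))

/-- For t = 2 the cofactor K is a unit and the ideal is everything, so `a` and `b` are needed only
for t ≥ 3, where the regular sequence applies. -/
theorem mem_of_dx_mul_mem [CharZero k] (ht : 2 ≤ t) (hst : t ≤ s)
    (hη : constantCoeff (η 1) ≠ 0)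
    {ρ σ : BigRing k 2} {a b : k}
    (ha : a = constantCoeff (pderiv k 0 (η 0)) * constantCoeff (η 1) -
      constantCoeff (pderiv k 0 (η 1)) * constantCoeff (η 0)) (ha0 : t ≠ 2 → a ≠ 0)
    (hb : b = constantCoeff (pderiv k 1 (η 0)) * constantCoeff (η 1) -
      constantCoeff (pderiv k 1 (η 1)) * constantCoeff (η 0)) (hb0 : t ≠ 2 → b ≠ 0)
    (hρ : value k 2 ρ ≠ 0) (h3 : s = t → (-value k 2 ρ) ^ t ≠ 1)
    (h4 : s = t → t ≠ 2 → (-(a / b)) ^ (t - 2) * (value k 2 ρ ^ 2) ^ (t - 1) ≠ 1)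
    (z : BigRing k 2) (hz : dx (family s t η) * z ∈ Ideal.span {family s t η,
      slope (family s t η) ρ, cofactor (family s t η) ρ σ}) :
    z ∈ Ideal.span {family s t η, slope (family s t η) ρ, cofactor (family s t η) ρ σ} := by
  rcases eq_or_ne t 2 with h2 | h2
  · have hu : IsUnit (cofactor (family s t η) ρ σ) := by
      rw [isUnit_iff_value, value_cofactor ht hst]
      subst h2
      rcases eq_or_lt_of_le hst with rfl | hlt
      · have h5 := h3 rfl
        rw [neg_sq] at h5
        intro h6
        norm_num at h6
        exact h5 (by linear_combination (-1 / 2) * h6)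
      · rw [zero_pow (by omega : s - 2 ≠ 0)]
        norm_num
    rw [Ideal.eq_top_of_isUnit_mem _ (Ideal.subset_span (by simp)) hu]
    trivial
  · have hr := isWeaklyRegular_slope_cofactor ht hst hη (by omega) (σ := σ) ha (ha0 h2) hb (hb0 h2)
      hρ h3 (fun h => h4 h h2)
    have hr' := ((isWeaklyRegular_concat_iff [family s t η, slope (family s t η) ρ,
      cofactor (family s t η) ρ σ] (dx (family s t η))).1 hr).2 z
    rw [ofList_triple] at hr'
    exact hr' hz

/-- Here ρ(0) = q₁/q₀. The conditions on ρ(0) are stated with denominators cleared, so that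
genericity of the pair is the nonvanishing of one polynomial in linear coordinates. -/
theorem edim_closureIdeal [CharZero k] (ht : 2 ≤ t) (hst : t ≤ s)
    (hη : constantCoeff (η 1) ≠ 0)
    {g : Fin 2 → MvPowerSeries (Fin 2 ⊕ Fin 2) (MvPowerSeries (Fin 2) k)}
    {p q₀ q₁ a b : k}
    (ha : a = constantCoeff (pderiv k 0 (η 0)) * constantCoeff (η 1) -
      constantCoeff (pderiv k 0 (η 1)) * constantCoeff (η 0)) (ha0 : t ≠ 2 → a ≠ 0)
    (hb : b = constantCoeff (pderiv k 1 (η 0)) * constantCoeff (η 1) -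
      constantCoeff (pderiv k 1 (η 1)) * constantCoeff (η 0)) (hb0 : t ≠ 2 → b ≠ 0)
    (hp : p = value k 2 (diag _ (g 0))) (hp0 : p ≠ 0)
    (hq₀ : q₀ = p * value k 2 (diag _ (pderiv _ (Sum.inr 0) (g 1))) -
      value k 2 (diag _ (g 1)) * value k 2 (diag _ (pderiv _ (Sum.inr 0) (g 0)))) (hq₀0 : q₀ ≠ 0)
    (hq₁ : q₁ = p * value k 2 (diag _ (pderiv _ (Sum.inr 1) (g 1))) -
      value k 2 (diag _ (g 1)) * value k 2 (diag _ (pderiv _ (Sum.inr 1) (g 0)))) (hq₁0 : q₁ ≠ 0)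
    (h3 : (-q₁) ^ t ≠ q₀ ^ t)
    (h4 : (-a) ^ (t - 2) * (q₁ ^ 2) ^ (t - 1) ≠ b ^ (t - 2) * (q₀ ^ 2) ^ (t - 1)) :
    edim k (TotalRing (family s t η) ⧸ (closureIdeal (degeneracyIdeal (TotalRing (family s t η))
      (fun i => (Ideal.Quotient.mk _ (g i) : PrincipalParts (family s t η) 3)))
      (singIdeal (family s t η)) ⊔ Ideal.span {Ideal.Quotient.mk _ (C (X 0))})) =
      (((t - 2) * (s - 1) : ℕ) : ℕ∞) := by
  obtain ⟨ρ, σ, hρ, hspan⟩ := exists_span_minors_eq (family s t η) (g := g)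
    (isUnit_iff_value.2 (by rw [← hp]; exact hp0))
    (isUnit_iff_value.2 (by rw [map_sub, map_mul, map_mul, ← hp, ← hq₀]; exact hq₀0))
  have hval := congrArg (value k 2) hρ
  simp only [map_mul, map_sub, ← hp, ← hq₀, ← hq₁] at hval
  have hρ0 : value k 2 ρ ≠ 0 := by
    intro h
    rw [h, zero_mul] at hval
    exact hq₁0 hval.symm
  have h3' : s = t → (-value k 2 ρ) ^ t ≠ 1 := by
    intro _ h
    refine h3 ?_
    rw [← hval, ← neg_mul, mul_pow, h, one_mul]
  have h4' : s = t → t ≠ 2 → (-(a / b)) ^ (t - 2) * (value k 2 ρ ^ 2) ^ (t - 1) ≠ 1 := by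
    intro _ h2 h
    refine h4 ?_
    have hb' : b ^ (t - 2) ≠ 0 := pow_ne_zero _ (hb0 h2)
    rw [← neg_div, div_pow, div_mul_eq_mul_div, div_eq_one_iff_eq hb'] at h
    rw [← hval, mul_pow, mul_pow, ← mul_assoc, h]
  have hcl := closureIdeal_degeneracyIdeal ht hst hη hspan
    (mem_of_dx_mul_mem ht hst hη ha ha0 hb hb0 hρ0 h3' h4')
  refine edim_eq_of_comap_eq ht hst hη (ρ := ρ) (σ := σ) hρ0 h3' ?_
  have hset : ({family s t η, slope (family s t η) ρ, cofactor (family s t η) ρ σ} : Set _) ∪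
      {C (X 0)} = {family s t η, slope (family s t η) ρ, cofactor (family s t η) ρ σ,
        vars k 2 (Sum.inl 0)} := by
    simp only [Set.insert_union, Set.singleton_union]
    rfl
  rw [hcl, comap_map_sup_span (Ideal.subset_span (by simp)), ← Ideal.span_union, hset]

end Multiplicity


/-! ### General members -/

section General

variable {k : Type*} [Field k]

theorem holdsForGeneral_of_eval_ne_zero {V ι : Type*} [AddCommGroup V] [Module k V] [Fintype ι]
    (L : V →ₗ[k] (ι → k)) (p : MvPolynomial ι k) {Q : V → Prop}
    (hp : ∃ v, MvPolynomial.eval (L v) p ≠ 0)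
    (h : ∀ v, MvPolynomial.eval (L v) p ≠ 0 → Q v) : HoldsForGeneral k Q := by
  let e := Fintype.equivFin ι
  have heval : ∀ v, MvPolynomial.eval ((LinearMap.funLeft k k e.symm ∘ₗ L) v)
      (MvPolynomial.rename e p) = MvPolynomial.eval (L v) p := by
    intro v
    rw [MvPolynomial.eval_rename]
    congr 2
    funext i
    simp [LinearMap.funLeft_apply]
  refine ⟨Fintype.card ι, LinearMap.funLeft k k e.symm ∘ₗ L, MvPolynomial.rename e p, ?_, ?_⟩
  · obtain ⟨v, hv⟩ := hp
    exact ⟨v, by rwa [heval]⟩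
  · intro v hv
    rw [heval] at hv
    exact h v hv

/-- The coordinates of pairs of elements with respect to three linear forms. -/
def pairCoords {V W : Type*} [AddCommGroup V] [Module k V] [AddCommGroup W] [Module k W]
    (φ : V →ₗ[k] W) (ℓ : Fin 3 → W →ₗ[k] k) : (Fin 2 → V) →ₗ[k] (Fin 2 × Fin 3 → k) :=
  LinearMap.pi fun i => ℓ i.2 ∘ₗ φ ∘ₗ LinearMap.proj i.1

@[simp] theorem pairCoords_apply {V W : Type*} [AddCommGroup V] [Module k V] [AddCommGroup W]
    [Module k W] (φ : V →ₗ[k] W) (ℓ : Fin 3 → W →ₗ[k] k) (v : Fin 2 → V) (i : Fin 2 × Fin 3) :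
    pairCoords φ ℓ v i = ℓ i.2 (φ (v i.1)) := rfl

/-! ### First-order jets at the origin as linear coordinates on principal parts. -/

section PrincipalParts

variable {r : ℕ}

/-- The value at the origin as a linear form. -/
def valueForm (k : Type*) [Field k] (r : ℕ) : BigRing k r →ₗ[k] k where
  toFun := value k r
  map_add' := map_add _
  map_smul' c g := by
    rw [Algebra.smul_def, map_mul, value_algebraMap, smul_eq_mul, RingHom.id_apply]

/-- The coefficients of `1`, `u` and `v` as linear forms. -/
def jetForm (k : Type*) [Field k] (r : ℕ) :
    Fin 3 → MvPowerSeries (Fin 2 ⊕ Fin 2) (MvPowerSeries (Fin r) k) →ₗ[k] k :=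
  ![valueForm k r ∘ₗ (diag (MvPowerSeries (Fin r) k)).toLinearMap.restrictScalars k,
    valueForm k r ∘ₗ (diag (MvPowerSeries (Fin r) k)).toLinearMap.restrictScalars k ∘ₗ
      (pderiv (MvPowerSeries (Fin r) k) (Sum.inr 0)).toLinearMap.restrictScalars k,
    valueForm k r ∘ₗ (diag (MvPowerSeries (Fin r) k)).toLinearMap.restrictScalars k ∘ₗ
      (pderiv (MvPowerSeries (Fin r) k) (Sum.inr 1)).toLinearMap.restrictScalars k]

theorem jetForm_zero (g : MvPowerSeries (Fin 2 ⊕ Fin 2) (MvPowerSeries (Fin r) k)) :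
    jetForm k r 0 g = value k r (diag _ g) := rfl

theorem jetForm_one (g : MvPowerSeries (Fin 2 ⊕ Fin 2) (MvPowerSeries (Fin r) k)) :
    jetForm k r 1 g = value k r (diag _ (pderiv _ (Sum.inr 0) g)) := rfl

theorem jetForm_two (g : MvPowerSeries (Fin 2 ⊕ Fin 2) (MvPowerSeries (Fin r) k)) :
    jetForm k r 2 g = value k r (diag _ (pderiv _ (Sum.inr 1) g)) := rfl

theorem jetForm_diagEq (i : Fin 2) : jetForm k r 0 (diagEq _ i) = 0 ∧
    jetForm k r 1 (diagEq _ i) = (if i = 0 then 1 else 0) ∧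
    jetForm k r 2 (diagEq _ i) = (if i = 1 then 1 else 0) := by
  rw [jetForm_zero, jetForm_one, jetForm_two, diag_diagEq, map_zero]
  fin_cases i <;> simp [pderiv_diagEq_self, pderiv_diagEq_of_ne]

theorem jetForm_diagEq_add_smul (ρ : k) :
    jetForm k r 0 (diagEq _ 0 + ρ • diagEq _ 1) = 0 ∧
    jetForm k r 1 (diagEq _ 0 + ρ • diagEq _ 1) = 1 ∧
    jetForm k r 2 (diagEq _ 0 + ρ • diagEq _ 1) = ρ := by
  obtain ⟨h1, h2, h3⟩ := jetForm_diagEq (k := k) (r := r) 0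
  obtain ⟨h4, h5, h6⟩ := jetForm_diagEq (k := k) (r := r) 1
  simp only [map_add, map_smul, h1, h2, h3, h4, h5, h6]
  simp

/-- F and its first derivatives vanish at the origin, so no generator contributes to the value or to
the u- and v-derivatives there. Hence the first-order coordinates descend to the quotient. -/
theorem value_diag_eq_zero_of_mem {F : BigRing k r} (hF : value k r F = 0)
    (hd : ∀ i, value k r (pderiv _ i F) = 0)
    {g : MvPowerSeries (Fin 2 ⊕ Fin 2) (MvPowerSeries (Fin r) k)}
    (hg : g ∈ principalPartsIdeal F 3) :
    value k r (diag _ g) = 0 ∧ ∀ i, value k r (diag _ (pderiv _ (Sum.inr i) g)) = 0 := by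
  let N : Ideal (MvPowerSeries (Fin 2 ⊕ Fin 2) (MvPowerSeries (Fin r) k)) :=
    { carrier := {g | value k r (diag _ g) = 0 ∧
        ∀ i, value k r (diag _ (pderiv _ (Sum.inr i) g)) = 0}
      add_mem' := by
        rintro a b ⟨ha, ha'⟩ ⟨hb, hb'⟩
        refine ⟨by rw [map_add, map_add, ha, hb, add_zero], fun i => ?_⟩
        rw [map_add, map_add, map_add, ha', hb', add_zero]
      zero_mem' := by simp
      smul_mem' := by
        rintro c a ⟨ha, ha'⟩
        refine ⟨by rw [smul_eq_mul, map_mul, map_mul, ha, mul_zero], fun i => ?_⟩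
        rw [smul_eq_mul, Derivation.leibniz, smul_eq_mul, smul_eq_mul]
        simp only [map_add, map_mul, ha, ha', mul_zero, zero_mul, add_zero] }
  suffices h : principalPartsIdeal F 3 ≤ N from h hg
  rw [principalPartsIdeal_eq]
  refine sup_le ?_ ?_
  · rw [Ideal.span_le]
    rintro _ (rfl | rfl)
    · refine ⟨by rw [diag_rename_inl, hF], fun i => ?_⟩
      rw [show pderiv (MvPowerSeries (Fin r) k) (Sum.inr i) (rename Sum.inl F) = 0 by simp]
      simp
    · refine ⟨by rw [diag_rename_inr, hF], fun i => ?_⟩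
      rw [pderiv_inr_rename_inr, diag_rename_inr, hd]
  · intro g hg
    refine ⟨?_, fun i => ?_⟩
    · rw [diag_eq_zero_of_mem (Ideal.pow_le_self (by norm_num) hg), map_zero]
    · rw [diag_eq_zero_of_mem (Ideal.pow_le_self (by norm_num)
        (derivation_mem_pow (pderiv (MvPowerSeries (Fin r) k) (Sum.inr i)) _ 2 hg)), map_zero]

theorem principalPartsIdeal_le_ker_jetForm {F : BigRing k r} (hF : value k r F = 0)
    (hd : ∀ i, value k r (pderiv _ i F) = 0) (i : Fin 3) :
    (principalPartsIdeal F 3).restrictScalars k ≤ LinearMap.ker (jetForm k r i) := by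
  intro g hg
  obtain ⟨h0, h1⟩ := value_diag_eq_zero_of_mem hF hd hg
  fin_cases i
  exacts [h0, h1 0, h1 1]

/-- The linear forms on principal parts induced by the coefficients of `1`, `u` and `v`. -/
def principalPartsForm {F : BigRing k r} (hF : value k r F = 0)
    (hd : ∀ i, value k r (pderiv _ i F) = 0) (i : Fin 3) : PrincipalParts F 3 →ₗ[k] k :=
  (Submodule.liftQ _ (jetForm k r i) (principalPartsIdeal_le_ker_jetForm hF hd i)) ∘ₗ
    (Submodule.Quotient.restrictScalarsEquiv k (principalPartsIdeal F 3)).symm.toLinearMap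

theorem principalPartsForm_mk {F : BigRing k r} (hF : value k r F = 0)
    (hd : ∀ i, value k r (pderiv _ i F) = 0) (i : Fin 3)
    (g : MvPowerSeries (Fin 2 ⊕ Fin 2) (MvPowerSeries (Fin r) k)) :
    principalPartsForm hF hd i (Ideal.Quotient.mk _ g) = jetForm k r i g := rfl

end PrincipalParts

/-- Supplies a point where the genericity polynomial is nonzero: a product of nonzero polynomials in
one variable has a nonroot in an infinite field. -/
theorem exists_general_slope [Infinite k] {t : ℕ} (ht : 2 ≤ t) (a : k) {b : k} (hb : b ≠ 0) :
    ∃ ρ : k, ρ ≠ 0 ∧ (-ρ) ^ t ≠ 1 ∧ a * (ρ ^ 2) ^ (t - 1) ≠ b := by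
  let g : Polynomial k := Polynomial.X * ((-Polynomial.X) ^ t - 1) *
    (Polynomial.C a * (Polynomial.X ^ 2) ^ (t - 1) - Polynomial.C b)
  have hg : g ≠ 0 := by
    refine mul_ne_zero (mul_ne_zero Polynomial.X_ne_zero fun h => ?_) fun h => ?_
    · have := congrArg (Polynomial.eval 0) h
      simp [show t ≠ 0 by omega] at this
    · have := congrArg (Polynomial.eval 0) h
      simp [show t - 1 ≠ 0 by omega] at this
      exact hb this
  have : ∃ ρ, g.eval ρ ≠ 0 := by
    by_contra! hall
    exact hg (Polynomial.funext fun ρ => by rw [hall, Polynomial.eval_zero])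
  obtain ⟨ρ, hρ⟩ := this
  simp only [g, Polynomial.eval_mul, Polynomial.eval_sub, Polynomial.eval_pow, Polynomial.eval_neg,
    Polynomial.eval_X, Polynomial.eval_one, Polynomial.eval_C, mul_ne_zero_iff, sub_ne_zero] at hρ
  exact ⟨ρ, hρ.1.1, hρ.1.2, hρ.2⟩

section TwoParameter

variable {s t : ℕ} {η : Fin 2 → MvPowerSeries (Fin 2) k}

theorem holdsForGeneral_edim_closureIdeal [CharZero k] (ht : 2 ≤ t) (hst : t ≤ s)
    (hη : constantCoeff (η 1) ≠ 0)
    {a b : k}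
    (ha : a = constantCoeff (pderiv k 0 (η 0)) * constantCoeff (η 1) -
      constantCoeff (pderiv k 0 (η 1)) * constantCoeff (η 0)) (ha0 : t ≠ 2 → a ≠ 0)
    (hb : b = constantCoeff (pderiv k 1 (η 0)) * constantCoeff (η 1) -
      constantCoeff (pderiv k 1 (η 1)) * constantCoeff (η 0)) (hb0 : t ≠ 2 → b ≠ 0) :
    HoldsForGeneral k fun τ : Fin 2 → PrincipalParts (family s t η) 3 =>
      edim k (TotalRing (family s t η) ⧸ (closureIdeal (degeneracyIdeal (TotalRing (family s t η)) τ)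
        (singIdeal (family s t η)) ⊔ Ideal.span {Ideal.Quotient.mk _ (C (X 0))})) =
        (((t - 2) * (s - 1) : ℕ) : ℕ∞) := by
  have hF := value_family η ht hst
  have hd : ∀ i, value k 2 (pderiv _ i (family s t η)) = 0 := by
    intro i
    fin_cases i
    exacts [value_dx_family η ht hst, value_dy_family η ht]
  let x : Fin 2 → Fin 3 → MvPolynomial (Fin 2 × Fin 3) k := fun i j => MvPolynomial.X (i, j)
  let q : Fin 3 → MvPolynomial (Fin 2 × Fin 3) k := fun j => x 0 0 * x 1 j - x 1 0 * x 0 j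
  have hbpow : b ^ (t - 2) ≠ 0 := by
    rcases eq_or_ne t 2 with rfl | h2
    · simp
    · exact pow_ne_zero _ (hb0 h2)
  refine holdsForGeneral_of_eval_ne_zero
    (pairCoords LinearMap.id (principalPartsForm hF hd))
    (x 0 0 * q 1 * q 2 * ((-q 2) ^ t - q 1 ^ t) * (MvPolynomial.C ((-a) ^ (t - 2)) *
      (q 2 ^ 2) ^ (t - 1) - MvPolynomial.C (b ^ (t - 2)) * (q 1 ^ 2) ^ (t - 1))) ?_ ?_
  · obtain ⟨ρ, hρ0, hρ1, hρ2⟩ := exists_general_slope ht ((-a) ^ (t - 2)) hbpow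
    let T := MvPowerSeries (Fin 2) k
    -- For this pair the coordinates are p = 1, q₀ = 1 and q₁ = ρ, so the conditions reduce to those
    -- on ρ alone.
    let g : Fin 2 → MvPowerSeries (Fin 2 ⊕ Fin 2) T := ![1, diagEq T 0 + ρ • diagEq T 1]
    have e00 : jetForm k 2 0 (g 0) = 1 := by simp [jetForm_zero, g]
    have e01 : jetForm k 2 1 (g 0) = 0 := by simp [jetForm_one, g]
    have e02 : jetForm k 2 2 (g 0) = 0 := by simp [jetForm_two, g]
    obtain ⟨e10, e11, e12⟩ : jetForm k 2 0 (g 1) = 0 ∧ jetForm k 2 1 (g 1) = 1 ∧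
      jetForm k 2 2 (g 1) = ρ := jetForm_diagEq_add_smul ρ
    refine ⟨fun i => Ideal.Quotient.mk _ (g i), ?_⟩
    simp only [x, q, map_mul, map_sub, map_pow, map_neg, MvPolynomial.eval_X, MvPolynomial.eval_C,
      pairCoords_apply, LinearMap.id_apply, principalPartsForm_mk, e00, e01, e02, e10, e11, e12]
    simp only [mul_one, one_mul, mul_zero, sub_zero, one_pow, mul_ne_zero_iff, sub_ne_zero]
    exact ⟨⟨hρ0, hρ1⟩, hρ2⟩
  · intro τ hτ
    obtain ⟨g, rfl⟩ := exists_lift τ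
    simp only [x, q, map_mul, map_sub, map_pow, map_neg, MvPolynomial.eval_X, MvPolynomial.eval_C,
      pairCoords_apply, LinearMap.id_apply, principalPartsForm_mk, mul_ne_zero_iff, sub_ne_zero,
      jetForm_zero, jetForm_one, jetForm_two] at hτ
    obtain ⟨⟨⟨⟨h1, h2⟩, h3⟩, h4⟩, h5⟩ := hτ
    exact edim_closureIdeal ht hst hη ha ha0 hb hb0 rfl h1 rfl (sub_ne_zero.2 h2) rfl
      (sub_ne_zero.2 h3) h4 h5

end TwoParameter

end General

/-! ### General two-parameter deformations -/

section Main

variable {k : Type*} [Field k] {f : MvPowerSeries (Fin 2) k} {s t d : ℕ}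
  {δ : Fin d → MvPowerSeries (Fin 2) k}

/-- The coefficients of `1`, `x` and `y` as linear forms. -/
def coeffForm (k : Type*) [Field k] : Fin 3 → MvPowerSeries (Fin 2) k →ₗ[k] k :=
  ![coeff 0, coeff 0 ∘ₗ (pderiv k 0).toLinearMap, coeff 0 ∘ₗ (pderiv k 1).toLinearMap]

theorem coeffForm_one (g : MvPowerSeries (Fin 2) k) :
    coeffForm k 1 g = constantCoeff (pderiv k 0 g) := rfl

theorem coeffForm_two (g : MvPowerSeries (Fin 2) k) :
    coeffForm k 2 g = constantCoeff (pderiv k 1 g) := rfl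

/-- For t ≥ 3 the series f, f_x, f_y lie in the square of the maximal ideal, so the linear
coefficients of a representative are determined by its class in Def¹. -/
theorem constantCoeff_pderiv_eq_zero_of_mem (ht : 3 ≤ t) (hst : t ≤ s) (hf : f = X 1 ^ t - X 0 ^ s)
    {z : MvPowerSeries (Fin 2) k} (hz : z ∈ Ideal.span {f, pderiv k 0 f, pderiv k 1 f}) (i : Fin 2) :
    constantCoeff (pderiv k i z) = 0 := by
  set M : Ideal (MvPowerSeries (Fin 2) k) := Ideal.span {X 0, X 1} with hM
  have h0 : (X 0 : MvPowerSeries (Fin 2) k) ∈ M := Ideal.subset_span (by simp)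
  have h1 : (X 1 : MvPowerSeries (Fin 2) k) ∈ M := Ideal.subset_span (by simp)
  have hpow : ∀ {x : MvPowerSeries (Fin 2) k} {n : ℕ}, x ∈ M → 2 ≤ n → x ^ n ∈ M ^ 2 :=
    fun hx hn => Ideal.pow_le_pow_right hn (Ideal.pow_mem_pow hx _)
  have h : Ideal.span {f, pderiv k 0 f, pderiv k 1 f} ≤ M ^ 2 := by
    rw [Ideal.span_le, pderiv_zero_quasiHomogeneous hf, pderiv_one_quasiHomogeneous hf, hf]
    rintro _ (rfl | rfl | rfl)
    · exact sub_mem (hpow h1 (by omega)) (hpow h0 (by omega))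
    · exact neg_mem (Ideal.mul_mem_left _ _ (hpow h0 (by omega)))
    · exact Ideal.mul_mem_left _ _ (hpow h1 (by omega))
  have h2 := derivation_mem_pow (pderiv k i) M 1 (h hz)
  rw [pow_one] at h2
  exact (mem_span_X_pair_iff _).1 h2

theorem numLimitingTypeA_three [CharZero k] (ht : 2 ≤ t) (hst : t ≤ s) (hf : f = X 1 ^ t - X 0 ^ s)
    (hδ : IsDefBasis f δ) : NumLimitingTypeA f δ 3 (((t - 2) * (s - 1) : ℕ) : ℕ∞) := by
  classical
  let x : Fin 2 → Fin 3 → MvPolynomial (Fin 2 × Fin 3) k := fun i j => MvPolynomial.X (i, j)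
  refine holdsForGeneral_of_eval_ne_zero
    (pairCoords (Fintype.linearCombination k δ) (coeffForm k))
    -- For t = 2 the Tjurina ideal contains y, so linear coefficients cannot be prescribed through a
    -- basis of Def¹; there the cofactor is a unit and they are not needed.
    (x 1 0 * (if t = 2 then 1 else (x 0 1 * x 1 0 - x 1 1 * x 0 0) *
      (x 0 2 * x 1 0 - x 1 2 * x 0 0))) ?_ ?_
  · obtain ⟨c, hc⟩ := exists_sum_smul_sub_mem hδ 1
    obtain ⟨c', hc'⟩ := exists_sum_smul_sub_mem hδ (X 0 + X 1)
    -- The sample deformation has η_0 ≡ x + y and η_1 ≡ 1, which for t ≥ 3 makes both determinants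
    -- equal to 1.
    refine ⟨![c', c], ?_⟩
    have e10 : coeffForm k 0 (∑ i, c i • δ i) = 1 := by
      have h1 := constantCoeff_eq_zero_of_mem ht hst hf hc
      rwa [map_sub, map_one, sub_eq_zero] at h1
    split_ifs with h2
    · simp [x, Fintype.linearCombination_apply, e10]
    · have h3 : 3 ≤ t := by omega
      have e11 : coeffForm k 1 (∑ i, c i • δ i) = 0 := by
        have h1 := constantCoeff_pderiv_eq_zero_of_mem h3 hst hf hc 0
        rw [map_sub, map_sub, sub_eq_zero] at h1
        rw [coeffForm_one, h1]
        simp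
      have e12 : coeffForm k 2 (∑ i, c i • δ i) = 0 := by
        have h1 := constantCoeff_pderiv_eq_zero_of_mem h3 hst hf hc 1
        rw [map_sub, map_sub, sub_eq_zero] at h1
        rw [coeffForm_two, h1]
        simp
      have e01 : coeffForm k 1 (∑ i, c' i • δ i) = 1 := by
        have h1 := constantCoeff_pderiv_eq_zero_of_mem h3 hst hf hc' 0
        rw [map_sub, map_sub, sub_eq_zero] at h1
        rw [coeffForm_one, h1, map_add]
        simp
      have e02 : coeffForm k 2 (∑ i, c' i • δ i) = 1 := by
        have h1 := constantCoeff_pderiv_eq_zero_of_mem h3 hst hf hc' 1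
        rw [map_sub, map_sub, sub_eq_zero] at h1
        rw [coeffForm_two, h1, map_add]
        simp
      simp [x, Fintype.linearCombination_apply, e10, e11, e12, e01, e02]
  · intro a hv
    simp only [x, map_mul, MvPolynomial.eval_X, pairCoords_apply, mul_ne_zero_iff] at hv
    set η : Fin 2 → MvPowerSeries (Fin 2) k := fun j => ∑ i, a j i • δ i with hη
    have hη1 : constantCoeff (η 1) ≠ 0 := hv.1
    have hne : t ≠ 2 → _ ∧ _ := fun h2 => by
      have h3 := hv.2
      rw [if_neg h2, map_mul, mul_ne_zero_iff] at h3
      simpa only [map_sub, map_mul, MvPolynomial.eval_X, pairCoords_apply] using h3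
    have h : ∀ F, F = family s t η → HoldsForGeneral k fun τ : Fin 2 → PrincipalParts F 3 =>
        edim k (TotalRing F ⧸ (closureIdeal (degeneracyIdeal (TotalRing F) τ) (singIdeal F) ⊔
          Ideal.span {Ideal.Quotient.mk _ (C (X 0))})) = (((t - 2) * (s - 1) : ℕ) : ℕ∞) := by
      rintro _ rfl
      exact holdsForGeneral_edim_closureIdeal ht hst hη1 rfl (fun h2 => (hne h2).1) rfl
        (fun h2 => (hne h2).2)
    exact h _ (deformation_eq_family hf δ a)

end Main

end

end AutDeg

theorem mainTheorem7 {k : Type*} [Field k] [IsAlgClosed k] [CharZero k] (s t : ℕ)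
    (ht : 2 ≤ t) (hst : t ≤ s) (f : MvPowerSeries (Fin 2) k)
    (hf : f = MvPowerSeries.X 1 ^ t - MvPowerSeries.X 0 ^ s)
    {d : ℕ} (δ : Fin d → MvPowerSeries (Fin 2) k) (hδ : AutDeg.IsDefBasis f δ) :
    AutDeg.autDegTypeA f δ 3 = (((2 * t - 3) * (s - 1) : ℕ) : ℕ∞) ∧
      AutDeg.NumLimitingTypeA f δ 3 (((t - 2) * (s - 1) : ℕ) : ℕ∞) :=
  ⟨AutDeg.autDegTypeA_three ht hst hf hδ, AutDeg.numLimitingTypeA_three ht hst hf hδ⟩
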